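/- Let $d\ge 2$. For $\varepsilon>0$ and $w:\mathbb R^d\to\mathbb C$ put $$e_\varepsilon(w)=\frac{|\nabla w|^2}{2}+\frac{(1-|w|^2)^2}{4\varepsilon^2},$$ where $\nabla w$ is the weak gradient. A solution of (PGL$_\varepsilon$) with initial datum $u^0_\varepsilon\in L^\infty(\mathbb R^d)$ is a function $u_\varepsilon:\mathbb R^d\times[0,\infty)\to\mathbb C$ which is smooth on $\mathbb R^d\times(0,\infty)$, bounded on $\mathbb R^d\times(0,T]$ for every $T>0$, satisfies $$\partial_t u_\varepsilon-\Delta u_\varepsilon=\frac1{\varepsilon^2}u_\varepsilon(1-|u_\varepsilon|^2)\quad\text{on }\mathbb R^d\times(0,\infty),\qquad u_\varepsilon(\cdot,0)=u^0_\varepsilon,$$ and is such that $u_\varepsilon(\cdot,t)\to u_\varepsilon^0$ in $L^1_{\rm loc}(\mathbb R^d)$ as $t\to0^+$. For $M_0>0$, the datum $u_\varepsilon^0$ satisfies $H_1(M_0)$ at the parameter $\varepsilon$ if $u^0_\varepsilon\in L^\infty(\mathbb R^d)$, $u^0_\varepsilon$ is weakly differentiable, and $$\int_{B(x,1)}e_\varepsilon(u_\varepsilon^0)\,dy\le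 M_0|\ln\varepsilon|\qquad\text{for all }x\in\mathbb R^d;$$ a family $(u_\varepsilon^0)_{\varepsilon\in(0,1)}$ satisfies $H_1(M_0)$ if this holds at every $\varepsilon\in(0,1)$. There is a constant $C=C(d)>0$, depending only on $d$, such that the following holds for every $M_0>0$. (i) (Propagation.) Let $\varepsilon>0$ and let $u_\varepsilon$ be a solution of (PGL$_\varepsilon$) whose initial datum satisfies $H_1(M_0)$ at $\varepsilon$. Then for every $T>0$ the function $(x,t)\mapsto u_\varepsilon(x,T+t)$ is a solution of (PGL$_\varepsilon$) whose initial datum $u_\varepsilon(\cdot,T)$ satisfies $H_1(C(1+T)M_0)$ at $\varepsilon$. More precisely, for all $t\ge0$, $y\in\mathbb R^d$ and $R>0$, $$\int_{B(y,R)}e_\varepsilon(u_\varepsilon)(x,t)\,dx\le C(1+R)^d(1+t)M_0|\ln\varepsilon|.$$ (ii) (Compactness.) Let $(u_\varepsilon)_{\varepsilon\in(0,1)}$ be a family of solutions of (PGL$_\varepsilon$) whose initial data satisfy $H_1(M_0)$, and put $$\mu_\varepsilon=\frac{e_\varepsilon(u_\varepsilon)(x,t)}{|\ln\varepsilon|}\,dx\,dt\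 \text{ on }\mathbb R^d\times[0,\infty),\qquad \mu^t_\varepsilon=\frac{e_\varepsilon(u_\varepsilon)(x,t)}{|\ln\varepsilon|}\,dx\ \text{ on }\mathbb R^d .$$ Then there exist a sequence $\varepsilon_m\to0$ in $(0,1)$, a Radon measure $\mu_*$ on $\mathbb R^d\times[0,\infty)$ (finite on compact sets) and, for each $t\ge0$, a Radon measure $\mu^t_*$ on $\mathbb R^d$ such that, as $m\to\infty$, $\mu_{\varepsilon_m}\rightharpoonup\mu_*$ and $\mu^t_{\varepsilon_m}\rightharpoonup\mu^t_*$ for every $t\ge0$, weakly as measures (that is, tested against continuous functions with compact support). Moreover $$\mu_*^t(B(0,R))\le C(1+t)(1+R)^dM_0\qquad\text{for all }R>0,\ t\ge0,$$ and $\mu_*=\mu_*^t\,dt$, that is, $t\mapsto\mu_*^t$ is measurable and $\mu_*(A)=\int_0^\infty\mu_*^t(\{x:(x,t)\in A\})\,dt$ for every Borel set $A\subset\mathbb R^d\times[0,\infty)$. -/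

import Mathlib

open MeasureTheory Filter Topology Set
open scoped NNReal ENNReal ContDiff

noncomputable section

/-- The Euclidean space `ℝ^d`. -/
abbrev Eucl (d : ℕ) : Type := EuclideanSpace ℝ (Fin d)

/-- The classical `i`-th partial derivative of a function on `ℝ^d`. -/
def classicalPartial {d : ℕ} {F : Type*} [NormedAddCommGroup F] [NormedSpace ℝ F]
    (w : Eucl d → F) (i : Fin d) (x : Eucl d) : F :=
  fderiv ℝ w x (EuclideanSpace.single i (1 : ℝ))

/-- `g` is a weak (distributional) gradient of `w`: both are locally integrable, and
`∫ (∂ᵢφ) w = - ∫ φ gᵢ` for all test functions `φ ∈ C_c^∞(ℝ^d)` and all `i`. -/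
def IsWeakGradient {d : ℕ} (w : Eucl d → ℂ) (g : Fin d → Eucl d → ℂ) : Prop :=
  LocallyIntegrable w volume ∧
  ∀ i : Fin d, LocallyIntegrable (g i) volume ∧
    ∀ φ : Eucl d → ℝ, ContDiff ℝ ∞ φ → HasCompactSupport φ →
      ∫ x, classicalPartial φ i x • w x = - ∫ x, φ x • g i x

open Classical in
/-- The gradient of `w`: the classical one if `w` is of class `C^1`, and otherwise a weak gradient
of `w` if there is one (it is unique up to null sets). -/
def weakGrad {d : ℕ} (w : Eucl d → ℂ) : Fin d → Eucl d → ℂ :=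
  if ContDiff ℝ 1 w then classicalPartial w
  else if h : ∃ g, IsWeakGradient w g then h.choose
  else 0

/-- The energy density `e_ε(w) = |∇w|² / 2 + (1 - |w|²)² / (4 ε²)`. -/
def energyDensity {d : ℕ} (ε : ℝ) (w : Eucl d → ℂ) (x : Eucl d) : ℝ :=
  (∑ i, ‖weakGrad w i x‖ ^ 2) / 2 + (1 - ‖w x‖ ^ 2) ^ 2 / (4 * ε ^ 2)

/-- The energy `∫_{B(y,R)} e_ε(w)` in the ball `B(y,R)`, with values in `[0, ∞]`. -/
def ballEnergy {d : ℕ} (ε : ℝ) (w : Eucl d → ℂ) (y : Eucl d) (R : ℝ) : ℝ≥0∞ :=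
  ∫⁻ x in Metric.ball y R, ENNReal.ofReal (energyDensity ε w x)

/-- The condition `H₁(M₀)` for a single `ε`: the function `w` is in `L^∞(ℝ^d)`, has a weak gradient,
and its energy in each ball of radius `1` is at most `M₀ |ln ε|`. -/
structure LocalEnergyBoundAt {d : ℕ} (M₀ ε : ℝ) (w : Eucl d → ℂ) : Prop where
  memLp_top : MemLp w ∞ volume
  weakly_differentiable : ∃ g, IsWeakGradient w g
  energy_le : ∀ x : Eucl d, ballEnergy ε w x 1 ≤ ENNReal.ofReal (M₀ * |Real.log ε|)

/-- The condition `H₁(M₀)` for a family of functions indexed by `ε ∈ (0,1)`. -/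
def LocalEnergyBound {d : ℕ} (M₀ : ℝ) (w : ℝ → Eucl d → ℂ) : Prop :=
  ∀ ε ∈ Ioo (0 : ℝ) 1, LocalEnergyBoundAt M₀ ε (w ε)

/-- `u` (time first, then space) is the solution of the parabolic Ginzburg-Landau equation
`∂ₜu - Δu = ε⁻² u (1 - |u|²)` on `ℝ^d × (0,∞)` with initial datum `u₀`: it is smooth for positive
times, bounded on `ℝ^d × (0,T]` for each `T`, satisfies the equation pointwise, and
`u(t) → u₀` in `L¹_loc(ℝ^d)` as `t → 0⁺`. -/
structure IsPGLSolution {d : ℕ} (ε : ℝ) (u₀ : Eucl d → ℂ) (u : ℝ → Eucl d → ℂ) : Prop where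
  smooth : ContDiffOn ℝ ∞ (fun p : Eucl d × ℝ => u p.2 p.1) (univ ×ˢ Ioi 0)
  bounded : ∀ T : ℝ, 0 < T → ∃ K : ℝ, ∀ t ∈ Ioc 0 T, ∀ x, ‖u t x‖ ≤ K
  equation : ∀ t : ℝ, 0 < t → ∀ x,
    deriv (fun s => u s x) t - Laplacian.laplacian (u t) x
      = ((1 / ε ^ 2 * (1 - ‖u t x‖ ^ 2) : ℝ) : ℂ) * u t x
  initial : u 0 = u₀
  tendsto_initial : ∀ R : ℝ, 0 < R →
    Tendsto (fun t => ∫⁻ x in Metric.ball (0 : Eucl d) R, ‖u t x - u₀ x‖ₑ) (𝓝[>] 0) (𝓝 0)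

/-- The measure `μ_ε^t = e_ε(u_ε)(x,t) / |ln ε| dx` on `ℝ^d ≃ ℝ^d × {t}`. -/
def sliceMeasure {d : ℕ} (ε : ℝ) (u : ℝ → Eucl d → ℂ) (t : ℝ≥0) : Measure (Eucl d) :=
  volume.withDensity fun x => ENNReal.ofReal (energyDensity ε (u t) x / |Real.log ε|)

/-- Lebesgue measure `dt` on `[0,∞)`. -/
def timeMeasure : Measure ℝ≥0 := (volume : Measure ℝ).comap ((↑) : ℝ≥0 → ℝ)

/-- The measure `μ_ε = e_ε(u_ε)(x,t) / |ln ε| dx dt` on `ℝ^d × [0,∞)`. -/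
def spaceTimeMeasure {d : ℕ} (ε : ℝ) (u : ℝ → Eucl d → ℂ) : Measure (Eucl d × ℝ≥0) :=
  ((volume : Measure (Eucl d)).prod timeMeasure).withDensity fun p =>
    ENNReal.ofReal (energyDensity ε (u p.2) p.1 / |Real.log ε|)

/-- Weak convergence of (locally finite) measures, tested against continuous functions with compact
support. -/
def WeaklyConverges {X : Type*} [TopologicalSpace X] [MeasurableSpace X]
    (μs : ℕ → Measure X) (μ : Measure X) : Prop :=
  ∀ φ : X → ℝ, Continuous φ → HasCompactSupport φ →
    Tendsto (fun m => ∫ x, φ x ∂(μs m)) atTop (𝓝 (∫ x, φ x ∂μ))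

/-- `μ = μ^t dt`: the slices `μ^t` depend measurably on `t`, and `μ(A) = ∫₀^∞ μ^t(A_t) dt` for each
Borel set `A`, where `A_t = {x : (x,t) ∈ A}`. -/
def IsTimeDisintegration {d : ℕ} (μ : Measure (Eucl d × ℝ≥0)) (μt : ℝ≥0 → Measure (Eucl d)) :
    Prop :=
  Measurable μt ∧
  ∀ A : Set (Eucl d × ℝ≥0), MeasurableSet A → μ A = ∫⁻ t, μt t {x | (x, t) ∈ A} ∂timeMeasure

end

/-! ### Directional derivatives and integration by parts on space-time slabs -/

noncomputable section

/-! The growth bound is the monotonicity formula for the parabolic Ginzburg-Landau flow. With the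
weight exp(-|x-y|²/(4(T-t))), the local energy balance and the stress tensor identity show, after
completing a square, that (T-t)^(-(d-2)/2) times the weighted energy is nonincreasing in t
(`rpow_mul_integral_glEnergy_le`). For T = 1+t the weight is bounded below on B(y,1) at time t. At
time 0 its mass is of order T^(d/2) and the prefactor is T^(-(d-2)/2); their product is T, whence
the factor 1+t with a constant depending only on d.

Two points need care. Nothing is known about decay at infinity, so the Gaussian is replaced by
compactly supported approximations (`IsExpCutoff`); the errors are integrals against a Gaussian of
twice the variance, which only have to be finite. Moreover the datum is only weakly differentiable
and is attained only in L¹_loc, so the energy at small times has to be compared with that of the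
datum. Both are settled by the remark that |u(x+c)-u(x)|² is a subsolution of a linear heat
equation: weighted difference quotients grow at most by a factor exp(Lt), where L depends on ε and
on sup|u|. This yields finiteness at all times, and since exp(Ls) → 1 as s → 0 the bad constant L
leaves no trace in the final estimate (`IsPGLSolution.volume_ball_mul_ballEnergy_le`).

For compactness, testing the energy balance with χ² gives d/dt ∫ e χ² ≤ 2 ∫ e |∇χ|². Divided by |ln
ε| and combined with the growth bound, this says that ∫ χ² dμ_ε^t minus a function of t independent
of ε is nonincreasing for t > 0. Helly's theorem for countably many χ provides one sequence that
works at every time, and the polarization f = ((f+1)² - (f-1)²)/4 passes from squares to arbitrary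
test functions. The Riesz theorem produces the slices of the limit, and dominated convergence in t
produces the space-time limit. -/

/-- The directional derivative of a function on space-time in the direction `v`. -/
def pd {d : ℕ} {F : Type*} [NormedAddCommGroup F] [NormedSpace ℝ F]
    (v : Eucl d × ℝ) (f : Eucl d × ℝ → F) : Eucl d × ℝ → F :=
  fun p => fderiv ℝ f p v

/-- The `i`-th spatial direction in space-time. -/
def spDir {d : ℕ} (i : Fin d) : Eucl d × ℝ := (EuclideanSpace.single i (1 : ℝ), 0)

/-- The time direction in space-time. -/
def tmDir {d : ℕ} : Eucl d × ℝ := (0, 1)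

section Calculus

variable {d : ℕ} {F : Type*} [NormedAddCommGroup F] [NormedSpace ℝ F]
  {G : Type*} [NormedAddCommGroup G] [InnerProductSpace ℝ G]

lemma two_le_infty : (2 : ℕ∞ω) ≤ ((⊤ : ℕ∞) : ℕ∞ω) :=
  WithTop.coe_le_coe.2 (le_top : (2 : ℕ∞) ≤ ⊤)

lemma isOpen_slab {I : Set ℝ} (hI : IsOpen I) : IsOpen ((univ : Set (Eucl d)) ×ˢ I) :=
  isOpen_univ.prod hI

lemma ContDiffOn.pd {I : Set ℝ} (hI : IsOpen I) {f : Eucl d × ℝ → F}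
    (hf : ContDiffOn ℝ ∞ f (univ ×ˢ I)) (v : Eucl d × ℝ) :
    ContDiffOn ℝ ∞ (pd v f) (univ ×ˢ I) := by
  have h := hf.fderiv_of_isOpen (isOpen_slab hI) (m := ∞) (by simp)
  exact h.clm_apply contDiffOn_const

lemma differentiableAt_of_slab {I : Set ℝ} (hI : IsOpen I) {f : Eucl d × ℝ → F}
    (hf : ContDiffOn ℝ ∞ f (univ ×ˢ I)) {p : Eucl d × ℝ} (hp : p.2 ∈ I) :
    DifferentiableAt ℝ f p :=
  (hf.contDiffAt ((isOpen_slab hI).mem_nhds ⟨mem_univ _, hp⟩)).differentiableAt (by simp)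

lemma pd_comm {I : Set ℝ} (hI : IsOpen I) {f : Eucl d × ℝ → F}
    (hf : ContDiffOn ℝ ∞ f (univ ×ˢ I)) {p : Eucl d × ℝ} (hp : p.2 ∈ I) (v w : Eucl d × ℝ) :
    pd v (pd w f) p = pd w (pd v f) p := by
  have hc := hf.contDiffAt ((isOpen_slab hI).mem_nhds ⟨mem_univ p.1, hp⟩)
  have hs : IsSymmSndFDerivAt ℝ f p := hc.isSymmSndFDerivAt (by
    rw [minSmoothness_of_isRCLikeNormedField]
    exact two_le_infty)
  have hd : DifferentiableAt ℝ (fderiv ℝ f) p :=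
    (hc.fderiv_right (m := 1) (by rw [one_add_one_eq_two]; exact two_le_infty)).differentiableAt (by simp)
  have key : ∀ a b : Eucl d × ℝ, pd a (pd b f) p = fderiv ℝ (fderiv ℝ f) p a b := by
    intro a b
    unfold pd
    rw [fderiv_clm_apply hd (differentiableAt_const _)]
    simp
  rw [key, key, hs v w]

lemma pd_mul {f g : Eucl d × ℝ → ℝ} {p v : Eucl d × ℝ} (hf : DifferentiableAt ℝ f p)
    (hg : DifferentiableAt ℝ g p) :
    pd v (fun p => f p * g p) p = pd v f p * g p + f p * pd v g p := by
  unfold pd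
  rw [fderiv_fun_mul hf hg]
  simp
  ring

lemma pd_inner {f g : Eucl d × ℝ → G} {p v : Eucl d × ℝ} (hf : DifferentiableAt ℝ f p)
    (hg : DifferentiableAt ℝ g p) :
    pd v (fun p => inner ℝ (f p) (g p)) p = inner ℝ (pd v f p) (g p) + inner ℝ (f p) (pd v g p) := by
  unfold pd
  rw [fderiv_inner_apply ℝ hf hg]
  ring

lemma pd_norm_sq {f : Eucl d × ℝ → G} {p v : Eucl d × ℝ} (hf : DifferentiableAt ℝ f p) :
    pd v (fun p => ‖f p‖ ^ 2) p = 2 * inner ℝ (f p) (pd v f p) := by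
  simp_rw [← real_inner_self_eq_norm_sq]
  rw [pd_inner hf hf, real_inner_comm]
  ring

lemma pd_add {f g : Eucl d × ℝ → F} {p v : Eucl d × ℝ} (hf : DifferentiableAt ℝ f p)
    (hg : DifferentiableAt ℝ g p) :
    pd v (fun p => f p + g p) p = pd v f p + pd v g p := by
  unfold pd
  rw [fderiv_fun_add hf hg]
  simp

lemma pd_sub {f g : Eucl d × ℝ → F} {p v : Eucl d × ℝ} (hf : DifferentiableAt ℝ f p)
    (hg : DifferentiableAt ℝ g p) :
    pd v (fun p => f p - g p) p = pd v f p - pd v g p := by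
  unfold pd
  rw [fderiv_fun_sub hf hg]
  simp

lemma pd_sum {ι : Type*} {s : Finset ι} {f : ι → Eucl d × ℝ → F} {p v : Eucl d × ℝ}
    (hf : ∀ i ∈ s, DifferentiableAt ℝ (f i) p) :
    pd v (fun p => ∑ i ∈ s, f i p) p = ∑ i ∈ s, pd v (f i) p := by
  unfold pd
  rw [fderiv_fun_sum hf]
  simp

lemma pd_comp {f : Eucl d × ℝ → ℝ} {h : ℝ → ℝ} {h' : ℝ} {p v : Eucl d × ℝ}
    (hh : HasDerivAt h h' (f p)) (hf : DifferentiableAt ℝ f p) :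
    pd v (fun p => h (f p)) p = h' * pd v f p := by
  unfold pd
  have := (hh.comp_hasFDerivAt p hf.hasFDerivAt).fderiv
  rw [show (fun p => h (f p)) = h ∘ f from rfl, this]
  simp

lemma pd_spDir_eq {f : Eucl d × ℝ → F} {x v : Eucl d} {t : ℝ} (hf : DifferentiableAt ℝ f (x, t)) :
    pd (v, 0) f (x, t) = fderiv ℝ (fun y => f (y, t)) x v := by
  unfold pd
  have h : HasFDerivAt (fun y : Eucl d => (y, t)) (ContinuousLinearMap.inl ℝ (Eucl d) ℝ) x :=
    hasFDerivAt_prodMk_left x t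
  have := (hf.hasFDerivAt.comp x h).fderiv
  rw [show (fun y => f (y, t)) = f ∘ (fun y : Eucl d => (y, t)) from rfl, this]
  simp

lemma hasDerivAt_tmDir {f : Eucl d × ℝ → F} {x : Eucl d} {t : ℝ}
    (hf : DifferentiableAt ℝ f (x, t)) :
    HasDerivAt (fun s => f (x, s)) (pd tmDir f (x, t)) t := by
  have h : HasDerivAt (fun s : ℝ => (x, s)) ((0 : Eucl d), (1 : ℝ)) t :=
    (hasDerivAt_const t x).prodMk (hasDerivAt_id t)
  exact hf.hasFDerivAt.comp_hasDerivAt t h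

lemma contDiff_slice {I : Set ℝ} {f : Eucl d × ℝ → F} {n : ℕ∞ω}
    (hf : ContDiffOn ℝ n f (univ ×ˢ I)) {t : ℝ} (ht : t ∈ I) :
    ContDiff ℝ n (fun x => f (x, t)) := by
  rw [← contDiffOn_univ]
  exact hf.comp (contDiff_prodMk_left t).contDiffOn (fun x _ => ⟨mem_univ _, ht⟩)

lemma pd_eq_zero_of_support {I : Set ℝ} (hI : IsOpen I) {f : Eucl d × ℝ → F} {K : Set (Eucl d)}
    (hK : IsClosed K) (hf : ∀ x ∉ K, ∀ t ∈ I, f (x, t) = 0) (v : Eucl d × ℝ) :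
    ∀ x ∉ K, ∀ t ∈ I, pd v f (x, t) = 0 := by
  intro x hx t ht
  have : f =ᶠ[𝓝 (x, t)] fun _ => 0 := by
    filter_upwards [(hK.isOpen_compl.prod hI).mem_nhds (show (x, t) ∈ Kᶜ ×ˢ I from ⟨hx, ht⟩)]
      with p hp using hf p.1 hp.1 p.2 hp.2
  unfold pd
  rw [this.fderiv_eq]
  simp

lemma integrable_slice {F : Type*} [NormedAddCommGroup F] {I : Set ℝ} {f : Eucl d × ℝ → F}
    {K : Set (Eucl d)}
    (hK : IsCompact K) (hf : ContinuousOn f (univ ×ˢ I)) (h0 : ∀ x ∉ K, ∀ t ∈ I, f (x, t) = 0)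
    {t : ℝ} (ht : t ∈ I) : Integrable (fun x => f (x, t)) := by
  refine Continuous.integrable_of_hasCompactSupport ?_
    (HasCompactSupport.intro hK fun x hx => h0 x hx t ht)
  rw [← continuousOn_univ]
  exact hf.comp (by fun_prop) (fun x _ => ⟨mem_univ _, ht⟩)

lemma integral_pd_space_eq_zero {I : Set ℝ} (hI : IsOpen I) {f : Eucl d × ℝ → ℝ} {K : Set (Eucl d)}
    (hK : IsCompact K) (hf : ContDiffOn ℝ ∞ f (univ ×ˢ I)) (h0 : ∀ x ∉ K, ∀ t ∈ I, f (x, t) = 0)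
    {t : ℝ} (ht : t ∈ I) (v : Eucl d) : ∫ x, pd (v, 0) f (x, t) = 0 := by
  have h1 : ∀ x, pd (v, 0) f (x, t) = fderiv ℝ (fun y => f (y, t)) x v := fun x =>
    pd_spDir_eq (differentiableAt_of_slab hI hf (p := (x, t)) ht)
  have hint := integrable_slice hK (hf.pd hI (v, 0)).continuousOn
    (pd_eq_zero_of_support hI hK.isClosed h0 _) ht
  simp_rw [h1] at hint ⊢
  -- Integration by parts against the constant function 1.
  have := integral_mul_fderiv_eq_neg_fderiv_mul_of_integrable (μ := (volume : Measure (Eucl d)))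
    (f := fun y => f (y, t)) (g := fun _ => (1 : ℝ)) (v := v)
    (by simpa using hint) (by simp)
    (by simpa using integrable_slice hK hf.continuousOn h0 ht)
    (fun x _ => (contDiff_slice hf ht).differentiable (by simp) x) (by fun_prop)
  simpa using this.symm

lemma hasDerivAt_integral_slice {I : Set ℝ} (hI : IsOpen I) {f : Eucl d × ℝ → ℝ} {K : Set (Eucl d)}
    (hK : IsCompact K) (hf : ContDiffOn ℝ ∞ f (univ ×ˢ I)) (h0 : ∀ x ∉ K, ∀ t ∈ I, f (x, t) = 0)
    {t : ℝ} (ht : t ∈ I) :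
    HasDerivAt (fun s => ∫ x, f (x, s)) (∫ x, pd tmDir f (x, t)) t := by
  obtain ⟨r, hr, hrI⟩ := Metric.isOpen_iff.1 hI t ht
  have hsub : Metric.closedBall t (r / 2) ⊆ I :=
    (Metric.closedBall_subset_ball (by linarith)).trans hrI
  have hcomp : IsCompact (K ×ˢ Metric.closedBall t (r / 2)) :=
    hK.prod (isCompact_closedBall _ _)
  have hcont : ContinuousOn (pd tmDir f) (univ ×ˢ I) := (hf.pd hI tmDir).continuousOn
  have h0' := pd_eq_zero_of_support hI hK.isClosed h0 (tmDir (d := d))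
  obtain ⟨M, hM⟩ := hcomp.exists_bound_of_continuousOn
    (hcont.mono (prod_mono (subset_univ _) hsub))
  refine (hasDerivAt_integral_of_dominated_loc_of_deriv_le
    (F := fun s x => f (x, s)) (F' := fun s x => pd tmDir f (x, s))
    (bound := K.indicator fun _ => M) (s := Metric.closedBall t (r / 2))
    (Metric.closedBall_mem_nhds t (by linarith)) ?_ ?_ ?_ ?_ ?_ ?_).2
  · filter_upwards [hI.mem_nhds ht] with s hs
    exact (integrable_slice hK hf.continuousOn h0 hs).aestronglyMeasurable
  · exact integrable_slice hK hf.continuousOn h0 ht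
  · exact (integrable_slice hK hcont h0' ht).aestronglyMeasurable
  · refine Eventually.of_forall fun x s hs => ?_
    by_cases hx : x ∈ K
    · rw [indicator_of_mem hx]
      exact hM (x, s) ⟨hx, hs⟩
    · rw [indicator_of_notMem hx, h0' x hx s (hsub hs), norm_zero]
  · exact (integrable_indicator_iff hK.measurableSet).2
      (integrableOn_const hK.measure_lt_top.ne)
  · refine Eventually.of_forall fun x s hs => ?_
    exact hasDerivAt_tmDir (differentiableAt_of_slab hI hf (p := (x, s)) (hsub hs))

/-- If `∂ₜf ≤ B + div X` with `f` and `X` compactly supported in space, then the time derivative of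
`∫ f dx` is at most `∫ B dx`. -/
lemma exists_hasDerivAt_integral_le {I : Set ℝ} (hI : IsOpen I) {f B : Eucl d × ℝ → ℝ}
    {X : Fin d → Eucl d × ℝ → ℝ} {K : Set (Eucl d)} (hK : IsCompact K)
    (hf : ContDiffOn ℝ ∞ f (univ ×ˢ I)) (h0 : ∀ x ∉ K, ∀ t ∈ I, f (x, t) = 0)
    (hX : ∀ i, ContDiffOn ℝ ∞ (X i) (univ ×ˢ I)) (hX0 : ∀ i, ∀ x ∉ K, ∀ t ∈ I, X i (x, t) = 0)
    {t : ℝ} (ht : t ∈ I) (hB : Integrable fun x => B (x, t))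
    (hle : ∀ x, pd tmDir f (x, t) ≤ B (x, t) + ∑ i, pd (spDir i) (X i) (x, t)) :
    ∃ D : ℝ, HasDerivAt (fun s => ∫ x, f (x, s)) D t ∧ D ≤ ∫ x, B (x, t) := by
  refine ⟨_, hasDerivAt_integral_slice hI hK hf h0 ht, ?_⟩
  have hXi : ∀ i, Integrable fun x => pd (spDir i) (X i) (x, t) := fun i =>
    integrable_slice hK ((hX i).pd hI _).continuousOn
      (pd_eq_zero_of_support hI hK.isClosed (hX0 i) _) ht
  calc ∫ x, pd tmDir f (x, t) ≤ ∫ x, (B (x, t) + ∑ i, pd (spDir i) (X i) (x, t)) :=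
        integral_mono (integrable_slice hK (hf.pd hI _).continuousOn
          (pd_eq_zero_of_support hI hK.isClosed h0 _) ht)
          (hB.add (integrable_finsetSum _ fun i _ => hXi i)) hle
    _ = ∫ x, B (x, t) := by
        rw [integral_add hB (integrable_finsetSum _ fun i _ => hXi i),
          integral_finsetSum _ fun i _ => hXi i]
        simp [spDir, integral_pd_space_eq_zero hI hK (hX _) (hX0 _) ht]

end Calculus

end

/-! ### Local energy identities for smooth solutions -/

noncomputable section

/-- `U` is smooth on `ℝ^d × (0,∞)` and solves the parabolic Ginzburg-Landau equation there. -/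
structure SolvesGL {d : ℕ} (ε : ℝ) (U : Eucl d × ℝ → ℂ) : Prop where
  smooth : ContDiffOn ℝ ∞ U (univ ×ˢ Ioi 0)
  equation : ∀ p : Eucl d × ℝ, p.2 ∈ Ioi (0 : ℝ) →
    pd tmDir U p = ∑ i, pd (spDir i) (pd (spDir i) U) p + (1 / ε ^ 2 * (1 - ‖U p‖ ^ 2)) • U p

/-- The Ginzburg-Landau energy density on space-time. -/
def glEnergy {d : ℕ} (ε : ℝ) (U : Eucl d × ℝ → ℂ) (p : Eucl d × ℝ) : ℝ :=
  (∑ i, ‖pd (spDir i) U p‖ ^ 2) / 2 + (1 - ‖U p‖ ^ 2) ^ 2 / (4 * ε ^ 2)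

section EnergyIdentities

variable {d : ℕ}

lemma pd_congr {F : Type*} [NormedAddCommGroup F] [NormedSpace ℝ F] {I : Set ℝ} (hI : IsOpen I)
    {f g : Eucl d × ℝ → F} (h : ∀ x, ∀ t ∈ I, f (x, t) = g (x, t)) {p : Eucl d × ℝ}
    (hp : p.2 ∈ I) (v : Eucl d × ℝ) : pd v f p = pd v g p := by
  unfold pd
  rw [Filter.EventuallyEq.fderiv_eq]
  filter_upwards [(isOpen_slab hI).mem_nhds (show p ∈ univ ×ˢ I from ⟨mem_univ _, hp⟩)] with z hz
  exact h z.1 z.2 hz.2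

lemma glEnergy_nonneg (ε : ℝ) (U : Eucl d × ℝ → ℂ) (p : Eucl d × ℝ) : 0 ≤ glEnergy ε U p := by
  unfold glEnergy
  positivity

lemma sum_norm_sq_le_glEnergy (ε : ℝ) (U : Eucl d × ℝ → ℂ) (p : Eucl d × ℝ) :
    ∑ i, ‖pd (spDir i) U p‖ ^ 2 ≤ 2 * glEnergy ε U p := by
  unfold glEnergy
  have : 0 ≤ (1 - ‖U p‖ ^ 2) ^ 2 / (4 * ε ^ 2) := by positivity
  linarith

lemma glEnergy_contDiffOn {I : Set ℝ} (hI : IsOpen I) {ε : ℝ} {U : Eucl d × ℝ → ℂ}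
    (hU : ContDiffOn ℝ ∞ U (univ ×ˢ I)) : ContDiffOn ℝ ∞ (glEnergy ε U) (univ ×ˢ I) := by
  unfold glEnergy
  have h1 : ContDiffOn ℝ ∞ (fun p => ∑ i, ‖pd (spDir i) U p‖ ^ 2) (univ ×ˢ I) :=
    ContDiffOn.sum fun i _ => (hU.pd hI _).norm_sq ℝ
  exact (h1.div_const _).add (((contDiffOn_const.sub (hU.norm_sq ℝ)).pow 2).div_const _)

lemma pd_glEnergy {I : Set ℝ} (hI : IsOpen I) {ε : ℝ} {U : Eucl d × ℝ → ℂ}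
    (hU : ContDiffOn ℝ ∞ U (univ ×ˢ I)) {p : Eucl d × ℝ} (hp : p.2 ∈ I) (v : Eucl d × ℝ) :
    pd v (glEnergy ε U) p = ∑ i, inner ℝ (pd (spDir i) U p) (pd v (pd (spDir i) U) p)
      - 1 / ε ^ 2 * (1 - ‖U p‖ ^ 2) * inner ℝ (U p) (pd v U p) := by
  have hUd := differentiableAt_of_slab hI hU hp
  have had : ∀ i, DifferentiableAt ℝ (pd (spDir i) U) p := fun i =>
    differentiableAt_of_slab hI (hU.pd hI _) hp
  have hW : HasDerivAt (fun n : ℝ => (1 - n) ^ 2 / (4 * ε ^ 2))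
      (-(1 / ε ^ 2 * (1 - ‖U p‖ ^ 2)) / 2) (‖U p‖ ^ 2) := by
    have := (((hasDerivAt_id (‖U p‖ ^ 2)).const_sub 1).pow 2).div_const (4 * ε ^ 2)
    refine this.congr_deriv ?_
    -- At ε = 0 both sides vanish, because division by zero gives zero.
    by_cases hε : ε = 0
    · simp [hε]
    · simp only [id]
      field_simp
      norm_num
      ring
  have h1 : pd v (fun p => (∑ i, ‖pd (spDir i) U p‖ ^ 2) * (1 / 2 : ℝ)) p
      = ∑ i, inner ℝ (pd (spDir i) U p) (pd v (pd (spDir i) U) p) := by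
    rw [pd_mul (DifferentiableAt.fun_sum fun i _ => (had i).norm_sq ℝ) (differentiableAt_const _),
      pd_sum (fun i _ => (had i).norm_sq ℝ)]
    simp_rw [fun i => pd_norm_sq (v := v) (had i), ← Finset.mul_sum]
    rw [show pd v (fun _ => (1 / 2 : ℝ)) p = 0 by simp [pd]]
    ring
  have h2 := pd_comp (v := v) hW (hUd.norm_sq ℝ)
  have : glEnergy ε U = fun p => (∑ i, ‖pd (spDir i) U p‖ ^ 2) * (1 / 2 : ℝ)
      + (fun n : ℝ => (1 - n) ^ 2 / (4 * ε ^ 2)) (‖U p‖ ^ 2) := by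
    ext p
    simp only [glEnergy]
    ring
  rw [this, pd_add, h1, h2, pd_norm_sq hUd]
  · ring
  · exact (DifferentiableAt.fun_sum fun i _ => (had i).norm_sq ℝ).mul_const _
  · exact hW.differentiableAt.comp p (hUd.norm_sq ℝ)

/-- The local energy balance: pairing the equation with ∂ₜU produces the dissipation term, and the
second derivatives of U are gathered in the divergence of ψ⟨∇U, ∂ₜU⟩. -/
lemma pd_tmDir_glEnergy_mul {I : Set ℝ} (hI : IsOpen I) (hI0 : I ⊆ Ioi 0) {ε : ℝ}
    {U : Eucl d × ℝ → ℂ} (hU : SolvesGL ε U) {ψ : Eucl d × ℝ → ℝ}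
    (hψ : ContDiffOn ℝ ∞ ψ (univ ×ˢ I)) {p : Eucl d × ℝ} (hp : p.2 ∈ I) :
    pd tmDir (fun p => glEnergy ε U p * ψ p) p
      = glEnergy ε U p * pd tmDir ψ p - ‖pd tmDir U p‖ ^ 2 * ψ p
        - inner ℝ (pd tmDir U p) (∑ i, pd (spDir i) ψ p • pd (spDir i) U p)
        + ∑ i, pd (spDir i) (fun p => ψ p * inner ℝ (pd (spDir i) U p) (pd tmDir U p)) p := by
  have hs : ContDiffOn ℝ ∞ U (univ ×ˢ I) := hU.smooth.mono (prod_mono subset_rfl hI0)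
  have had : ∀ v, DifferentiableAt ℝ (pd v U) p := fun v =>
    differentiableAt_of_slab hI (hs.pd hI _) hp
  have hψd := differentiableAt_of_slab hI hψ hp
  have hX : ∀ i, pd (spDir i) (fun p => ψ p * inner ℝ (pd (spDir i) U p) (pd tmDir U p)) p
      = pd (spDir i) ψ p * inner ℝ (pd (spDir i) U p) (pd tmDir U p)
        + ψ p * (inner ℝ (pd (spDir i) (pd (spDir i) U) p) (pd tmDir U p)
          + inner ℝ (pd (spDir i) U p) (pd tmDir (pd (spDir i) U) p)) := by
    intro i
    rw [pd_mul hψd ((had _).inner ℝ (had _)), pd_inner (had _) (had _),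
      pd_comm hI hs hp (spDir i) tmDir]
  have hb : ‖pd tmDir U p‖ ^ 2 = ∑ i, inner ℝ (pd (spDir i) (pd (spDir i) U) p) (pd tmDir U p)
      + (1 / ε ^ 2 * (1 - ‖U p‖ ^ 2)) * inner ℝ (U p) (pd tmDir U p) := by
    rw [← sum_inner, ← real_inner_smul_left, ← inner_add_left, ← hU.equation p (hI0 hp),
      real_inner_self_eq_norm_sq]
  rw [pd_mul (differentiableAt_of_slab hI (glEnergy_contDiffOn hI hs) hp) hψd,
    pd_glEnergy hI hs hp, hb, inner_sum]
  simp_rw [hX, real_inner_smul_right, Finset.sum_add_distrib, ← Finset.mul_sum,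
    Finset.sum_add_distrib]
  simp_rw [real_inner_comm (pd tmDir U p)]
  ring

/-- The stress tensor identity: pairing the equation with ∇ψ·∇U and moving derivatives onto ψ leaves
only the Hessian of ψ, up to a divergence. It is what makes the special shape of the Gaussian weight
usable. -/
lemma inner_pd_tmDir_eq {I : Set ℝ} (hI : IsOpen I) (hI0 : I ⊆ Ioi 0) {ε : ℝ}
    {U : Eucl d × ℝ → ℂ} (hU : SolvesGL ε U) {ψ : Eucl d × ℝ → ℝ}
    (hψ : ContDiffOn ℝ ∞ ψ (univ ×ˢ I)) {p : Eucl d × ℝ} (hp : p.2 ∈ I) :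
    inner ℝ (pd tmDir U p) (∑ j, pd (spDir j) ψ p • pd (spDir j) U p)
      = ∑ i, pd (spDir i) (fun p => ∑ j, pd (spDir j) ψ p *
            inner ℝ (pd (spDir i) U p) (pd (spDir j) U p) - pd (spDir i) ψ p * glEnergy ε U p) p
        - ∑ i, ∑ j, pd (spDir i) (pd (spDir j) ψ) p *
            inner ℝ (pd (spDir i) U p) (pd (spDir j) U p)
        + glEnergy ε U p * ∑ i, pd (spDir i) (pd (spDir i) ψ) p := by
  have hs : ContDiffOn ℝ ∞ U (univ ×ˢ I) := hU.smooth.mono (prod_mono subset_rfl hI0)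
  have had : ∀ v, DifferentiableAt ℝ (pd v U) p := fun v =>
    differentiableAt_of_slab hI (hs.pd hI _) hp
  have hψd : ∀ v, DifferentiableAt ℝ (pd v ψ) p := fun v =>
    differentiableAt_of_slab hI (hψ.pd hI _) hp
  have hed := differentiableAt_of_slab hI (glEnergy_contDiffOn (ε := ε) hI hs) hp
  have hX : ∀ i, pd (spDir i) (fun p => ∑ j, pd (spDir j) ψ p *
            inner ℝ (pd (spDir i) U p) (pd (spDir j) U p) - pd (spDir i) ψ p * glEnergy ε U p) p
      = ∑ j, (pd (spDir i) (pd (spDir j) ψ) p * inner ℝ (pd (spDir i) U p) (pd (spDir j) U p)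
          + pd (spDir j) ψ p * (inner ℝ (pd (spDir i) (pd (spDir i) U) p) (pd (spDir j) U p)
            + inner ℝ (pd (spDir i) U p) (pd (spDir j) (pd (spDir i) U) p)))
        - (pd (spDir i) (pd (spDir i) ψ) p * glEnergy ε U p + pd (spDir i) ψ p *
          (∑ j, inner ℝ (pd (spDir j) U p) (pd (spDir i) (pd (spDir j) U) p)
      - 1 / ε ^ 2 * (1 - ‖U p‖ ^ 2) * inner ℝ (U p) (pd (spDir i) U p))) := by
    intro i
    rw [pd_sub (DifferentiableAt.fun_sum fun j _ => (hψd _).fun_mul ((had _).inner ℝ (had _)))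
      ((hψd _).fun_mul hed), pd_sum (fun j _ => (hψd _).fun_mul ((had _).inner ℝ (had _))),
      pd_mul (hψd _) hed, pd_glEnergy hI hs hp]
    congr 1
    refine Finset.sum_congr rfl fun j _ => ?_
    rw [pd_mul (hψd _) ((had _).inner ℝ (had _)), pd_inner (had _) (had _),
      pd_comm hI hs hp (spDir i) (spDir j)]
  have hb : ∀ j, inner ℝ (pd tmDir U p) (pd (spDir j) U p)
      = ∑ i, inner ℝ (pd (spDir i) (pd (spDir i) U) p) (pd (spDir j) U p)
      + (1 / ε ^ 2 * (1 - ‖U p‖ ^ 2)) * inner ℝ (U p) (pd (spDir j) U p) := by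
    intro j
    rw [← sum_inner, ← real_inner_smul_left, ← inner_add_left, ← hU.equation p (hI0 hp)]
  simp_rw [hX, inner_sum, real_inner_smul_right, hb, mul_add, mul_sub, Finset.sum_sub_distrib,
    Finset.sum_add_distrib, Finset.mul_sum]
  -- Once i and j are exchanged, the mixed second derivatives of U coming from the products ⟨∂ᵢU,
  -- ∂ⱼU⟩ cancel those coming from the gradient of the energy density.
  rw [Finset.sum_comm (f := fun i j => pd (spDir j) ψ p *
      inner ℝ (pd (spDir i) (pd (spDir i) U) p) (pd (spDir j) U p)),
    Finset.sum_comm (f := fun i j => pd (spDir j) ψ p *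
      inner ℝ (pd (spDir i) U p) (pd (spDir j) (pd (spDir i) U) p))]
  simp_rw [mul_comm (pd (spDir _) (pd (spDir _) ψ) p) (glEnergy ε U p)]
  simp only [Finset.sum_sub_distrib]
  ring

end EnergyIdentities

section PGL

variable {d : ℕ} {ε : ℝ} {u₀ : Eucl d → ℂ} {u : ℝ → Eucl d → ℂ}

lemma IsPGLSolution.contDiff_slice (hu : IsPGLSolution ε u₀ u) {t : ℝ} (ht : 0 < t) :
    ContDiff ℝ ∞ (u t) :=
  _root_.contDiff_slice hu.smooth ht

lemma IsPGLSolution.solvesGL (hu : IsPGLSolution ε u₀ u) :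
    SolvesGL ε (fun p : Eucl d × ℝ => u p.2 p.1) := by
  refine ⟨hu.smooth, fun p hp => ?_⟩
  obtain ⟨x, t⟩ := p
  have ht : 0 < t := hp
  have hd := differentiableAt_of_slab isOpen_Ioi hu.smooth (p := (x, t)) ht
  have h1 := (hasDerivAt_tmDir hd).deriv
  have h2 := hu.equation t ht x
  have h3 : Laplacian.laplacian (u t) x
      = ∑ i, pd (spDir i) (pd (spDir i) (fun p : Eucl d × ℝ => u p.2 p.1)) (x, t) := by
    rw [InnerProductSpace.laplacian_eq_iteratedFDeriv_orthonormalBasis (u t)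
      (EuclideanSpace.basisFun (Fin d) ℝ)]
    refine Finset.sum_congr rfl fun i _ => ?_
    rw [iteratedFDeriv_two_apply]
    have hs := hu.contDiff_slice ht
    have hs1 : Differentiable ℝ (fderiv ℝ (u t)) :=
      (hs.fderiv_right (m := 1) (by rw [one_add_one_eq_two]; exact two_le_infty)).differentiable
        (by simp)
    have ha : ∀ y, pd (spDir i) (fun p : Eucl d × ℝ => u p.2 p.1) (y, t)
        = fderiv ℝ (u t) y (EuclideanSpace.single i 1) := fun y =>
      pd_spDir_eq (differentiableAt_of_slab isOpen_Ioi hu.smooth (p := (y, t)) ht)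
    rw [spDir, pd_spDir_eq (differentiableAt_of_slab isOpen_Ioi (hu.smooth.pd isOpen_Ioi _)
      (p := (x, t)) ht)]
    rw [spDir] at ha
    simp_rw [ha]
    rw [fderiv_clm_apply (hs1 x) (differentiableAt_const _)]
    simp
  rw [h3, h1] at h2
  rw [sub_eq_iff_eq_add'.1 h2]
  simp

/-- Equality holds at every point, not just almost everywhere, because `weakGrad` takes its
classical branch on the smooth function `u t`. -/
lemma IsPGLSolution.energyDensity_eq (hu : IsPGLSolution ε u₀ u) {t : ℝ} (ht : 0 < t)
    (x : Eucl d) :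
    energyDensity ε (u t) x = glEnergy ε (fun p : Eucl d × ℝ => u p.2 p.1) (x, t) := by
  have hc : ContDiff ℝ 1 (u t) := (hu.contDiff_slice ht).of_le (by simp)
  unfold energyDensity glEnergy weakGrad
  rw [if_pos hc]
  congr 3
  ext i
  rw [spDir, pd_spDir_eq (differentiableAt_of_slab isOpen_Ioi hu.smooth (p := (x, t)) ht)]
  rfl

end PGL

end

/-! ### Compactly supported substitutes for the backward heat kernel -/

noncomputable section

/-- `F` is a smooth compactly supported approximation of `q ↦ exp (-q)` on `[0,∞)` with first two
derivatives `F1`, `F2`, and `H` is a bound for the quotient `F1² / F`; all relative errors are at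
most `δ`. -/
structure IsExpCutoff (δ : ℝ) (F F1 F2 H : ℝ → ℝ) : Prop where
  smooth : ContDiff ℝ ∞ F
  hasDerivAt : ∀ q, HasDerivAt F (F1 q) q
  hasDerivAt' : ∀ q, HasDerivAt F1 (F2 q) q
  nonneg : ∀ q, 0 ≤ F q
  le_exp : ∀ q, F q ≤ Real.exp (-q)
  nonneg' : ∀ q, 0 ≤ H q
  sq_le : ∀ q, F1 q ^ 2 ≤ F q * H q
  err1 : ∀ q, |F1 q + F q| ≤ δ * Real.exp (-q)
  err2 : ∀ q, |F2 q - F q| ≤ δ * Real.exp (-q)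
  err3 : ∀ q, |H q - F q| ≤ δ * Real.exp (-q)
  support : ∃ B, 0 < B ∧ ∀ q, B ≤ q → F q = 0
  eq_exp : ∀ q, q ≤ 1 / δ → F q = Real.exp (-q)

lemma exists_smooth_step : ∃ η η1 η2 : ℝ → ℝ, ∃ A : ℝ, 1 ≤ A ∧ ContDiff ℝ ∞ η ∧
    (∀ s, HasDerivAt η (η1 s) s) ∧ (∀ s, HasDerivAt η1 (η2 s) s) ∧ (∀ s, 0 ≤ η s) ∧
    (∀ s, η s ≤ 1) ∧ (∀ s, |η1 s| ≤ A) ∧ (∀ s, |η2 s| ≤ A) ∧ (∀ s, s ≤ 1 → η s = 1) ∧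
    (∀ s, 2 ≤ s → η s = 0) := by
  set η : ℝ → ℝ := fun s => Real.smoothTransition (2 - s) with hη
  have hs : ContDiff ℝ ∞ η := Real.smoothTransition.contDiff.comp (contDiff_const.sub contDiff_id)
  have h1 : ∀ s, s ≤ 1 → η s = 1 := fun s hs =>
    Real.smoothTransition.one_of_one_le (by linarith)
  have h0 : ∀ s, 2 ≤ s → η s = 0 := fun s hs =>
    Real.smoothTransition.zero_of_nonpos (by linarith)
  have hs1 : ContDiff ℝ ∞ (deriv η) := (contDiff_infty_iff_deriv.1 hs).2
  have hs2 : ContDiff ℝ ∞ (deriv (deriv η)) := (contDiff_infty_iff_deriv.1 hs1).2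
  have hc1 : HasCompactSupport (deriv η) := by
    refine HasCompactSupport.intro (isCompact_Icc (a := (1 : ℝ)) (b := 2)) fun s hs' => ?_
    rw [mem_Icc, not_and_or, not_le, not_le] at hs'
    rcases hs' with h | h
    · have : η =ᶠ[𝓝 s] fun _ => 1 := by
        filter_upwards [Iio_mem_nhds h] with r hr using h1 r (le_of_lt hr)
      rw [this.deriv_eq, deriv_const]
    · have : η =ᶠ[𝓝 s] fun _ => 0 := by
        filter_upwards [Ioi_mem_nhds h] with r hr using h0 r (le_of_lt hr)
      rw [this.deriv_eq, deriv_const]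
  obtain ⟨A1, hA1⟩ := hs1.continuous.bounded_above_of_compact_support hc1
  obtain ⟨A2, hA2⟩ := hs2.continuous.bounded_above_of_compact_support hc1.deriv
  refine ⟨η, deriv η, deriv (deriv η), max 1 (max A1 A2), le_max_left _ _, hs,
    fun s => (hs.differentiable (by simp) s).hasDerivAt,
    fun s => (hs1.differentiable (by simp) s).hasDerivAt,
    fun s => Real.smoothTransition.nonneg _, fun s => Real.smoothTransition.le_one _,
    fun s => (hA1 s).trans (le_max_of_le_right (le_max_left _ _)),
    fun s => (hA2 s).trans (le_max_of_le_right (le_max_right _ _)), h1, h0⟩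

/-- Take F(q) = exp(-q) η(q/R)² with η a smooth step. Squaring η makes F1² divisible by F: the
quotient is H = exp(-q)(-η + 2η'/R)², which stays meaningful where F vanishes. Each derivative of
η(q/R) gains a factor 1/R, so the relative errors are O(1/R). -/
lemma exists_isExpCutoff {δ : ℝ} (hδ : 0 < δ) : ∃ F F1 F2 H : ℝ → ℝ, IsExpCutoff δ F F1 F2 H := by
  obtain ⟨η, η1, η2, A, hA, hs, hd1, hd2, hn, hle, hb1, hb2, h1, h0⟩ := exists_smooth_step
  -- The three lower bounds serve respectively r² ≤ r for r = 1/R, the equality with exp(-q) up to q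
  -- = 1/δ, and the relative errors, each of which is at most 8A²r.
  obtain ⟨R, hR1, hRδ, hRA⟩ : ∃ R : ℝ, 1 ≤ R ∧ 1 / δ ≤ R ∧ 8 * A ^ 2 / δ ≤ R :=
    ⟨max 1 (max (1 / δ) (8 * A ^ 2 / δ)), le_max_left _ _, le_max_of_le_right (le_max_left _ _),
      le_max_of_le_right (le_max_right _ _)⟩
  have hR0 : 0 < R := by linarith
  set r := R⁻¹ with hr
  have hr0 : 0 < r := inv_pos.2 hR0
  have hr1 : r ≤ 1 := inv_le_one_of_one_le₀ hR1
  have hrA : 8 * A ^ 2 * r ≤ δ := by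
    rw [div_le_iff₀ hδ] at hRA
    rw [hr, ← div_eq_mul_inv, div_le_iff₀ hR0]
    linarith
  have he : ∀ q, HasDerivAt (fun q : ℝ => Real.exp (-q)) (-Real.exp (-q)) q := fun q => by
    simpa using (hasDerivAt_neg q).exp
  have hη : ∀ q, HasDerivAt (fun q => η (q * r)) (η1 (q * r) * r) q := fun q => by
    exact ((hd1 (q * r)).comp q ((hasDerivAt_id q).mul_const r)).congr_deriv (by simp)
  have hη1 : ∀ q, HasDerivAt (fun q => η1 (q * r)) (η2 (q * r) * r) q := fun q => by
    exact ((hd2 (q * r)).comp q ((hasDerivAt_id q).mul_const r)).congr_deriv (by simp)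
  have habs : ∀ q a, |a| ≤ 8 * A ^ 2 * r → |Real.exp (-q) * a| ≤ δ * Real.exp (-q) := by
    intro q a ha
    rw [abs_mul, abs_of_pos (Real.exp_pos _), mul_comm]
    exact mul_le_mul_of_nonneg_right (ha.trans hrA) (Real.exp_pos _).le
  have hp1 : ∀ s, |η s * η1 s| ≤ A := fun s => by
    rw [abs_mul, abs_of_nonneg (hn s)]
    nlinarith [hle s, hn s, hb1 s, abs_nonneg (η1 s)]
  have hp2 : ∀ s, |η s * η2 s| ≤ A := fun s => by
    rw [abs_mul, abs_of_nonneg (hn s)]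
    nlinarith [hle s, hn s, hb2 s, abs_nonneg (η2 s)]
  have hp3 : ∀ s, η1 s ^ 2 ≤ A ^ 2 := fun s => sq_le_sq' (abs_le.1 (hb1 s)).1 (abs_le.1 (hb1 s)).2
  have hAA : A ≤ A ^ 2 := by nlinarith
  have hrr : r ^ 2 ≤ r := by nlinarith
  refine ⟨fun q => Real.exp (-q) * η (q * r) ^ 2,
    fun q => Real.exp (-q) * (-η (q * r) ^ 2 + 2 * (η (q * r) * η1 (q * r)) * r),
    fun q => Real.exp (-q) * (η (q * r) ^ 2 - 4 * (η (q * r) * η1 (q * r)) * r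
      + 2 * (η1 (q * r) ^ 2 + η (q * r) * η2 (q * r)) * r ^ 2),
    fun q => Real.exp (-q) * (-η (q * r) + 2 * η1 (q * r) * r) ^ 2, ?_⟩
  constructor
  · exact (Real.contDiff_exp.comp contDiff_neg).mul
      ((hs.comp (contDiff_id.mul contDiff_const)).pow 2)
  · intro q
    refine ((he q).mul ((hη q).pow 2)).congr_deriv ?_
    simp
    ring
  · intro q
    refine ((he q).mul ((((hη q).pow 2).neg).add
      ((((hη q).mul (hη1 q)).const_mul 2).mul_const r))).congr_deriv ?_
    simp
    ring
  · intro q; positivity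
  · intro q
    have : η (q * r) ^ 2 ≤ 1 := pow_le_one₀ (hn _) (hle _)
    simpa using mul_le_mul_of_nonneg_left this (Real.exp_pos (-q)).le
  · intro q; positivity
  · intro q
    apply le_of_eq
    ring
  · intro q
    rw [← mul_add]
    apply habs
    rw [show -η (q * r) ^ 2 + 2 * (η (q * r) * η1 (q * r)) * r + η (q * r) ^ 2
      = 2 * r * (η (q * r) * η1 (q * r)) by ring, abs_mul, abs_of_pos (by positivity)]
    nlinarith [hp1 (q * r)]
  · intro q
    rw [← mul_sub]
    apply habs
    have a1 := abs_le.1 (hp1 (q * r))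
    have a2 := abs_le.1 (hp2 (q * r))
    have a3 := hp3 (q * r)
    have a4 := sq_nonneg (η1 (q * r))
    have b1 : |(η (q * r) * η1 (q * r)) * r| ≤ A ^ 2 * r := by
      rw [abs_mul, abs_of_pos hr0]
      exact mul_le_mul_of_nonneg_right ((hp1 _).trans hAA) hr0.le
    have b2 : |(η1 (q * r) ^ 2 + η (q * r) * η2 (q * r)) * r ^ 2| ≤ 2 * A ^ 2 * r := by
      rw [abs_mul, abs_of_pos (by positivity : 0 < r ^ 2)]
      refine mul_le_mul ?_ hrr (by positivity) (by positivity)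
      rw [abs_le]
      constructor <;> linarith
    rw [abs_le] at b1 b2 ⊢
    constructor <;> linarith
  · intro q
    rw [← mul_sub]
    apply habs
    have a3 := hp3 (q * r)
    have a4 := sq_nonneg (η1 (q * r))
    have b1 : |(η (q * r) * η1 (q * r)) * r| ≤ A ^ 2 * r := by
      rw [abs_mul, abs_of_pos hr0]
      exact mul_le_mul_of_nonneg_right ((hp1 _).trans hAA) hr0.le
    have b2 : η1 (q * r) ^ 2 * r ^ 2 ≤ A ^ 2 * r := mul_le_mul a3 hrr (by positivity) (by positivity)
    have b3 : 0 ≤ η1 (q * r) ^ 2 * r ^ 2 := by positivity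
    rw [abs_le] at b1 ⊢
    constructor <;> linarith
  · refine ⟨2 * R, by positivity, fun q hq => ?_⟩
    have : 2 ≤ q * r := by
      rw [hr, ← div_eq_mul_inv, le_div_iff₀ hR0]
      exact hq
    simp [h0 _ this]
  · intro q hq
    have : q * r ≤ 1 := by
      rw [hr, ← div_eq_mul_inv, div_le_iff₀ hR0]
      linarith
    simp [h1 _ this]

/-- The exponent `|x - y|² / (4 (T - t))` of the backward heat kernel at `(y,T)`. -/
def heatExponent {d : ℕ} (y : Eucl d) (T : ℝ) (p : Eucl d × ℝ) : ℝ :=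
  ‖p.1 - y‖ ^ 2 * (4 * (T - p.2))⁻¹

section HeatExponent

variable {d : ℕ} {y : Eucl d} {T : ℝ}

lemma contDiffOn_heatExponent : ContDiffOn ℝ ∞ (heatExponent y T) (univ ×ˢ Ioo 0 T) := by
  unfold heatExponent
  refine ContDiffOn.mul ?_ (ContDiffOn.inv ?_ ?_)
  · exact ((contDiff_fst.sub contDiff_const).norm_sq ℝ).contDiffOn
  · exact (contDiff_const.mul (contDiff_const.sub contDiff_snd)).contDiffOn
  · intro p hp
    have := hp.2.2
    have : 0 < T - p.2 := by linarith
    positivity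

lemma pd_heatExponent {p : Eucl d × ℝ} (hp : p.2 ∈ Ioo 0 T) (v : Eucl d × ℝ) :
    pd v (heatExponent y T) p = inner ℝ (p.1 - y) v.1 / (2 * (T - p.2))
      + heatExponent y T p * v.2 / (T - p.2) := by
  have hτ : 0 < T - p.2 := by linarith [hp.2]
  have h1 : pd v (fun p : Eucl d × ℝ => ‖p.1 - y‖ ^ 2) p = 2 * inner ℝ (p.1 - y) v.1 := by
    rw [pd_norm_sq (by fun_prop)]
    congr 2
    unfold pd
    rw [fderiv_sub_const, fderiv_fst]
    simp
  have h2 : pd v (fun p : Eucl d × ℝ => (4 * (T - p.2))⁻¹) p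
      = -((4 * (T - p.2)) ^ 2)⁻¹ * (-4 * v.2) := by
    rw [pd_comp (f := fun p : Eucl d × ℝ => 4 * (T - p.2))
      (hasDerivAt_inv (by positivity : 4 * (T - p.2) ≠ 0)) (by fun_prop)]
    congr 1
    unfold pd
    rw [fderiv_const_mul (by fun_prop), fderiv_const_sub, fderiv_snd]
    simp
  unfold heatExponent
  rw [pd_mul (DifferentiableAt.norm_sq ℝ (by fun_prop)) ?_, h1, h2]
  · field_simp
    ring
  · exact DifferentiableAt.fun_inv (by fun_prop) (by positivity)

lemma pd_spDir_heatExponent {p : Eucl d × ℝ} (hp : p.2 ∈ Ioo 0 T) (i : Fin d) :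
    pd (spDir i) (heatExponent y T) p = (p.1 i - y i) / (2 * (T - p.2)) := by
  rw [pd_heatExponent hp]
  simp [spDir, EuclideanSpace.inner_single_right]

lemma pd_tmDir_heatExponent {p : Eucl d × ℝ} (hp : p.2 ∈ Ioo 0 T) :
    pd tmDir (heatExponent y T) p = heatExponent y T p / (T - p.2) := by
  rw [pd_heatExponent hp]
  simp [tmDir]

lemma pd_spDir_spDir_heatExponent {p : Eucl d × ℝ} (hp : p.2 ∈ Ioo 0 T) (i j : Fin d) :
    pd (spDir i) (pd (spDir j) (heatExponent y T)) p
      = if i = j then 1 / (2 * (T - p.2)) else 0 := by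
  have hτ : 0 < T - p.2 := by linarith [hp.2]
  rw [pd_congr isOpen_Ioo (g := fun p : Eucl d × ℝ => (p.1 j - y j) * (2 * (T - p.2))⁻¹)
    (fun x t ht => by rw [pd_spDir_heatExponent (p := (x, t)) ht, div_eq_mul_inv]) hp]
  have h1 : pd (spDir i) (fun p : Eucl d × ℝ => p.1 j - y j) p = if i = j then 1 else 0 := by
    have h : HasFDerivAt (fun p : Eucl d × ℝ => p.1 j - y j)
        ((EuclideanSpace.proj j : Eucl d →L[ℝ] ℝ).comp (ContinuousLinearMap.fst ℝ (Eucl d) ℝ)) p :=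
      (ContinuousLinearMap.hasFDerivAt
        ((EuclideanSpace.proj j : Eucl d →L[ℝ] ℝ).comp
          (ContinuousLinearMap.fst ℝ (Eucl d) ℝ))).sub_const _
    unfold pd
    rw [h.fderiv]
    simp [spDir, eq_comm]
  have h2 : pd (spDir i) (fun p : Eucl d × ℝ => (2 * (T - p.2))⁻¹) p = 0 := by
    rw [pd_comp (f := fun p : Eucl d × ℝ => 2 * (T - p.2))
      (hasDerivAt_inv (by positivity : 2 * (T - p.2) ≠ 0)) (by fun_prop)]
    unfold pd
    rw [fderiv_const_mul (by fun_prop), fderiv_const_sub, fderiv_snd]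
    simp [spDir]
  rw [pd_mul (by fun_prop) (DifferentiableAt.fun_inv (by fun_prop) (by positivity)), h1, h2]
  split_ifs <;> simp

lemma sum_sq_eq_heatExponent {p : Eucl d × ℝ} (hp : p.2 ∈ Ioo 0 T) :
    ∑ i, (p.1 i - y i) ^ 2 = 4 * (T - p.2) * heatExponent y T p := by
  have hτ : 0 < T - p.2 := by linarith [hp.2]
  have : ‖p.1 - y‖ ^ 2 = ∑ i, (p.1 i - y i) ^ 2 := by
    rw [EuclideanSpace.norm_sq_eq]
    simp
  rw [heatExponent, ← this]
  field_simp

lemma heatExponent_nonneg {p : Eucl d × ℝ} (hp : p.2 ∈ Ioo 0 T) : 0 ≤ heatExponent y T p := by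
  have hτ : 0 < T - p.2 := by linarith [hp.2]
  unfold heatExponent
  positivity

variable {δ : ℝ} {F F1 F2 H : ℝ → ℝ}

lemma IsExpCutoff.contDiffOn (hF : IsExpCutoff δ F F1 F2 H) :
    ContDiffOn ℝ ∞ (fun p => F (heatExponent y T p)) (univ ×ˢ Ioo 0 T) :=
  hF.smooth.comp_contDiffOn contDiffOn_heatExponent

lemma IsExpCutoff.pd_eq (hF : IsExpCutoff δ F F1 F2 H) {p : Eucl d × ℝ} (hp : p.2 ∈ Ioo 0 T)
    (v : Eucl d × ℝ) : pd v (fun p => F (heatExponent y T p)) p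
      = F1 (heatExponent y T p) * pd v (heatExponent y T) p :=
  pd_comp (hF.hasDerivAt _) (differentiableAt_of_slab isOpen_Ioo contDiffOn_heatExponent hp)

lemma IsExpCutoff.pd_pd_eq (hF : IsExpCutoff δ F F1 F2 H) {p : Eucl d × ℝ} (hp : p.2 ∈ Ioo 0 T)
    (i j : Fin d) : pd (spDir i) (pd (spDir j) (fun p => F (heatExponent y T p))) p
      = F2 (heatExponent y T p) * ((p.1 i - y i) * (p.1 j - y j)) / (2 * (T - p.2)) ^ 2
        + if i = j then F1 (heatExponent y T p) / (2 * (T - p.2)) else 0 := by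
  rw [pd_congr isOpen_Ioo (g := fun p => F1 (heatExponent y T p) * pd (spDir j) (heatExponent y T) p)
    (fun x t ht => hF.pd_eq (p := (x, t)) ht (spDir j)) hp]
  have hq := differentiableAt_of_slab isOpen_Ioo (contDiffOn_heatExponent (y := y)) hp
  have hF1 : DifferentiableAt ℝ (fun p => F1 (heatExponent y T p)) p :=
    (hF.hasDerivAt' _).differentiableAt.comp p hq
  rw [pd_mul hF1
    (differentiableAt_of_slab isOpen_Ioo (contDiffOn_heatExponent.pd isOpen_Ioo _) hp),
    pd_comp (hF.hasDerivAt' _) hq, pd_spDir_spDir_heatExponent hp, pd_spDir_heatExponent hp,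
    pd_spDir_heatExponent hp]
  have hτ : 0 < T - p.2 := by linarith [hp.2]
  split_ifs
  · field_simp
  · field_simp
    simp

lemma IsExpCutoff.sum_pd_pd_eq (hF : IsExpCutoff δ F F1 F2 H) {p : Eucl d × ℝ}
    (hp : p.2 ∈ Ioo 0 T) : ∑ i, pd (spDir i) (pd (spDir i) (fun p => F (heatExponent y T p))) p
      = F2 (heatExponent y T p) * (4 * (T - p.2) * heatExponent y T p) / (2 * (T - p.2)) ^ 2
        + d * (F1 (heatExponent y T p) / (2 * (T - p.2))) := by
  simp_rw [hF.pd_pd_eq hp, if_true, Finset.sum_add_distrib, ← sum_sq_eq_heatExponent (y := y) hp,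
    Finset.mul_sum, Finset.sum_div]
  simp [sq]

lemma IsExpCutoff.exists_compact (hF : IsExpCutoff δ F F1 F2 H) (y : Eucl d) (T : ℝ) :
    ∃ K : Set (Eucl d), IsCompact K ∧
      ∀ x ∉ K, ∀ t ∈ Ioo 0 T, F (heatExponent y T (x, t)) = 0 := by
  obtain ⟨B, hB0, hB⟩ := hF.support
  -- Since T - t < T on the slab, one ball contains the supports at all times.
  refine ⟨Metric.closedBall y (√(4 * T * B)), isCompact_closedBall _ _, fun x hx t ht => hB _ ?_⟩
  have hτ : 0 < T - t := by linarith [ht.2]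
  have hT : 0 < T := by linarith [ht.1]
  rw [Metric.mem_closedBall, not_le, dist_eq_norm, Real.sqrt_lt (by positivity) (by positivity)]
    at hx
  simp only [heatExponent]
  rw [← div_eq_mul_inv, le_div_iff₀ (by positivity)]
  nlinarith [ht.1]

/-- The polynomial factor in the cutoff error is absorbed by giving up half of the exponent, that
is, by doubling the variance of the Gaussian. The 12 is 6·2, from q exp(-q/2) ≤ 2. -/
lemma poly_mul_exp_neg_le {q : ℝ} (hq : 0 ≤ q) (a : ℝ) (ha : 0 ≤ a) :
    (6 * q + a) * Real.exp (-q) ≤ (12 + a) * Real.exp (-q / 2) := by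
  have h1 : q / 2 ≤ Real.exp (q / 2) := by linarith [Real.add_one_le_exp (q / 2)]
  have h2 : Real.exp (-q) = Real.exp (-q / 2) * Real.exp (-q / 2) := by
    rw [← Real.exp_add]; ring_nf
  have h3 : Real.exp (q / 2) * Real.exp (-q / 2) = 1 := by
    rw [← Real.exp_add]; ring_nf; exact Real.exp_zero
  have h4 : Real.exp (-q / 2) ≤ 1 := Real.exp_le_one_iff.2 (by linarith)
  have h5 := Real.exp_pos (-q / 2)
  have h6 : q * Real.exp (-q / 2) ≤ 2 := by nlinarith
  have h7 := mul_le_mul_of_nonneg_right h6 h5.le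
  have h8 := mul_le_mul_of_nonneg_left h4 (mul_nonneg ha h5.le)
  rw [h2]
  linarith

end HeatExponent

end

/-! ### Pointwise differential inequalities with the cut-off weight -/

noncomputable section

section WeightedInequalities

variable {d : ℕ}

lemma norm_sum_smul_sq_le (z : Fin d → ℝ) (a : Fin d → ℂ) :
    ‖∑ i, z i • a i‖ ^ 2 ≤ (∑ i, z i ^ 2) * ∑ i, ‖a i‖ ^ 2 := by
  have h1 : ‖∑ i, z i • a i‖ ≤ ∑ i, |z i| * ‖a i‖ := by
    refine (norm_sum_le _ _).trans (le_of_eq ?_)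
    simp
  calc ‖∑ i, z i • a i‖ ^ 2 ≤ (∑ i, |z i| * ‖a i‖) ^ 2 := by gcongr
    _ ≤ (∑ i, |z i| ^ 2) * ∑ i, ‖a i‖ ^ 2 := Finset.sum_mul_sq_le_sq_mul_sq _ _ _
    _ = _ := by simp

lemma sum_sum_smul_inner (z : Fin d → ℝ) (a : Fin d → ℂ) :
    ∑ i, ∑ j, (z i * z j) * inner ℝ (a i) (a j) = ‖∑ i, z i • a i‖ ^ 2 := by
  rw [← real_inner_self_eq_norm_sq, sum_inner]
  refine Finset.sum_congr rfl fun i _ => ?_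
  rw [inner_sum]
  refine Finset.sum_congr rfl fun j _ => ?_
  rw [real_inner_smul_left, real_inner_smul_right]
  ring

/-- Completion of the square in b. Using h with f1² ≤ f h instead of f1²/f keeps it valid where the
weight f vanishes. -/
lemma neg_sq_sub_inner_le {f f1 h τ : ℝ} (hf : 0 ≤ f) (hh : 0 ≤ h) (hfh : f1 ^ 2 ≤ f * h)
    (hτ : 0 < τ) (b ξ : ℂ) :
    -(‖b‖ ^ 2 * f) - 2 * (f1 / (2 * τ) * inner ℝ b ξ) ≤ h * ‖ξ‖ ^ 2 / (2 * τ) ^ 2 := by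
  have h1 : |f1| ≤ √f * √h := by
    rw [← Real.sqrt_mul hf]
    exact Real.abs_le_sqrt hfh
  have h2 : |f1 * inner ℝ b ξ| ≤ √f * √h * (‖b‖ * ‖ξ‖) := by
    rw [abs_mul]
    exact mul_le_mul h1 (abs_real_inner_le_norm b ξ) (abs_nonneg _) (by positivity)
  have h3 := (abs_le.1 h2).1
  have h4 : h * ‖ξ‖ ^ 2 / (2 * τ) ^ 2 + ‖b‖ ^ 2 * f + 2 * (f1 / (2 * τ) * inner ℝ b ξ)
      = (√f * ‖b‖ - √h * ‖ξ‖ / (2 * τ)) ^ 2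
        + (f1 * inner ℝ b ξ + √f * √h * (‖b‖ * ‖ξ‖)) / τ := by
    rw [sub_sq, mul_pow √f, div_pow, mul_pow √h, Real.sq_sqrt hf, Real.sq_sqrt hh]
    field_simp
    ring
  have h5 : 0 ≤ (f1 * inner ℝ b ξ + √f * √h * (‖b‖ * ‖ξ‖)) / τ :=
    div_nonneg (by linarith) hτ.le
  nlinarith [sq_nonneg (√f * ‖b‖ - √h * ‖ξ‖ / (2 * τ))]

/-- Here e is the energy density, G = |∇u|² and X = |(x-y)·∇u|². For the exact exponential, f1 = -f
and f2 = h = f: the X terms cancel, the time derivative cancels part of the Laplacian, and G ≤ 2e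
turns the rest into -(d-2)/(2τ) e f. The cutoff perturbs each cancellation by δm; the q-terms add up
to 2 + 4 = 6, the others to d/2 + 1. -/
lemma weighted_error_le {δ f f1 f2 h q τ e G X m : ℝ} (hδ : 0 ≤ δ) (hm : 0 ≤ m) (hq : 0 ≤ q)
    (hτ : 0 < τ) (hf : 0 ≤ f) (h1 : |f1 + f| ≤ δ * m) (h2 : |f2 - f| ≤ δ * m)
    (h3 : |h - f| ≤ δ * m) (hG : 0 ≤ G) (hGe : G ≤ 2 * e) (hX : 0 ≤ X)
    (hXG : X ≤ 4 * τ * q * G) :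
    e * (f1 * (q / τ)) + h * X / (2 * τ) ^ 2 + e * (f2 * (4 * τ * q) / (2 * τ) ^ 2
      + d * (f1 / (2 * τ))) - (f2 * X / (2 * τ) ^ 2 + f1 / (2 * τ) * G)
      ≤ -((d : ℝ) - 2) / (2 * τ) * (e * f) + δ / τ * (e * ((6 * q + (d / 2 + 1)) * m)) := by
  have he : 0 ≤ e := by linarith
  set X' := X / (4 * τ) with hX'
  have hX0 : 0 ≤ X' := by positivity
  have hX1 : X' ≤ 2 * (q * e) := by
    rw [hX', div_le_iff₀ (by positivity)]
    nlinarith [mul_nonneg hτ.le hq]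
  have hXX : X = X' * (4 * τ) := by rw [hX']; field_simp
  rw [hXX]
  have key : e * (f1 * q) + h * X' + e * (f2 * q + d * (f1 / 2)) - (f2 * X' + f1 / 2 * G)
      ≤ -((d : ℝ) - 2) / 2 * (e * f) + δ * (e * ((6 * q + (d / 2 + 1)) * m)) := by
    obtain ⟨a1, b1⟩ := abs_le.1 h1
    obtain ⟨a2, b2⟩ := abs_le.1 h2
    obtain ⟨a3, b3⟩ := abs_le.1 h3
    have c1 : (f1 + f2) * (q * e) ≤ 2 * (δ * m) * (q * e) :=
      mul_le_mul_of_nonneg_right (by linarith) (by positivity)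
    have c2 : (h - f2) * X' ≤ 2 * (δ * m) * (2 * (q * e)) :=
      (mul_le_mul_of_nonneg_right (by linarith : h - f2 ≤ 2 * (δ * m)) hX0).trans
        (mul_le_mul_of_nonneg_left hX1 (by positivity))
    have c3 : (f1 + f) * (e * d) ≤ δ * m * (e * d) :=
      mul_le_mul_of_nonneg_right b1 (by positivity)
    have c4 : -f1 * G ≤ (f + δ * m) * (2 * e) :=
      (mul_le_mul_of_nonneg_right (by linarith : -f1 ≤ f + δ * m) hG).trans
        (mul_le_mul_of_nonneg_left hGe (by positivity))
    linarith
  have := div_le_div_of_nonneg_right key hτ.le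
  refine le_trans (le_of_eq ?_) (this.trans (le_of_eq ?_))
  · field_simp
    ring
  · field_simp

lemma IsExpCutoff.pd_tmDir_glEnergy_mul_le {δ : ℝ} (hδ : 0 ≤ δ) {F F1 F2 H : ℝ → ℝ}
    (hF : IsExpCutoff δ F F1 F2 H) {ε : ℝ} {U : Eucl d × ℝ → ℂ} (hU : SolvesGL ε U) (y : Eucl d)
    {T : ℝ} {p : Eucl d × ℝ} (hp : p.2 ∈ Ioo 0 T) :
    pd tmDir (fun p => glEnergy ε U p * F (heatExponent y T p)) p
      ≤ (-((d : ℝ) - 2) / (2 * (T - p.2)) * (glEnergy ε U p * F (heatExponent y T p))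
        + δ / (T - p.2) * (glEnergy ε U p
          * ((12 + (d / 2 + 1)) * Real.exp (-heatExponent y T p / 2))))
      + ∑ i, pd (spDir i) (fun p => F (heatExponent y T p) *
            inner ℝ (pd (spDir i) U p) (pd tmDir U p)
          + (∑ j, pd (spDir j) (fun p => F (heatExponent y T p)) p *
            inner ℝ (pd (spDir i) U p) (pd (spDir j) U p)
            - pd (spDir i) (fun p => F (heatExponent y T p)) p * glEnergy ε U p)) p := by
  have hI : IsOpen (Ioo 0 T) := isOpen_Ioo
  have hI0 : Ioo 0 T ⊆ Ioi (0 : ℝ) := fun t ht => ht.1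
  have hτ : 0 < T - p.2 := by linarith [hp.2]
  have hψ := hF.contDiffOn (y := y) (T := T)
  have hs : ContDiffOn ℝ ∞ U (univ ×ˢ Ioo 0 T) := hU.smooth.mono (prod_mono subset_rfl hI0)
  have had : ∀ v, DifferentiableAt ℝ (pd v U) p := fun v =>
    differentiableAt_of_slab hI (hs.pd hI _) hp
  have hψd := differentiableAt_of_slab hI hψ hp
  have hψd' : ∀ v, DifferentiableAt ℝ (pd v fun p => F (heatExponent y T p)) p := fun v =>
    differentiableAt_of_slab hI (hψ.pd hI _) hp
  have hed := differentiableAt_of_slab hI (glEnergy_contDiffOn (ε := ε) hI hs) hp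
  have hq := heatExponent_nonneg (y := y) hp
  set q := heatExponent y T p with hqdef
  have hsplit : ∀ i, pd (spDir i) (fun p => F (heatExponent y T p) *
            inner ℝ (pd (spDir i) U p) (pd tmDir U p)
          + (∑ j, pd (spDir j) (fun p => F (heatExponent y T p)) p *
            inner ℝ (pd (spDir i) U p) (pd (spDir j) U p)
            - pd (spDir i) (fun p => F (heatExponent y T p)) p * glEnergy ε U p)) p
      = pd (spDir i) (fun p => F (heatExponent y T p) *
            inner ℝ (pd (spDir i) U p) (pd tmDir U p)) p
        + pd (spDir i) (fun p => ∑ j, pd (spDir j) (fun p => F (heatExponent y T p)) p *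
            inner ℝ (pd (spDir i) U p) (pd (spDir j) U p)
            - pd (spDir i) (fun p => F (heatExponent y T p)) p * glEnergy ε U p) p := fun i =>
    pd_add (hψd.mul ((had _).inner ℝ (had _)))
      ((DifferentiableAt.fun_sum fun j _ => (hψd' _).fun_mul ((had _).inner ℝ (had _))).sub
        ((hψd' _).mul hed))
  simp_rw [hsplit, Finset.sum_add_distrib]
  have e1 := pd_tmDir_glEnergy_mul hI hI0 hU hψ hp
  have e2 := inner_pd_tmDir_eq hI hI0 hU hψ hp
  set S1 := ∑ i, pd (spDir i) (fun p => F (heatExponent y T p) *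
            inner ℝ (pd (spDir i) U p) (pd tmDir U p)) p
  set S2 := ∑ i, pd (spDir i) (fun p => ∑ j, pd (spDir j) (fun p => F (heatExponent y T p)) p *
            inner ℝ (pd (spDir i) U p) (pd (spDir j) U p)
            - pd (spDir i) (fun p => F (heatExponent y T p)) p * glEnergy ε U p) p
  set e := glEnergy ε U p
  set a : Fin d → ℂ := fun i => pd (spDir i) U p with ha
  set z : Fin d → ℝ := fun i => p.1 i - y i with hz
  set b := pd tmDir U p
  set ξ := ∑ i, z i • a i with hξ
  set τ := T - p.2 with hτdef
  have hz2 : ∑ i, z i ^ 2 = 4 * τ * q := sum_sq_eq_heatExponent hp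
  have hgrad : ∑ i, pd (spDir i) (fun p => F (heatExponent y T p)) p • pd (spDir i) U p
      = (F1 q / (2 * τ)) • ξ := by
    rw [hξ, Finset.smul_sum]
    refine Finset.sum_congr rfl fun i _ => ?_
    rw [hF.pd_eq hp, pd_spDir_heatExponent hp, smul_smul]
    congr 1
    ring
  have hlap : ∑ i, pd (spDir i) (pd (spDir i) fun p => F (heatExponent y T p)) p
      = F2 q * (4 * τ * q) / (2 * τ) ^ 2 + d * (F1 q / (2 * τ)) := hF.sum_pd_pd_eq hp
  have hhess : ∑ i, ∑ j, pd (spDir i) (pd (spDir j) fun p => F (heatExponent y T p)) p *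
      inner ℝ (pd (spDir i) U p) (pd (spDir j) U p)
      = F2 q * ‖ξ‖ ^ 2 / (2 * τ) ^ 2 + F1 q / (2 * τ) * ∑ i, ‖a i‖ ^ 2 := by
    rw [hξ, ← sum_sum_smul_inner]
    simp_rw [hF.pd_pd_eq hp, add_mul, Finset.sum_add_distrib, Finset.mul_sum, Finset.sum_div,
      ite_mul, zero_mul]
    simp only [Finset.sum_ite_eq, Finset.mem_univ, if_true, real_inner_self_eq_norm_sq]
    congr 1
    refine Finset.sum_congr rfl fun i _ => Finset.sum_congr rfl fun j _ => ?_
    simp only [hz, ha]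
    ring
  have htm : pd tmDir (fun p => F (heatExponent y T p)) p = F1 q * (q / τ) := by
    rw [hF.pd_eq hp, pd_tmDir_heatExponent hp]
  rw [hgrad, hlap, hhess] at e2
  rw [hgrad, htm] at e1
  rw [real_inner_smul_right] at e1 e2
  -- `e1` contains the cross term -⟨∂ₜU, ∇ψ·∇U⟩ once. It is written as minus two copies plus one:
  -- the two copies complete the square, and the extra one is expanded by the stress tensor identity
  -- `e2`.
  have k1 := neg_sq_sub_inner_le (hF.nonneg q) (hF.nonneg' q) (hF.sq_le q) hτ b ξ
  have k2 := weighted_error_le (d := d) (e := e) (G := ∑ i, ‖a i‖ ^ 2) (X := ‖ξ‖ ^ 2) hδ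
    (Real.exp_pos (-q)).le hq hτ (hF.nonneg q) (hF.err1 q) (hF.err2 q) (hF.err3 q) (by positivity)
    (sum_norm_sq_le_glEnergy ε U p) (by positivity)
    (by rw [← hz2]; exact norm_sum_smul_sq_le z a)
  have k3 : δ / τ * (e * ((6 * q + (d / 2 + 1)) * Real.exp (-q)))
      ≤ δ / τ * (e * ((12 + (d / 2 + 1)) * Real.exp (-q / 2))) := by
    refine mul_le_mul_of_nonneg_left (mul_le_mul_of_nonneg_left ?_ (glEnergy_nonneg ε U p))
      (by positivity)
    exact poly_mul_exp_neg_le hq _ (by positivity)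
  linarith

/-- Both spatial derivatives are moved from P to the weight, so only its backward heat operator
matters. This is `weighted_error_le` with G = X = 0, and the remaining term with factor -(d-2) is
discarded since d ≥ 2. -/
lemma IsExpCutoff.pd_tmDir_subsolution_mul_le (hd : 2 ≤ d) {δ : ℝ} (hδ : 0 ≤ δ) {F F1 F2 H : ℝ → ℝ}
    (hF : IsExpCutoff δ F F1 F2 H) {P : Eucl d × ℝ → ℝ} {L T : ℝ}
    (hP : ContDiffOn ℝ ∞ P (univ ×ˢ Ioo 0 T)) (y : Eucl d) {p : Eucl d × ℝ} (hp : p.2 ∈ Ioo 0 T)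
    (hP0 : 0 ≤ P p) (hsub : pd tmDir P p ≤ ∑ i, pd (spDir i) (pd (spDir i) P) p + L * P p) :
    pd tmDir (fun p => P p * F (heatExponent y T p)) p
      ≤ (L * (P p * F (heatExponent y T p)) + δ / (T - p.2) * (P p
          * ((12 + (d / 2 + 1)) * Real.exp (-heatExponent y T p / 2))))
      + ∑ i, pd (spDir i) (fun p => pd (spDir i) P p * F (heatExponent y T p)
          - P p * pd (spDir i) (fun p => F (heatExponent y T p)) p) p := by
  have hI : IsOpen (Ioo 0 T) := isOpen_Ioo
  have hτ : 0 < T - p.2 := by linarith [hp.2]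
  have hψ := hF.contDiffOn (y := y) (T := T)
  have hψd := differentiableAt_of_slab hI hψ hp
  have hψd' : ∀ v, DifferentiableAt ℝ (pd v fun p => F (heatExponent y T p)) p := fun v =>
    differentiableAt_of_slab hI (hψ.pd hI _) hp
  have hPd := differentiableAt_of_slab hI hP hp
  have hPd' : ∀ v, DifferentiableAt ℝ (pd v P) p := fun v =>
    differentiableAt_of_slab hI (hP.pd hI _) hp
  have hq := heatExponent_nonneg (y := y) hp
  have hX : ∀ i, pd (spDir i) (fun p => pd (spDir i) P p * F (heatExponent y T p)
          - P p * pd (spDir i) (fun p => F (heatExponent y T p)) p) p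
      = pd (spDir i) (pd (spDir i) P) p * F (heatExponent y T p)
        - P p * pd (spDir i) (pd (spDir i) (fun p => F (heatExponent y T p))) p := fun i => by
    rw [pd_sub ((hPd' _).fun_mul hψd) (hPd.fun_mul (hψd' _)), pd_mul (hPd' _) hψd,
      pd_mul hPd (hψd' _)]
    ring
  simp_rw [hX, Finset.sum_sub_distrib, ← Finset.sum_mul, ← Finset.mul_sum]
  rw [pd_mul hPd hψd, hF.pd_eq hp, pd_tmDir_heatExponent hp]
  set q := heatExponent y T p with hqdef
  set τ := T - p.2 with hτdef
  have hlap : ∑ i, pd (spDir i) (pd (spDir i) fun p => F (heatExponent y T p)) p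
      = F2 q * (4 * τ * q) / (2 * τ) ^ 2 + d * (F1 q / (2 * τ)) := hF.sum_pd_pd_eq hp
  rw [hlap]
  have k1 := mul_le_mul_of_nonneg_right hsub (hF.nonneg q)
  have k2 := weighted_error_le (d := d) (e := P p) (G := 0) (X := 0) hδ
    (Real.exp_pos (-q)).le hq hτ (hF.nonneg q) (hF.err1 q) (hF.err2 q) (hF.err3 q) le_rfl
    (by linarith) le_rfl (by simp)
  have k3 : δ / τ * (P p * ((6 * q + (d / 2 + 1)) * Real.exp (-q)))
      ≤ δ / τ * (P p * ((12 + (d / 2 + 1)) * Real.exp (-q / 2))) := by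
    refine mul_le_mul_of_nonneg_left (mul_le_mul_of_nonneg_left ?_ hP0) (by positivity)
    exact poly_mul_exp_neg_le hq _ (by positivity)
  have k4 : 0 ≤ ((d : ℝ) - 2) / (2 * τ) * (P p * F q) := by
    have : (2 : ℝ) ≤ d := by exact_mod_cast hd
    have := hF.nonneg q
    refine mul_nonneg (div_nonneg (by linarith) (by positivity)) (by positivity)
  simp only [mul_zero, zero_div, add_zero, sub_zero] at k2
  rw [neg_div, neg_mul] at k2
  linarith

end WeightedInequalities

end

/-! ### Gaussian-weighted integrals and the monotonicity formula -/

noncomputable section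

/-- The (unnormalised) Gaussian weight `exp (-|x - y|² / (4 τ))`. -/
def gaussWeight {d : ℕ} (y : Eucl d) (τ : ℝ) (x : Eucl d) : ℝ :=
  Real.exp (-(‖x - y‖ ^ 2 * (4 * τ)⁻¹))

section GaussWeight

variable {d : ℕ}

lemma gaussWeight_pos (y : Eucl d) (τ : ℝ) (x : Eucl d) : 0 < gaussWeight y τ x :=
  Real.exp_pos _

lemma continuous_gaussWeight (y : Eucl d) (τ : ℝ) : Continuous (gaussWeight y τ) := by
  unfold gaussWeight
  fun_prop

lemma gaussWeight_mono (y : Eucl d) {τ τ' : ℝ} (h0 : 0 < τ) (h : τ ≤ τ') (x : Eucl d) :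
    gaussWeight y τ x ≤ gaussWeight y τ' x := by
  unfold gaussWeight
  refine Real.exp_le_exp.2 (neg_le_neg (mul_le_mul_of_nonneg_left ?_ (by positivity)))
  exact inv_anti₀ (by positivity) (by linarith)

lemma integral_gaussWeight (y : Eucl d) {τ : ℝ} (hτ : 0 < τ) :
    ∫ x, gaussWeight y τ x = (Real.pi * (4 * τ)) ^ (d / 2 : ℝ) := by
  unfold gaussWeight
  rw [integral_sub_right_eq_self (fun x : Eucl d => Real.exp (-(‖x‖ ^ 2 * (4 * τ)⁻¹)))]
  have := GaussianFourier.integral_rexp_neg_mul_sq_norm (V := Eucl d) (b := (4 * τ)⁻¹)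
    (by positivity)
  simp only [finrank_euclideanSpace, Fintype.card_fin, div_inv_eq_mul] at this
  rw [← this]
  congr with x
  ring_nf

lemma integrable_gaussWeight (y : Eucl d) {τ : ℝ} (hτ : 0 < τ) :
    Integrable (gaussWeight y τ) := by
  -- A non-integrable function has Bochner integral 0, whereas the computed value is positive.
  refine not_imp_comm.1 integral_undef ?_
  rw [integral_gaussWeight y hτ]
  have := Real.pi_pos
  positivity

lemma exp_neg_heatExponent (y : Eucl d) (T : ℝ) (x : Eucl d) (t : ℝ) :
    Real.exp (-heatExponent y T (x, t)) = gaussWeight y (T - t) x := rfl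

lemma exp_neg_heatExponent_div_two (y : Eucl d) (T : ℝ) (x : Eucl d) (t : ℝ) :
    Real.exp (-heatExponent y T (x, t) / 2) = gaussWeight y (2 * (T - t)) x := by
  unfold heatExponent gaussWeight
  congr 1
  simp only [mul_inv]
  ring

end GaussWeight

lemma mul_le_mul_add_of_hasDerivAt_le {Y w w' : ℝ → ℝ} {s t C : ℝ} (hst : s ≤ t)
    (hw : ∀ r ∈ Icc s t, HasDerivAt w (w' r) r)
    (hY : ∀ r ∈ Icc s t, ∃ D, HasDerivAt Y D r ∧ w' r * Y r + w r * D ≤ C) :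
    w t * Y t ≤ w s * Y s + C * (t - s) := by
  choose! D hD hle using hY
  have hd : ∀ r ∈ Icc s t, HasDerivAt (fun r => w r * Y r - C * r)
      (w' r * Y r + w r * D r - C) r := fun r hr => by
    simpa using ((hw r hr).fun_mul (hD r hr)).fun_sub ((hasDerivAt_id r).const_mul C)
  have hanti : AntitoneOn (fun r => w r * Y r - C * r) (Icc s t) := by
    refine antitoneOn_of_hasDerivWithinAt_nonpos (convex_Icc s t)
      (fun r hr => (hd r hr).continuousAt.continuousWithinAt)
      (fun r hr => (hd r (interior_subset hr)).hasDerivWithinAt) fun r hr => ?_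
    have := hle r (interior_subset hr)
    linarith
  have := hanti (left_mem_Icc.2 hst) (right_mem_Icc.2 hst) hst
  simp only at this
  linarith

section Weighted

variable {d : ℕ}

/-- A Gronwall inequality for Gaussian-weighted integrals, with the weight cut off at infinity. -/
lemma mul_integral_gaussWeight_le {Q : Eucl d × ℝ → ℝ} {y : Eucl d} {T s t k W J : ℝ} {c w : ℝ → ℝ}
    (hQ : ContDiffOn ℝ ∞ Q (univ ×ˢ Ioo 0 T)) (hQ0 : ∀ p, 0 ≤ Q p) (hs : 0 < s) (hst : s ≤ t)
    (htT : t < T) (hk : 0 ≤ k) (hw : ∀ r ∈ Icc s t, HasDerivAt w (-c r * w r) r)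
    (hw0 : ∀ r ∈ Icc s t, 0 ≤ w r) (hwW : ∀ r ∈ Icc s t, w r ≤ W)
    (hmain : ∀ δ, 0 < δ → ∀ F F1 F2 H : ℝ → ℝ, IsExpCutoff δ F F1 F2 H →
      ∀ K : Set (Eucl d), IsCompact K →
      (∀ x ∉ K, ∀ t ∈ Ioo 0 T, F (heatExponent y T (x, t)) = 0) →
      ∃ X : Fin d → Eucl d × ℝ → ℝ, (∀ i, ContDiffOn ℝ ∞ (X i) (univ ×ˢ Ioo 0 T)) ∧
        (∀ i, ∀ x ∉ K, ∀ t ∈ Ioo 0 T, X i (x, t) = 0) ∧ ∀ p : Eucl d × ℝ, p.2 ∈ Ioo 0 T →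
        pd tmDir (fun p => Q p * F (heatExponent y T p)) p
          ≤ (c p.2 * (Q p * F (heatExponent y T p)) + δ / (T - p.2) * (Q p
            * (k * Real.exp (-heatExponent y T p / 2)))) + ∑ i, pd (spDir i) (X i) p)
    (hint : ∀ r ∈ Icc s t, Integrable fun x => Q (x, r) * gaussWeight y (2 * (T - r)) x)
    (hJ : ∀ r ∈ Icc s t, ∫ x, Q (x, r) * gaussWeight y (2 * (T - r)) x ≤ J) :
    w t * ∫ x, Q (x, t) * gaussWeight y (T - t) x
      ≤ w s * ∫ x, Q (x, s) * gaussWeight y (T - s) x := by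
  have hsub : ∀ r ∈ Icc s t, r ∈ Ioo 0 T := fun r hr =>
    ⟨hs.trans_le hr.1, hr.2.trans_lt htT⟩
  have htt : t ∈ Icc s t := right_mem_Icc.2 hst
  have hss : s ∈ Icc s t := left_mem_Icc.2 hst
  have hτ : 0 < T - t := by linarith
  have hcont : ∀ r ∈ Icc s t, Continuous fun x => Q (x, r) := fun r hr =>
    (contDiff_slice hQ (hsub r hr)).continuous
  have hint1 : ∀ r ∈ Icc s t, Integrable fun x => Q (x, r) * gaussWeight y (T - r) x := by
    intro r hr
    have h1 : 0 < T - r := by linarith [hr.2]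
    refine (hint r hr).mono' ((hcont r hr).mul (continuous_gaussWeight _ _)).aestronglyMeasurable
      (Eventually.of_forall fun x => ?_)
    rw [Real.norm_of_nonneg (mul_nonneg (hQ0 _) (gaussWeight_pos _ _ _).le)]
    exact mul_le_mul_of_nonneg_left (gaussWeight_mono y h1 (by linarith) x) (hQ0 _)
  -- The cutoff error δ/(T-r) is largest at r = t, so one constant serves the whole interval.
  set C := W * (1 / (T - t) * (k * J)) with hC
  -- With a fixed cutoff all integrands have compact support, so differentiation under the integral
  -- and the divergence theorem apply; the a priori bound J controls the price δ C (t-s).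
  have step : ∀ δ, 0 < δ → ∃ F : ℝ → ℝ, (Continuous F) ∧ (∀ q, 0 ≤ F q) ∧
      (∀ q, F q ≤ Real.exp (-q)) ∧ (∀ q, q ≤ 1 / δ → F q = Real.exp (-q)) ∧
      w t * ∫ x, Q (x, t) * F (heatExponent y T (x, t))
        ≤ w s * (∫ x, Q (x, s) * gaussWeight y (T - s) x) + δ * C * (t - s) := by
    intro δ hδ
    obtain ⟨F, F1, F2, H, hF⟩ := exists_isExpCutoff hδ
    obtain ⟨K, hK, hK0⟩ := hF.exists_compact y T
    obtain ⟨X, hX, hX0, hle⟩ := hmain δ hδ F F1 F2 H hF K hK hK0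
    refine ⟨F, hF.smooth.continuous, hF.nonneg, hF.le_exp, hF.eq_exp, ?_⟩
    have hf : ContDiffOn ℝ ∞ (fun p => Q p * F (heatExponent y T p)) (univ ×ˢ Ioo 0 T) :=
      hQ.mul hF.contDiffOn
    have hf0 : ∀ x ∉ K, ∀ t ∈ Ioo 0 T, Q (x, t) * F (heatExponent y T (x, t)) = 0 :=
      fun x hx t ht => by rw [hK0 x hx t ht, mul_zero]
    have hfint : ∀ r ∈ Icc s t, Integrable fun x => Q (x, r) * F (heatExponent y T (x, r)) :=
      fun r hr => integrable_slice hK hf.continuousOn hf0 (hsub r hr)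
    have hY := mul_le_mul_add_of_hasDerivAt_le
      (Y := fun r => ∫ x, Q (x, r) * F (heatExponent y T (x, r))) (w := w)
      (w' := fun r => -c r * w r) (C := δ * C) hst hw ?_
    · refine hY.trans (add_le_add_left (mul_le_mul_of_nonneg_left ?_ (hw0 s hss)) _)
      exact integral_mono (hfint s hss) (hint1 s hss) fun x =>
        mul_le_mul_of_nonneg_left (hF.le_exp _) (hQ0 _)
    · intro r hr
      have hτr : 0 < T - r := by linarith [hr.2]
      have hB1 : Integrable fun x => c r * (Q (x, r) * F (heatExponent y T (x, r))) :=
        (hfint r hr).const_mul _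
      have hB2 : Integrable fun x => δ / (T - r) * (Q (x, r)
            * (k * Real.exp (-heatExponent y T (x, r) / 2))) := by
        simp_rw [exp_neg_heatExponent_div_two]
        refine Integrable.const_mul ?_ _
        refine ((hint r hr).const_mul k).congr (Eventually.of_forall fun x => ?_)
        simp only
        ring
      obtain ⟨D, hD, hDle⟩ := exists_hasDerivAt_integral_le isOpen_Ioo
        (B := fun p => c p.2 * (Q p * F (heatExponent y T p)) + δ / (T - p.2) * (Q p
            * (k * Real.exp (-heatExponent y T p / 2)))) hK hf hf0 hX hX0 (hsub r hr)
        (hB1.add hB2) (fun x => hle (x, r) (hsub r hr))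
      refine ⟨D, hD, ?_⟩
      rw [integral_add hB1 hB2, integral_const_mul, integral_const_mul] at hDle
      have h1 : ∫ x, Q (x, r) * (k * Real.exp (-heatExponent y T (x, r) / 2)) ≤ k * J := by
        refine le_trans (le_of_eq ?_) (mul_le_mul_of_nonneg_left (hJ r hr) hk)
        rw [← integral_const_mul]
        congr with x
        rw [exp_neg_heatExponent_div_two]
        ring
      have hkJ : 0 ≤ k * J := by
        refine mul_nonneg hk (le_trans (integral_nonneg fun x => ?_) (hJ r hr))
        exact mul_nonneg (hQ0 _) (gaussWeight_pos _ _ _).le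
      have h2 : δ / (T - r) * ∫ x, Q (x, r) * (k * Real.exp (-heatExponent y T (x, r) / 2))
          ≤ δ * (1 / (T - t) * (k * J)) := by
        rw [div_eq_mul_one_div, mul_assoc]
        refine mul_le_mul_of_nonneg_left ?_ hδ.le
        refine (mul_le_mul_of_nonneg_left h1 (by positivity)).trans ?_
        exact mul_le_mul_of_nonneg_right (one_div_le_one_div_of_le hτ (by linarith [hr.2])) hkJ
      have h3 := mul_le_mul_of_nonneg_left hDle (hw0 r hr)
      have h4 := mul_le_mul_of_nonneg_left h2 (hw0 r hr)
      have h5 : w r * (δ * (1 / (T - t) * (k * J))) ≤ W * (δ * (1 / (T - t) * (k * J))) :=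
        mul_le_mul_of_nonneg_right (hwW r hr) (by positivity)
      simp only [hC]
      linarith
  have hδn : ∀ n : ℕ, 0 < 1 / ((n : ℝ) + 1) := fun n => by positivity
  choose! F hFc hF0 hFle hFeq hFmain using step
  have hlim1 : Tendsto (fun n : ℕ => w t *
      ∫ x, Q (x, t) * F (1 / ((n : ℝ) + 1)) (heatExponent y T (x, t))) atTop
      (𝓝 (w t * ∫ x, Q (x, t) * gaussWeight y (T - t) x)) := by
    refine Tendsto.const_mul _ (tendsto_integral_of_dominated_convergence
      (fun x => Q (x, t) * gaussWeight y (T - t) x) (fun n => ?_) (hint1 t htt)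
      (fun n => Eventually.of_forall fun x => ?_) (Eventually.of_forall fun x => ?_))
    · refine Continuous.aestronglyMeasurable ((hcont t htt).mul ((hFc _ (hδn n)).comp ?_))
      change Continuous fun x : Eucl d => ‖x - y‖ ^ 2 * (4 * (T - t))⁻¹
      fun_prop
    · rw [Real.norm_of_nonneg (mul_nonneg (hQ0 _) (hF0 _ (hδn n) _)), ← exp_neg_heatExponent]
      exact mul_le_mul_of_nonneg_left (hFle _ (hδn n) _) (hQ0 _)
    -- At each point the sequence is eventually constant, since F agrees with exp(-q) up to q = 1/δ
    -- = n+1.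
    · refine tendsto_const_nhds.congr' ?_
      obtain ⟨N, hN⟩ := exists_nat_ge (heatExponent y T (x, t))
      filter_upwards [eventually_ge_atTop N] with n hn
      rw [hFeq _ (hδn n), exp_neg_heatExponent]
      rw [one_div_one_div]
      have : (N : ℝ) ≤ n := by exact_mod_cast hn
      linarith
  have hlim2 : Tendsto (fun n : ℕ => w s * (∫ x, Q (x, s) * gaussWeight y (T - s) x)
      + 1 / ((n : ℝ) + 1) * C * (t - s)) atTop
      (𝓝 (w s * (∫ x, Q (x, s) * gaussWeight y (T - s) x) + 0 * C * (t - s))) :=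
    tendsto_const_nhds.add ((tendsto_one_div_add_atTop_nhds_zero_nat.mul_const C).mul_const _)
  have := le_of_tendsto_of_tendsto' hlim1 hlim2 fun n => hFmain _ (hδn n)
  simpa using this

/-- Gaussian-weighted integrals of bounded nonnegative subsolutions of `∂ₜP = ΔP + L P`. -/
lemma integral_subsolution_gaussWeight_le (hd : 2 ≤ d) {P : Eucl d × ℝ → ℝ} {L T M s t : ℝ}
    (hL : 0 ≤ L) (hP : ContDiffOn ℝ ∞ P (univ ×ˢ Ioo 0 T)) (hP0 : ∀ p, 0 ≤ P p) (y : Eucl d)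
    (hs : 0 < s) (hst : s ≤ t) (htT : t < T)
    (hsub : ∀ p : Eucl d × ℝ, p.2 ∈ Ioo 0 T →
      pd tmDir P p ≤ ∑ i, pd (spDir i) (pd (spDir i) P) p + L * P p)
    (hM : ∀ p : Eucl d × ℝ, p.2 ∈ Ioo 0 T → P p ≤ M) :
    ∫ x, P (x, t) * gaussWeight y (T - t) x
      ≤ Real.exp (L * (t - s)) * ∫ x, P (x, s) * gaussWeight y (T - s) x := by
  have hsub' : ∀ r ∈ Icc s t, r ∈ Ioo 0 T := fun r hr =>
    ⟨hs.trans_le hr.1, hr.2.trans_lt htT⟩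
  have hint : ∀ r ∈ Icc s t, Integrable fun x => P (x, r) * gaussWeight y (2 * (T - r)) x := by
    intro r hr
    refine ((integrable_gaussWeight y (by linarith [hr.2] : 0 < 2 * (T - r))).const_mul M).mono'
      ((contDiff_slice hP (hsub' r hr)).continuous.mul
        (continuous_gaussWeight _ _)).aestronglyMeasurable (Eventually.of_forall fun x => ?_)
    rw [Real.norm_of_nonneg (mul_nonneg (hP0 _) (gaussWeight_pos _ _ _).le)]
    exact mul_le_mul_of_nonneg_right (hM _ (hsub' r hr)) (gaussWeight_pos _ _ _).le
  have hM0 : 0 ≤ M := (hP0 (0, s)).trans (hM _ (hsub' s (left_mem_Icc.2 hst)))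
  -- Boundedness of P makes the a priori bound J immediate: M times the mass of the widest Gaussian
  -- that occurs.
  have key := mul_integral_gaussWeight_le (c := fun _ => L) (w := fun r => Real.exp (-(L * r)))
    (k := 12 + (d / 2 + 1)) (W := 1) (J := M * ∫ x, gaussWeight y (2 * T) x) (y := y)
    hP hP0 hs hst htT (by positivity) ?_ (fun r _ => (Real.exp_pos _).le) ?_ ?_ hint ?_
  · have := mul_le_mul_of_nonneg_left key (Real.exp_pos (L * t)).le
    rw [← mul_assoc, ← mul_assoc, ← Real.exp_add, ← Real.exp_add, add_neg_cancel, Real.exp_zero,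
      one_mul] at this
    rwa [show L * (t - s) = L * t + -(L * s) by ring]
  · intro r _
    refine (((hasDerivAt_id r).const_mul L).neg.exp).congr_deriv ?_
    simp
    ring
  · intro r hr
    exact Real.exp_le_one_iff.2 (by nlinarith [hr.1])
  · intro δ hδ F F1 F2 H hF K hK hK0
    refine ⟨fun i p => pd (spDir i) P p * F (heatExponent y T p)
          - P p * pd (spDir i) (fun p => F (heatExponent y T p)) p, fun i => ?_,
          fun i x hx t ht => ?_, fun p hp =>
      hF.pd_tmDir_subsolution_mul_le hd hδ.le hP y hp (hP0 p) (hsub p hp)⟩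
    · exact ((hP.pd isOpen_Ioo _).mul hF.contDiffOn).sub (hP.mul (hF.contDiffOn.pd isOpen_Ioo _))
    · simp only
      rw [hK0 x hx t ht, pd_eq_zero_of_support (f := fun p => F (heatExponent y T p)) isOpen_Ioo
        hK.isClosed hK0 _ x hx t ht]
      simp
  · intro r hr
    rw [← integral_const_mul]
    refine integral_mono (hint r hr)
      ((integrable_gaussWeight y (by linarith [hr.1, hr.2])).const_mul M) fun x => ?_
    exact mul_le_mul (hM _ (hsub' r hr))
      (gaussWeight_mono y (by linarith [hr.2]) (by linarith [hr.1]) x) (gaussWeight_pos _ _ _).le hM0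

/-- **Monotonicity formula** for the Gaussian-weighted energy. -/
lemma rpow_mul_integral_glEnergy_le (hd : 2 ≤ d) {ε : ℝ} {U : Eucl d × ℝ → ℂ} (hU : SolvesGL ε U)
    (y : Eucl d) {T s t J : ℝ} (hs : 0 < s) (hst : s ≤ t) (htT : t < T)
    (hint : ∀ r ∈ Icc s t, Integrable fun x =>
      glEnergy ε U (x, r) * gaussWeight y (2 * (T - r)) x)
    (hJ : ∀ r ∈ Icc s t, ∫ x, glEnergy ε U (x, r) * gaussWeight y (2 * (T - r)) x ≤ J) :
    (T - t) ^ (-(((d : ℝ) - 2) / 2)) * ∫ x, glEnergy ε U (x, t) * gaussWeight y (T - t) x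
      ≤ (T - s) ^ (-(((d : ℝ) - 2) / 2)) * ∫ x, glEnergy ε U (x, s) * gaussWeight y (T - s) x := by
  have hI : IsOpen (Ioo 0 T) := isOpen_Ioo
  have hUs : ContDiffOn ℝ ∞ U (univ ×ˢ Ioo 0 T) :=
    hU.smooth.mono (prod_mono subset_rfl fun t ht => ht.1)
  have hκ : 0 ≤ ((d : ℝ) - 2) / 2 := by
    have : (2 : ℝ) ≤ d := by exact_mod_cast hd
    linarith
  -- The integrating factor solves w' = -c w for c = -(d-2)/(2(T-r)), which gives the power of T-r;
  -- it increases with r, so its value at t serves as W.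
  refine mul_integral_gaussWeight_le (c := fun r => -((d : ℝ) - 2) / (2 * (T - r)))
    (w := fun r => (T - r) ^ (-(((d : ℝ) - 2) / 2)))
    (k := 12 + (d / 2 + 1)) (W := (T - t) ^ (-(((d : ℝ) - 2) / 2))) (J := J) (y := y)
    (glEnergy_contDiffOn hI hUs) (glEnergy_nonneg ε U) hs hst htT (by positivity) ?_ ?_ ?_ ?_ hint hJ
  · intro r hr
    have hτ : 0 < T - r := by linarith [hr.2]
    refine (((hasDerivAt_id r).const_sub T).rpow_const (Or.inl hτ.ne')).congr_deriv ?_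
    simp only [id]
    rw [Real.rpow_sub_one hτ.ne']
    field_simp
  · intro r hr
    have hτ : 0 < T - r := by linarith [hr.2]
    positivity
  · intro r hr
    exact Real.rpow_le_rpow_of_nonpos (by linarith) (by linarith [hr.2]) (by linarith)
  · intro δ hδ F F1 F2 H hF K hK hK0
    refine ⟨fun i p => F (heatExponent y T p) *
            inner ℝ (pd (spDir i) U p) (pd tmDir U p)
          + (∑ j, pd (spDir j) (fun p => F (heatExponent y T p)) p *
            inner ℝ (pd (spDir i) U p) (pd (spDir j) U p)
            - pd (spDir i) (fun p => F (heatExponent y T p)) p * glEnergy ε U p), fun i => ?_,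
          fun i x hx t ht => ?_, fun p hp => hF.pd_tmDir_glEnergy_mul_le hδ.le hU y hp⟩
    · refine (hF.contDiffOn.mul ((hUs.pd hI _).inner ℝ (hUs.pd hI _))).add
        (ContDiffOn.sub (ContDiffOn.sum fun j _ => (hF.contDiffOn.pd hI _).mul
          ((hUs.pd hI _).inner ℝ (hUs.pd hI _))) ((hF.contDiffOn.pd hI _).mul
          (glEnergy_contDiffOn hI hUs)))
    · simp only
      rw [hK0 x hx t ht]
      simp [pd_eq_zero_of_support (f := fun p => F (heatExponent y T p)) isOpen_Ioo
        hK.isClosed hK0 _ x hx t ht]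

end Weighted

end

/-! ### Difference quotients of weakly differentiable functions in Gaussian norms -/

noncomputable section

lemma sq_lintegral_le {α : Type*} [MeasurableSpace α] (ν : Measure α) {f : α → ℝ≥0∞}
    (hf : AEMeasurable f ν) : (∫⁻ a, f a ∂ν) ^ 2 ≤ ν univ * ∫⁻ a, f a ^ 2 ∂ν := by
  have h := ENNReal.lintegral_mul_le_Lp_mul_Lq ν (p := 2) (q := 2) Real.HolderConjugate.two_two
    hf (g := fun _ => 1) aemeasurable_const
  simp only [Pi.mul_apply, mul_one, ENNReal.one_rpow, lintegral_one] at h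
  calc (∫⁻ a, f a ∂ν) ^ 2
      ≤ ((∫⁻ a, f a ^ (2 : ℝ) ∂ν) ^ (1 / 2 : ℝ) * ν univ ^ (1 / 2 : ℝ)) ^ 2 := by gcongr
    _ = ν univ * ∫⁻ a, f a ^ 2 ∂ν := by
        rw [mul_pow, ← ENNReal.rpow_natCast, ← ENNReal.rpow_natCast, ← ENNReal.rpow_mul,
          ← ENNReal.rpow_mul]
        simp [mul_comm]

section Mollification

variable {d : ℕ}

/-- From |x-y|² ≤ 2|x+a-y|² + 2: doubling τ absorbs the factor 2, and the leftover 1/(4τ) is at most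
1 because τ ≥ 1. -/
lemma gaussWeight_add_le (y : Eucl d) {τ : ℝ} (hτ : 1 ≤ τ) {a : Eucl d} (ha : ‖a‖ ≤ 1)
    (x : Eucl d) : gaussWeight y τ (x + a) ≤ Real.exp 1 * gaussWeight y (2 * τ) x := by
  unfold gaussWeight
  rw [← Real.exp_add]
  refine Real.exp_le_exp.2 ?_
  have h1 : ‖x - y‖ ≤ ‖x + a - y‖ + ‖a‖ := by
    calc ‖x - y‖ = ‖(x + a - y) - a‖ := by congr 1; abel
      _ ≤ _ := norm_sub_le _ _
  have h2 : ‖x - y‖ ^ 2 ≤ 2 * ‖x + a - y‖ ^ 2 + 2 := by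
    have : ‖x - y‖ ^ 2 ≤ (‖x + a - y‖ + ‖a‖) ^ 2 := by gcongr
    nlinarith [sq_nonneg (‖x + a - y‖ - ‖a‖), norm_nonneg a]
  rw [← div_eq_mul_inv, ← div_eq_mul_inv]
  have h3 : ‖x - y‖ ^ 2 / (4 * (2 * τ)) ≤ (2 * ‖x + a - y‖ ^ 2 + 2) / (4 * (2 * τ)) := by gcongr
  have h4 : (2 * ‖x + a - y‖ ^ 2 + 2) / (4 * (2 * τ)) = ‖x + a - y‖ ^ 2 / (4 * τ) + 1 / (4 * τ) := by
    field_simp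
  have h5 : 1 / (4 * τ) ≤ 1 := by
    rw [div_le_one (by positivity)]
    linarith
  linarith

/-- Tonelli moves each translation from f onto the weight, where `gaussWeight_add_le` applies. It is
used for averages along a segment and for mollification. -/
lemma lintegral_gaussWeight_shift_average_le (ν : Measure (Eucl d)) [SFinite ν]
    (hν : ∀ᵐ a ∂ν, ‖a‖ ≤ 1) {f : Eucl d → ℝ≥0∞} (hf : Measurable f) (y : Eucl d) {τ : ℝ}
    (hτ : 1 ≤ τ) :
    ∫⁻ x, ENNReal.ofReal (gaussWeight y τ x) * ∫⁻ a, f (x - a) ∂ν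
      ≤ ENNReal.ofReal (Real.exp 1) * ν univ
        * ∫⁻ x, ENNReal.ofReal (gaussWeight y (2 * τ) x) * f x := by
  have hg : ∀ τ, Measurable fun x => ENNReal.ofReal (gaussWeight y τ x) := fun τ =>
    (continuous_gaussWeight y τ).measurable.ennreal_ofReal
  calc ∫⁻ x, ENNReal.ofReal (gaussWeight y τ x) * ∫⁻ a, f (x - a) ∂ν
      = ∫⁻ x, ∫⁻ a, ENNReal.ofReal (gaussWeight y τ x) * f (x - a) ∂ν := by
        refine lintegral_congr fun x => ?_
        rw [lintegral_const_mul]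
        exact hf.comp (measurable_const.sub measurable_id)
    _ = ∫⁻ a, (∫⁻ x, ENNReal.ofReal (gaussWeight y τ x) * f (x - a)) ∂ν := by
        refine lintegral_lintegral_swap (Measurable.aemeasurable ?_)
        exact ((hg τ).comp measurable_fst).mul (hf.comp (measurable_fst.sub measurable_snd))
    _ = ∫⁻ a, (∫⁻ x, ENNReal.ofReal (gaussWeight y τ (x + a)) * f x) ∂ν := by
        refine lintegral_congr fun a => ?_
        rw [← lintegral_add_right_eq_self (μ := volume) _ a]
        simp
    _ ≤ ∫⁻ a, (ENNReal.ofReal (Real.exp 1)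
          * ∫⁻ x, ENNReal.ofReal (gaussWeight y (2 * τ) x) * f x) ∂ν := by
        refine lintegral_mono_ae (hν.mono fun a ha => ?_)
        rw [← lintegral_const_mul' _ _ ENNReal.ofReal_ne_top]
        refine lintegral_mono fun x => ?_
        rw [← mul_assoc, ← ENNReal.ofReal_mul (Real.exp_pos _).le]
        gcongr
        exact gaussWeight_add_le y hτ ha x
    _ = _ := by
        rw [lintegral_const]
        ring

open scoped Convolution

/-- The derivative of the convolution falls on φ, and z ↦ φ(x-z) is an admissible test function in
the definition of the weak gradient. -/
lemma hasFDerivAt_mollification {w : Eucl d → ℂ} {g : Fin d → Eucl d → ℂ}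
    (hw : IsWeakGradient w g) {φ : Eucl d → ℝ} (hφ : ContDiff ℝ ∞ φ) (hφc : HasCompactSupport φ) :
    ContDiff ℝ ∞ (φ ⋆[ContinuousLinearMap.lsmul ℝ ℝ, volume] w) ∧
    ∀ i x, fderiv ℝ (φ ⋆[ContinuousLinearMap.lsmul ℝ ℝ, volume] w) x (EuclideanSpace.single i 1)
      = (φ ⋆[ContinuousLinearMap.lsmul ℝ ℝ, volume] g i) x := by
  rw [← convolution_flip]
  refine ⟨hφc.contDiff_convolution_right _ hw.1 hφ, fun i x => ?_⟩
  have hφ1 : ContDiff ℝ 1 φ := hφ.of_le (by simp)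
  rw [(hφc.hasFDerivAt_convolution_right _ hw.1 hφ1 x).fderiv,
    convolution_precompR_apply _ hw.1 (hφc.fderiv ℝ) (hφ1.continuous_fderiv (by simp)),
    convolution_eq_swap (f := φ)]
  simp only [convolution_def, ContinuousLinearMap.flip_apply, ContinuousLinearMap.lsmul_apply]
  have h := (hw.2 i).2 (fun z => φ (x - z)) (hφ.comp (contDiff_const.sub contDiff_id))
    (hφc.comp_homeomorph (Homeomorph.subLeft x))
  rw [← neg_eq_iff_eq_neg, ← integral_neg] at h
  rw [← h]
  refine integral_congr_ae (Eventually.of_forall fun z => ?_)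
  simp only [classicalPartial]
  rw [← neg_smul]
  congr 1
  have := ((hφ1.differentiable (by simp) (x - z)).hasFDerivAt.comp z
    ((hasFDerivAt_id z).const_sub x)).fderiv
  rw [show (fun z => φ (x - z)) = φ ∘ HSub.hSub x from rfl, this]
  simp

/-- Jensen's inequality for the probability density φ. The strongly measurable representative g' is
there because the averaging lemma asks for genuine measurability. -/
lemma enorm_convolution_sq_le (φ : ContDiffBump (0 : Eucl d)) {g g' : Eucl d → ℂ}
    (hg' : StronglyMeasurable g') (hgg' : g =ᵐ[volume] g') (x : Eucl d) :
    ‖(φ.normed volume ⋆[ContinuousLinearMap.lsmul ℝ ℝ, volume] g) x‖ₑ ^ 2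
      ≤ ∫⁻ a, ‖g' (x - a)‖ₑ ^ 2 ∂(volume.withDensity fun a => ENNReal.ofReal (φ.normed volume a)) := by
  set ν : Measure (Eucl d) := volume.withDensity fun a => ENNReal.ofReal (φ.normed volume a) with hν
  have hφm : Measurable fun a => ENNReal.ofReal (φ.normed volume a) :=
    φ.continuous_normed.measurable.ennreal_ofReal
  have hν1 : ν univ = 1 := by
    rw [hν, withDensity_apply _ MeasurableSet.univ, Measure.restrict_univ,
      ← ofReal_integral_eq_lintegral_ofReal φ.integrable_normed
        (Eventually.of_forall φ.nonneg_normed), φ.integral_normed, ENNReal.ofReal_one]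
  have hm : Measurable fun a => ‖g' (x - a)‖ₑ :=
    (hg'.measurable.comp (measurable_const.sub measurable_id)).enorm
  have h1 : (φ.normed volume ⋆[ContinuousLinearMap.lsmul ℝ ℝ, volume] g) x
      = ∫ a, φ.normed volume a • g' (x - a) := by
    rw [convolution_def]
    refine integral_congr_ae ?_
    have : ∀ᵐ a, g (x - a) = g' (x - a) :=
      (quasiMeasurePreserving_sub_left volume x).ae hgg'
    filter_upwards [this] with a ha
    simp [ha]
  have h2 : ‖(φ.normed volume ⋆[ContinuousLinearMap.lsmul ℝ ℝ, volume] g) x‖ₑ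
      ≤ ∫⁻ a, ‖g' (x - a)‖ₑ ∂ν := by
    rw [h1]
    refine (enorm_integral_le_lintegral_enorm _).trans (le_of_eq ?_)
    rw [hν, lintegral_withDensity_eq_lintegral_mul _ hφm hm]
    refine lintegral_congr fun a => ?_
    rw [enorm_smul, Pi.mul_apply, Real.enorm_of_nonneg (φ.nonneg_normed a)]
  calc _ ≤ (∫⁻ a, ‖g' (x - a)‖ₑ ∂ν) ^ 2 := by gcongr
    _ ≤ ν univ * ∫⁻ a, ‖g' (x - a)‖ₑ ^ 2 ∂ν := sq_lintegral_le ν hm.aemeasurable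
    _ = _ := by rw [hν1, one_mul]

/-- The fundamental theorem of calculus along the segment, then Cauchy-Schwarz. Pushing dθ forward
by θ ↦ -θe puts the segment average into the form required by
`lintegral_gaussWeight_shift_average_le`. -/
lemma enorm_sub_sq_le_of_contDiff {W : Eucl d → ℂ} (hW : ContDiff ℝ 1 W) (i : Fin d) {h : ℝ}
    (hh : 0 < h) (x : Eucl d) :
    ‖W (x + h • EuclideanSpace.single i 1) - W x‖ₑ ^ 2
      ≤ ENNReal.ofReal h * ∫⁻ a, ‖fderiv ℝ W (x - a) (EuclideanSpace.single i 1)‖ₑ ^ 2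
        ∂((volume.restrict (Ioc 0 h)).map fun θ : ℝ => -(θ • EuclideanSpace.single i (1 : ℝ))) := by
  set e : Eucl d := EuclideanSpace.single i 1 with he
  have hc : Continuous fun z => fderiv ℝ W z e :=
    (hW.continuous_fderiv (by simp)).clm_apply continuous_const
  have hcm : Continuous fun θ : ℝ => -(θ • e) := by fun_prop
  have hd : ∀ θ : ℝ, HasDerivAt (fun θ : ℝ => W (x + θ • e)) (fderiv ℝ W (x + θ • e) e) θ := by
    intro θ
    have h1 : HasDerivAt (fun θ : ℝ => x + θ • e) e θ := by
      simpa using ((hasDerivAt_id θ).smul_const e).const_add x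
    exact (hW.differentiable (by simp) _).hasFDerivAt.comp_hasDerivAt θ h1
  have hcont : Continuous fun θ : ℝ => fderiv ℝ W (x + θ • e) e := hc.comp (by fun_prop)
  have hftc : W (x + h • e) - W x = ∫ θ in Ioc 0 h, fderiv ℝ W (x + θ • e) e := by
    rw [← intervalIntegral.integral_of_le hh.le,
      intervalIntegral.integral_eq_sub_of_hasDerivAt (fun θ _ => hd θ)
        (hcont.intervalIntegrable _ _)]
    simp
  have hm : Measurable fun a => ‖fderiv ℝ W (x - a) e‖ₑ ^ 2 :=
    (hc.comp (continuous_const.sub continuous_id)).measurable.enorm.pow_const 2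
  rw [lintegral_map hm hcm.measurable]
  simp only [sub_neg_eq_add]
  rw [hftc]
  calc ‖∫ θ in Ioc 0 h, fderiv ℝ W (x + θ • e) e‖ₑ ^ 2
      ≤ (∫⁻ θ in Ioc 0 h, ‖fderiv ℝ W (x + θ • e) e‖ₑ) ^ 2 := by
        gcongr
        exact enorm_integral_le_lintegral_enorm _
    _ ≤ _ := sq_lintegral_le _ hcont.measurable.enorm.aemeasurable
    _ = _ := by simp

/-- The difference quotients of a weakly differentiable function are controlled by its gradient. -/
lemma lintegral_gaussWeight_enorm_sub_sq_le {w : Eucl d → ℂ} {g : Fin d → Eucl d → ℂ}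
    (hw : IsWeakGradient w g) (i : Fin d) {h : ℝ} (hh : 0 < h) (hh1 : h ≤ 1) (y : Eucl d) {τ : ℝ}
    (hτ : 1 ≤ τ) :
    ∫⁻ x, ENNReal.ofReal (gaussWeight y τ x)
        * ‖w (x + h • EuclideanSpace.single i 1) - w x‖ₑ ^ 2
      ≤ ENNReal.ofReal (Real.exp 2) * ENNReal.ofReal h ^ 2
        * ∫⁻ x, ENNReal.ofReal (gaussWeight y (4 * τ) x) * ‖g i x‖ₑ ^ 2 := by
  set e : Eucl d := EuclideanSpace.single i 1 with he
  have hg : ∀ τ, Measurable fun x => ENNReal.ofReal (gaussWeight y τ x) := fun τ =>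
    (continuous_gaussWeight y τ).measurable.ennreal_ofReal
  have hgi := (hw.2 i).1.aestronglyMeasurable
  set g' := hgi.mk _ with hg'
  have hg'm : StronglyMeasurable g' := hgi.stronglyMeasurable_mk
  have hgg' : g i =ᵐ[volume] g' := hgi.ae_eq_mk
  -- The inner radius is half the outer one, so that mollifications converge almost everywhere;
  -- outer radii at most 1 keep the shifts admissible.
  let φ : ℕ → ContDiffBump (0 : Eucl d) := fun n =>
    ⟨1 / (2 * ((n : ℝ) + 1)), 1 / ((n : ℝ) + 1), by positivity, by
      apply one_div_lt_one_div_of_lt <;> linarith [(n.cast_nonneg : (0 : ℝ) ≤ n)]⟩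
  have hφ : Tendsto (fun n => (φ n).rOut) atTop (𝓝 0) := tendsto_one_div_add_atTop_nhds_zero_nat
  have hφ2 : ∀ᶠ n in atTop, (φ n).rOut ≤ 2 * (φ n).rIn := Eventually.of_forall fun n => by
    change 1 / ((n : ℝ) + 1) ≤ 2 * (1 / (2 * ((n : ℝ) + 1)))
    apply le_of_eq
    field_simp
  set W : ℕ → Eucl d → ℂ := fun n =>
    (φ n).normed volume ⋆[ContinuousLinearMap.lsmul ℝ ℝ, volume] w with hWdef
  have hlim : ∀ᵐ x, Tendsto (fun n => W n x) atTop (𝓝 (w x)) :=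
    ContDiffBump.ae_convolution_tendsto_right_of_locallyIntegrable hφ hφ2 hw.1
  have hlim' : ∀ᵐ x, Tendsto (fun n => W n (x + h • e)) atTop (𝓝 (w (x + h • e))) :=
    (quasiMeasurePreserving_add_right volume (h • e)).ae hlim
  have hW := fun n => hasFDerivAt_mollification hw (φ := (φ n).normed volume)
    (φ n).contDiff_normed (φ n).hasCompactSupport_normed
  have hbound : ∀ n, ∫⁻ x, ENNReal.ofReal (gaussWeight y τ x) * ‖W n (x + h • e) - W n x‖ₑ ^ 2
      ≤ ENNReal.ofReal (Real.exp 2) * ENNReal.ofReal h ^ 2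
        * ∫⁻ x, ENNReal.ofReal (gaussWeight y (4 * τ) x) * ‖g i x‖ₑ ^ 2 := by
    intro n
    have hWc : ContDiff ℝ 1 (W n) := (hW n).1.of_le (by simp)
    have hcm : Continuous fun θ : ℝ => -(θ • e) := by fun_prop
    set ν₁ : Measure (Eucl d) := (volume.restrict (Ioc 0 h)).map fun θ : ℝ => -(θ • e) with hν₁
    set ν₂ : Measure (Eucl d) :=
      volume.withDensity fun a => ENNReal.ofReal ((φ n).normed volume a) with hν₂
    have hφm : Measurable fun a => ENNReal.ofReal ((φ n).normed volume a) :=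
      (φ n).continuous_normed.measurable.ennreal_ofReal
    have hν₁u : ν₁ univ = ENNReal.ofReal h := by
      rw [hν₁, Measure.map_apply hcm.measurable MeasurableSet.univ]
      simp
    have hν₂u : ν₂ univ = 1 := by
      rw [hν₂, withDensity_apply _ MeasurableSet.univ, Measure.restrict_univ,
        ← ofReal_integral_eq_lintegral_ofReal (φ n).integrable_normed
          (Eventually.of_forall (φ n).nonneg_normed), (φ n).integral_normed, ENNReal.ofReal_one]
    have hν₁1 : ∀ᵐ a ∂ν₁, ‖a‖ ≤ 1 := by
      rw [hν₁, ae_map_iff hcm.measurable.aemeasurable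
        (measurableSet_le measurable_norm measurable_const)]
      filter_upwards [ae_restrict_mem measurableSet_Ioc] with θ hθ
      rw [norm_neg, norm_smul, he, PiLp.norm_single, norm_one, mul_one,
        Real.norm_of_nonneg hθ.1.le]
      exact hθ.2.trans hh1
    have hν₂1 : ∀ᵐ a ∂ν₂, ‖a‖ ≤ 1 := by
      rw [hν₂, ae_withDensity_iff hφm]
      refine Eventually.of_forall fun a ha => ?_
      have ha' : a ∈ Function.support ((φ n).normed volume) := by
        intro h0
        exact ha (by rw [h0, ENNReal.ofReal_zero])
      rw [(φ n).support_normed_eq, mem_ball_zero_iff] at ha'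
      refine ha'.le.trans ?_
      change 1 / ((n : ℝ) + 1) ≤ 1
      rw [div_le_one (by positivity)]
      linarith [(n.cast_nonneg : (0 : ℝ) ≤ n)]
    have : SFinite ν₁ := by
      rw [hν₁]
      infer_instance
    have hf1 : Measurable fun x => ‖fderiv ℝ (W n) x e‖ₑ ^ 2 :=
      ((hWc.continuous_fderiv (by simp)).clm_apply continuous_const).measurable.enorm.pow_const 2
    calc ∫⁻ x, ENNReal.ofReal (gaussWeight y τ x) * ‖W n (x + h • e) - W n x‖ₑ ^ 2
        ≤ ∫⁻ x, ENNReal.ofReal h * (ENNReal.ofReal (gaussWeight y τ x)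
            * ∫⁻ a, ‖fderiv ℝ (W n) (x - a) e‖ₑ ^ 2 ∂ν₁) := by
          refine lintegral_mono fun x => ?_
          rw [mul_left_comm]
          gcongr
          exact enorm_sub_sq_le_of_contDiff hWc i hh x
      _ = ENNReal.ofReal h * ∫⁻ x, ENNReal.ofReal (gaussWeight y τ x)
            * ∫⁻ a, ‖fderiv ℝ (W n) (x - a) e‖ₑ ^ 2 ∂ν₁ :=
          lintegral_const_mul' _ _ ENNReal.ofReal_ne_top
      -- The segment average has mass h, costs a factor e and doubles τ; the mollification in the
      -- next step costs another e and another doubling. Hence exp 2, h² and 4τ.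
      _ ≤ ENNReal.ofReal h * (ENNReal.ofReal (Real.exp 1) * ν₁ univ
            * ∫⁻ x, ENNReal.ofReal (gaussWeight y (2 * τ) x) * ‖fderiv ℝ (W n) x e‖ₑ ^ 2) := by
          gcongr
          exact lintegral_gaussWeight_shift_average_le ν₁ hν₁1 hf1 y hτ
      _ ≤ ENNReal.ofReal h * (ENNReal.ofReal (Real.exp 1) * ν₁ univ
            * (ENNReal.ofReal (Real.exp 1) * ν₂ univ
            * ∫⁻ x, ENNReal.ofReal (gaussWeight y (2 * (2 * τ)) x) * ‖g' x‖ₑ ^ 2)) := by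
          gcongr
          refine le_trans (lintegral_mono fun x => ?_) (lintegral_gaussWeight_shift_average_le ν₂
            hν₂1 (hg'm.measurable.enorm.pow_const 2) y (by linarith))
          gcongr
          rw [(hW n).2 i x]
          exact enorm_convolution_sq_le (φ n) hg'm hgg' x
      _ = _ := by
          have h1 : ∫⁻ x, ENNReal.ofReal (gaussWeight y (2 * (2 * τ)) x) * ‖g' x‖ₑ ^ 2
              = ∫⁻ x, ENNReal.ofReal (gaussWeight y (4 * τ) x) * ‖g i x‖ₑ ^ 2 := by
            rw [show 2 * (2 * τ) = 4 * τ by ring]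
            refine lintegral_congr_ae ?_
            filter_upwards [hgg'] with x hx
            rw [hx]
          rw [hν₁u, hν₂u, h1, show (2 : ℝ) = 1 + 1 by norm_num, Real.exp_add,
            ENNReal.ofReal_mul (Real.exp_pos _).le]
          ring
  -- The bound is uniform in n and the mollifications converge almost everywhere, so Fatou's lemma
  -- concludes.
  calc _ = ∫⁻ x, liminf (fun n => ENNReal.ofReal (gaussWeight y τ x)
          * ‖W n (x + h • e) - W n x‖ₑ ^ 2) atTop := by
        refine lintegral_congr_ae ?_
        filter_upwards [hlim, hlim'] with x hx hx'
        refine (Tendsto.liminf_eq (ENNReal.Tendsto.const_mul ?_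
          (Or.inr ENNReal.ofReal_ne_top))).symm
        exact ((ENNReal.continuous_pow 2).tendsto _).comp
          ((continuous_enorm.tendsto _).comp (hx'.sub hx))
    _ ≤ liminf (fun n => ∫⁻ x, ENNReal.ofReal (gaussWeight y τ x)
          * ‖W n (x + h • e) - W n x‖ₑ ^ 2) atTop := by
        refine lintegral_liminf_le fun n => (hg τ).mul (Measurable.pow_const ?_ 2)
        exact (((hW n).1.continuous.comp (by fun_prop)).sub (hW n).1.continuous).measurable.enorm
    _ ≤ _ := liminf_le_of_le (by isBoundedDefault) fun b hb => by
        obtain ⟨n, hn⟩ := hb.exists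
        exact hn.trans (hbound n)

end Mollification

end

/-! ### A priori gradient bounds from the datum through translated differences -/

noncomputable section

section Differences

variable {d : ℕ}

lemma pd_shift {U : Eucl d × ℝ → ℂ} (c p v : Eucl d × ℝ) :
    pd v (fun p => U (p + c)) p = pd v U (p + c) := by
  unfold pd
  rw [fderiv_comp_add_right]

lemma norm_reaction_sub_le {ε K : ℝ} {a b : ℂ} (ha : ‖a‖ ≤ K) (hb : ‖b‖ ≤ K) :
    ‖(1 / ε ^ 2 * (1 - ‖a‖ ^ 2)) • a - (1 / ε ^ 2 * (1 - ‖b‖ ^ 2)) • b‖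
      ≤ 1 / ε ^ 2 * (1 + 3 * K ^ 2) * ‖a - b‖ := by
  have hK : 0 ≤ K := (norm_nonneg a).trans ha
  have h1 : (1 / ε ^ 2 * (1 - ‖a‖ ^ 2)) • a - (1 / ε ^ 2 * (1 - ‖b‖ ^ 2)) • b
      = (1 / ε ^ 2) • ((1 - ‖a‖ ^ 2) • (a - b) - ((‖a‖ - ‖b‖) * (‖a‖ + ‖b‖)) • b) := by
    module
  have h2 : ‖(1 - ‖a‖ ^ 2) • (a - b)‖ ≤ (1 + K ^ 2) * ‖a - b‖ := by
    rw [norm_smul]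
    refine mul_le_mul_of_nonneg_right ?_ (norm_nonneg _)
    rw [Real.norm_eq_abs, abs_le]
    have : ‖a‖ ^ 2 ≤ K ^ 2 := by gcongr
    constructor <;> nlinarith [sq_nonneg ‖a‖, sq_nonneg K]
  have h3 : ‖((‖a‖ - ‖b‖) * (‖a‖ + ‖b‖)) • b‖ ≤ 2 * K ^ 2 * ‖a - b‖ := by
    rw [norm_smul, Real.norm_eq_abs, abs_mul, abs_of_nonneg (by positivity : 0 ≤ ‖a‖ + ‖b‖)]
    calc |‖a‖ - ‖b‖| * (‖a‖ + ‖b‖) * ‖b‖ ≤ ‖a - b‖ * (K + K) * K := by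
          gcongr
          exact abs_norm_sub_norm_le a b
      _ = _ := by ring
  rw [h1, norm_smul, Real.norm_of_nonneg (by positivity : 0 ≤ 1 / ε ^ 2), mul_assoc]
  refine mul_le_mul_of_nonneg_left ((norm_sub_le _ _).trans ?_) (by positivity)
  linarith

/-- For V = U(·+c) - U the heat operator applied to |V|² equals -2|∇V|² plus twice V paired with the
difference of the reaction terms, which are Lipschitz on the disc of radius K. -/
lemma SolvesGL.pd_tmDir_norm_sq_diff_le {ε K : ℝ} {U : Eucl d × ℝ → ℂ} (hU : SolvesGL ε U)
    (c : Eucl d) {p : Eucl d × ℝ} (hp : 0 < p.2) (h1 : ‖U (p + (c, 0))‖ ≤ K) (h2 : ‖U p‖ ≤ K) :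
    pd tmDir (fun p => ‖U (p + (c, 0)) - U p‖ ^ 2) p
      ≤ ∑ i, pd (spDir i) (pd (spDir i) fun p => ‖U (p + (c, 0)) - U p‖ ^ 2) p
        + 2 * (1 / ε ^ 2 * (1 + 3 * K ^ 2)) * ‖U (p + (c, 0)) - U p‖ ^ 2 := by
  set V : Eucl d × ℝ → ℂ := fun p => U (p + (c, 0)) - U p with hV
  have hUc : ContDiffOn ℝ ∞ (fun p => U (p + (c, 0))) (univ ×ˢ Ioi 0) :=
    hU.smooth.comp (contDiff_id.add contDiff_const).contDiffOn
      fun p hp => ⟨mem_univ _, by simpa using hp.2⟩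
  have hVs : ContDiffOn ℝ ∞ V (univ ×ˢ Ioi 0) := hUc.sub hU.smooth
  have hVd : ∀ p : Eucl d × ℝ, p.2 ∈ Ioi (0 : ℝ) → DifferentiableAt ℝ V p := fun p hp =>
    differentiableAt_of_slab isOpen_Ioi hVs hp
  have hp' : (p + (c, (0 : ℝ))).2 ∈ Ioi (0 : ℝ) := by simpa using hp
  have hpd : ∀ v, ∀ x, ∀ t ∈ Ioi (0 : ℝ), pd v V (x, t) = pd v U ((x, t) + (c, 0)) - pd v U (x, t) := by
    intro v x t ht
    rw [hV, pd_sub (differentiableAt_of_slab isOpen_Ioi hUc (p := (x, t)) ht)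
      (differentiableAt_of_slab isOpen_Ioi hU.smooth (p := (x, t)) ht), pd_shift]
  have hpd2 : ∀ i, pd (spDir i) (pd (spDir i) V) p
      = pd (spDir i) (pd (spDir i) U) (p + (c, 0)) - pd (spDir i) (pd (spDir i) U) p := by
    intro i
    rw [pd_congr isOpen_Ioi (g := fun p => pd (spDir i) U (p + (c, 0)) - pd (spDir i) U p)
      (hpd _) hp, pd_sub, pd_shift]
    · have := differentiableAt_of_slab isOpen_Ioi (hU.smooth.pd isOpen_Ioi (spDir i)) hp'
      exact this.comp p (f := fun p => p + (c, (0 : ℝ))) (by fun_prop)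
    · exact differentiableAt_of_slab isOpen_Ioi (hU.smooth.pd isOpen_Ioi (spDir i)) hp
  have hP2 : ∀ i, pd (spDir i) (pd (spDir i) fun p => ‖V p‖ ^ 2) p
      = 2 * (‖pd (spDir i) V p‖ ^ 2 + inner ℝ (V p) (pd (spDir i) (pd (spDir i) V) p)) := by
    intro i
    have hd2 := differentiableAt_of_slab isOpen_Ioi (hVs.pd isOpen_Ioi (spDir i)) hp
    rw [pd_congr isOpen_Ioi (g := fun p => (2 : ℝ) * inner ℝ (V p) (pd (spDir i) V p))
      (fun x t ht => pd_norm_sq (hVd (x, t) ht)) hp,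
      pd_mul (differentiableAt_const _) ((hVd p hp).inner ℝ hd2), pd_inner (hVd p hp) hd2,
      real_inner_self_eq_norm_sq]
    simp [pd]
  have heq : pd tmDir V p = ∑ i, pd (spDir i) (pd (spDir i) V) p
      + ((1 / ε ^ 2 * (1 - ‖U (p + (c, 0))‖ ^ 2)) • U (p + (c, 0))
        - (1 / ε ^ 2 * (1 - ‖U p‖ ^ 2)) • U p) := by
    have := hpd tmDir p.1 p.2 hp
    rw [show (p.1, p.2) = p from rfl] at this
    rw [this, hU.equation _ hp', hU.equation _ hp]
    simp_rw [hpd2, Finset.sum_sub_distrib]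
    abel
  change pd tmDir (fun p => ‖V p‖ ^ 2) p ≤ ∑ i, pd (spDir i) (pd (spDir i) fun p => ‖V p‖ ^ 2) p
    + 2 * (1 / ε ^ 2 * (1 + 3 * K ^ 2)) * ‖V p‖ ^ 2
  rw [pd_norm_sq (hVd p hp), heq, inner_add_right, inner_sum]
  simp_rw [hP2, ← Finset.mul_sum, Finset.sum_add_distrib]
  have k1 : 0 ≤ ∑ i, ‖pd (spDir i) V p‖ ^ 2 := by positivity
  have k2 := real_inner_le_norm (V p) ((1 / ε ^ 2 * (1 - ‖U (p + (c, 0))‖ ^ 2)) • U (p + (c, 0))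
        - (1 / ε ^ 2 * (1 - ‖U p‖ ^ 2)) • U p)
  have k3 := mul_le_mul_of_nonneg_left (norm_reaction_sub_le (ε := ε) h1 h2) (norm_nonneg (V p))
  have k4 : ‖V p‖ * (1 / ε ^ 2 * (1 + 3 * K ^ 2) * ‖U (p + (c, 0)) - U p‖)
      = 1 / ε ^ 2 * (1 + 3 * K ^ 2) * ‖V p‖ ^ 2 := by
    simp only [hV]
    ring
  rw [k4] at k3
  linarith

end Differences

section InitialLayer

variable {d : ℕ} {ε K T : ℝ} {u₀ : Eucl d → ℂ} {u : ℝ → Eucl d → ℂ}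

lemma measurable_ofReal_gaussWeight (y : Eucl d) (τ : ℝ) :
    Measurable fun x => ENNReal.ofReal (gaussWeight y τ x) :=
  (continuous_gaussWeight y τ).measurable.ennreal_ofReal

lemma lintegral_gaussWeight_lt_top (y : Eucl d) {τ : ℝ} (hτ : 0 < τ) :
    ∫⁻ x, ENNReal.ofReal (gaussWeight y τ x) < ⊤ := by
  have := (integrable_gaussWeight y hτ).lintegral_lt_top
  exact this

/-- Local L¹ convergence is upgraded to the Gaussian-weighted norm on the whole space: |u - u₀| ≤
2K, and the Gaussian has small mass outside large balls. -/
lemma IsPGLSolution.tendsto_lintegral_gaussWeight (hu : IsPGLSolution ε u₀ u) (hT : 0 < T)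
    (hK : ∀ t ∈ Ioc 0 T, ∀ x, ‖u t x‖ ≤ K) (hK0 : ∀ᵐ x, ‖u₀ x‖ ≤ K) (y : Eucl d) {τ : ℝ}
    (hτ : 0 < τ) :
    Tendsto (fun s => ∫⁻ x, ENNReal.ofReal (gaussWeight y τ x) * ‖u s x - u₀ x‖ₑ)
      (𝓝[>] 0) (𝓝 0) := by
  set ν : Measure (Eucl d) := volume.withDensity fun x => ENNReal.ofReal (gaussWeight y τ x)
    with hν
  have hνapp : ∀ s, MeasurableSet s → ν s = ∫⁻ x in s, ENNReal.ofReal (gaussWeight y τ x) :=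
    fun s hs => withDensity_apply _ hs
  have hfin : ν univ ≠ ⊤ := by
    rw [hνapp _ MeasurableSet.univ, Measure.restrict_univ]
    exact (lintegral_gaussWeight_lt_top y hτ).ne
  have htail : Tendsto (fun n : ℕ => ν (Metric.ball 0 n)ᶜ) atTop (𝓝 0) := by
    have := tendsto_measure_iInter_atTop (μ := ν) (s := fun n : ℕ => (Metric.ball (0 : Eucl d) n)ᶜ)
      (fun n => measurableSet_ball.compl.nullMeasurableSet)
      (fun m n hmn => compl_subset_compl.2 (Metric.ball_subset_ball (by exact_mod_cast hmn)))
      ⟨0, ne_top_of_le_ne_top hfin (measure_mono (subset_univ _))⟩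
    rwa [← compl_iUnion, Metric.iUnion_ball_nat, compl_univ, measure_empty] at this
  rw [ENNReal.tendsto_nhds_zero]
  intro η hη
  have hη2 : 0 < η / 2 := ENNReal.half_pos hη.ne'
  have htail' : Tendsto (fun n : ℕ => ENNReal.ofReal (2 * K) * ν (Metric.ball 0 n)ᶜ) atTop
      (𝓝 0) := by
    have := ENNReal.Tendsto.const_mul htail (a := ENNReal.ofReal (2 * K))
      (Or.inr ENNReal.ofReal_ne_top)
    rwa [mul_zero] at this
  obtain ⟨n, hn, hn0⟩ := ((ENNReal.tendsto_nhds_zero.1 htail' _ hη2).and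
    (eventually_gt_atTop 0)).exists
  have hin := ENNReal.tendsto_nhds_zero.1 (hu.tendsto_initial n (by exact_mod_cast hn0)) _ hη2
  filter_upwards [hin, Ioc_mem_nhdsGT hT] with s hs hsT
  rw [← lintegral_add_compl _ (measurableSet_ball (x := (0 : Eucl d)) (ε := (n : ℝ)))]
  calc _ ≤ (∫⁻ x in Metric.ball 0 n, ‖u s x - u₀ x‖ₑ)
        + ∫⁻ x in (Metric.ball 0 n)ᶜ, ENNReal.ofReal (2 * K)
          * ENNReal.ofReal (gaussWeight y τ x) := by
        refine add_le_add (lintegral_mono fun x => ?_) (lintegral_mono_ae ?_)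
        · have : ENNReal.ofReal (gaussWeight y τ x) ≤ 1 := by
            rw [ENNReal.ofReal_le_one]
            exact Real.exp_le_one_iff.2 (neg_nonpos.2 (by positivity))
          exact mul_le_of_le_one_left zero_le this
        · refine (ae_restrict_of_ae hK0).mono fun x hx => ?_
          rw [mul_comm]
          gcongr
          rw [← ofReal_norm]
          refine ENNReal.ofReal_le_ofReal ((norm_sub_le _ _).trans ?_)
          linarith [hK s hsT x]
    _ ≤ η / 2 + η / 2 := by
        refine add_le_add hs ?_
        rw [lintegral_const_mul' _ _ ENNReal.ofReal_ne_top, ← hνapp _ measurableSet_ball.compl]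
        exact hn
    _ = η := ENNReal.add_halves η

lemma lintegral_gaussWeight_comp_add (y c : Eucl d) (τ : ℝ) (f : Eucl d → ℝ≥0∞) :
    ∫⁻ x, ENNReal.ofReal (gaussWeight y τ x) * f (x + c)
      = ∫⁻ x, ENNReal.ofReal (gaussWeight (y + c) τ x) * f x := by
  rw [← lintegral_add_right_eq_self (μ := volume)
    (fun x => ENNReal.ofReal (gaussWeight (y + c) τ x) * f x) c]
  simp [gaussWeight]

lemma sq_norm_le_add {M : ℝ} {a b : ℂ} (ha : ‖a‖ ≤ M) (hb : ‖b‖ ≤ M) :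
    ‖a‖ ^ 2 ≤ ‖b‖ ^ 2 + 2 * M * ‖a - b‖ := by
  have h1 := norm_sub_norm_le a b
  have h2 : ‖a‖ ^ 2 - ‖b‖ ^ 2 = (‖a‖ - ‖b‖) * (‖a‖ + ‖b‖) := by ring
  have h3 : (‖a‖ - ‖b‖) * (‖a‖ + ‖b‖) ≤ ‖a - b‖ * (2 * M) :=
    mul_le_mul h1 (by linarith) (by positivity) (norm_nonneg _)
  linarith

lemma ofReal_integral_mul_gaussWeight {f : Eucl d → ℝ} (hf : Continuous f) (hf0 : ∀ x, 0 ≤ f x)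
    {M : ℝ} (hM : ∀ x, f x ≤ M) (y : Eucl d) {τ : ℝ} (hτ : 0 < τ) :
    ENNReal.ofReal (∫ x, f x * gaussWeight y τ x)
      = ∫⁻ x, ENNReal.ofReal (gaussWeight y τ x) * ENNReal.ofReal (f x) := by
  have hg := gaussWeight_pos y τ
  rw [ofReal_integral_eq_lintegral_ofReal]
  · refine lintegral_congr fun x => ?_
    rw [mul_comm, ENNReal.ofReal_mul (hg x).le]
  · refine ((integrable_gaussWeight y hτ).const_mul M).mono'
      (hf.mul (continuous_gaussWeight y τ)).aestronglyMeasurable (Eventually.of_forall fun x => ?_)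
    rw [Real.norm_of_nonneg (mul_nonneg (hf0 x) (hg x).le)]
    exact mul_le_mul_of_nonneg_right (hM x) (hg x).le
  · exact Eventually.of_forall fun x => mul_nonneg (hf0 x) (hg x).le

/-- The subsolution estimate runs from a time s > 0 to t, and then s → 0. Weighted L¹ convergence
suffices to pass to the limit in the squares, because all functions are bounded by K. -/
lemma IsPGLSolution.lintegral_gaussWeight_diff_sq_le (hd : 2 ≤ d) (hu : IsPGLSolution ε u₀ u)
    (hK : ∀ t ∈ Ioc 0 T, ∀ x, ‖u t x‖ ≤ K) (hK0 : ∀ᵐ x, ‖u₀ x‖ ≤ K)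
    (hm : AEStronglyMeasurable u₀ volume) (y c : Eucl d) {t : ℝ} (ht : 0 < t) (htT : t < T) :
    ∫⁻ x, ENNReal.ofReal (gaussWeight y (T - t) x) * ‖u t (x + c) - u t x‖ₑ ^ 2
      ≤ ENNReal.ofReal (Real.exp (2 * (1 / ε ^ 2 * (1 + 3 * K ^ 2)) * t))
        * ∫⁻ x, ENNReal.ofReal (gaussWeight y T x) * ‖u₀ (x + c) - u₀ x‖ₑ ^ 2 := by
  set L := 2 * (1 / ε ^ 2 * (1 + 3 * K ^ 2)) with hL
  have hT : 0 < T := ht.trans htT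
  have hK00 : 0 ≤ K := (norm_nonneg (u t 0)).trans (hK t ⟨ht, htT.le⟩ 0)
  set U : Eucl d × ℝ → ℂ := fun p => u p.2 p.1 with hUdef
  have hU : SolvesGL ε U := hu.solvesGL
  have hcont : ∀ s, 0 < s → Continuous (u s) := fun s hs => (hu.contDiff_slice hs).continuous
  set I : ℝ → ℝ≥0∞ := fun s => ∫⁻ x, ENNReal.ofReal (gaussWeight y T x)
    * ‖u s (x + c) - u s x‖ₑ ^ 2 with hI
  set I₀ := ∫⁻ x, ENNReal.ofReal (gaussWeight y T x) * ‖u₀ (x + c) - u₀ x‖ₑ ^ 2 with hI₀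
  have hPint : ∀ s, 0 < s → s < T →
      ENNReal.ofReal (∫ x, ‖U ((x, s) + (c, 0)) - U (x, s)‖ ^ 2 * gaussWeight y (T - s) x)
        = ∫⁻ x, ENNReal.ofReal (gaussWeight y (T - s) x) * ‖u s (x + c) - u s x‖ₑ ^ 2 := by
    intro s hs hsT
    have hc := hcont s hs
    rw [ofReal_integral_mul_gaussWeight (M := (2 * K) ^ 2) _ (fun x => by positivity) _ y
      (by linarith)]
    · refine lintegral_congr fun x => ?_
      rw [ENNReal.ofReal_pow (norm_nonneg _), ofReal_norm]
      simp [hUdef]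
    · simp only [hUdef, Prod.mk_add_mk, add_zero]
      fun_prop
    · intro x
      have h1 := hK s ⟨hs, hsT.le⟩
      refine pow_le_pow_left₀ (norm_nonneg _) ((norm_sub_le _ _).trans ?_) 2
      have := h1 (x + c)
      have := h1 x
      simp only [hUdef, Prod.mk_add_mk, add_zero]
      linarith
  have hstep : ∀ s, 0 < s → s ≤ t → ∫⁻ x, ENNReal.ofReal (gaussWeight y (T - t) x)
      * ‖u t (x + c) - u t x‖ₑ ^ 2 ≤ ENNReal.ofReal (Real.exp (L * t)) * I s := by
    intro s hs hst
    have hUs : ContDiffOn ℝ ∞ U (univ ×ˢ Ioo 0 T) :=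
      hU.smooth.mono (prod_mono subset_rfl fun t ht => ht.1)
    have hUc : ContDiffOn ℝ ∞ (fun p => U (p + (c, 0))) (univ ×ˢ Ioo 0 T) :=
      hUs.comp (contDiff_id.add contDiff_const).contDiffOn
        fun p hp => ⟨mem_univ _, by simpa using hp.2⟩
    have hbd : ∀ p : Eucl d × ℝ, p.2 ∈ Ioo 0 T → ‖U p‖ ≤ K := fun p hp =>
      hK p.2 ⟨hp.1, hp.2.le⟩ p.1
    have hbd' : ∀ p : Eucl d × ℝ, p.2 ∈ Ioo 0 T → ‖U (p + (c, 0))‖ ≤ K := fun p hp =>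
      hbd _ (by simpa using hp)
    have key := integral_subsolution_gaussWeight_le hd (P := fun p => ‖U (p + (c, 0)) - U p‖ ^ 2)
      (L := L) (M := (2 * K) ^ 2) (by positivity) ((hUc.sub hUs).norm_sq ℝ)
      (fun p => by positivity) y hs hst htT
      (fun p hp => hU.pd_tmDir_norm_sq_diff_le c hp.1 (hbd' p hp) (hbd p hp))
      (fun p hp => pow_le_pow_left₀ (norm_nonneg _)
        ((norm_sub_le _ _).trans (by linarith [hbd p hp, hbd' p hp])) 2)
    have key' := ENNReal.ofReal_le_ofReal key
    rw [ENNReal.ofReal_mul (Real.exp_pos _).le, hPint t ht htT, hPint s hs (hst.trans_lt htT)]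
      at key'
    refine key'.trans (mul_le_mul' (ENNReal.ofReal_le_ofReal (Real.exp_le_exp.2 ?_))
      (lintegral_mono fun x => ?_))
    · have : 0 ≤ L := by positivity
      nlinarith
    · gcongr
      exact gaussWeight_mono y (by linarith) (by linarith) x
  -- The 4K is the constant 2M of `sq_norm_le_add` with M = 2K, a bound for the differences; the
  -- Gaussian centred at y+c accounts for the translated copy.
  have hlim : Tendsto (fun s => ENNReal.ofReal (Real.exp (L * t)) * (I₀ + ENNReal.ofReal (4 * K)
      * ((∫⁻ x, ENNReal.ofReal (gaussWeight (y + c) T x) * ‖u s x - u₀ x‖ₑ)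
        + ∫⁻ x, ENNReal.ofReal (gaussWeight y T x) * ‖u s x - u₀ x‖ₑ))) (𝓝[>] 0)
      (𝓝 (ENNReal.ofReal (Real.exp (L * t)) * I₀)) := by
    have h := (hu.tendsto_lintegral_gaussWeight hT hK hK0 (y + c) hT).add
      (hu.tendsto_lintegral_gaussWeight hT hK hK0 y hT)
    have h2 := ENNReal.Tendsto.const_mul (a := ENNReal.ofReal (4 * K)) h
      (Or.inr ENNReal.ofReal_ne_top)
    have h3 := ENNReal.Tendsto.const_mul (a := ENNReal.ofReal (Real.exp (L * t)))
      (h2.const_add I₀) (Or.inr ENNReal.ofReal_ne_top)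
    simpa only [add_zero, mul_zero] using h3
  refine ge_of_tendsto hlim ?_
  filter_upwards [Ioc_mem_nhdsGT ht] with s hs
  refine (hstep s hs.1 hs.2).trans ?_
  gcongr
  have hsT : s ∈ Ioc 0 T := ⟨hs.1, hs.2.trans htT.le⟩
  have hmsub : AEMeasurable (fun x => ‖u s x - u₀ x‖ₑ) :=
    ((hcont s hs.1).aestronglyMeasurable.sub hm).enorm
  have hqmp : Measure.QuasiMeasurePreserving (fun x : Eucl d => x + c) volume volume :=
    quasiMeasurePreserving_add_right volume c
  have hK0c : ∀ᵐ x, ‖u₀ (x + c)‖ ≤ K := hqmp.ae hK0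
  have hg := measurable_ofReal_gaussWeight y T
  have hm2 : AEMeasurable fun x => ENNReal.ofReal (gaussWeight y T x) * ‖u s x - u₀ x‖ₑ :=
    hg.aemeasurable.mul hmsub
  rw [← lintegral_gaussWeight_comp_add y c T (fun x => ‖u s x - u₀ x‖ₑ),
    ← lintegral_add_right' _ hm2,
    ← lintegral_const_mul' _ _ ENNReal.ofReal_ne_top, hI₀, ← lintegral_add_right']
  · refine lintegral_mono_ae ?_
    filter_upwards [hK0, hK0c] with x hx hxc
    rw [← mul_add, mul_left_comm, ← mul_add]
    gcongr
    rw [← ofReal_norm, ← ofReal_norm, ← ofReal_norm, ← ofReal_norm,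
      ← ENNReal.ofReal_add (norm_nonneg _) (norm_nonneg _),
      ← ENNReal.ofReal_mul (by positivity), ← ENNReal.ofReal_pow (norm_nonneg _),
      ← ENNReal.ofReal_pow (norm_nonneg _), ← ENNReal.ofReal_add (by positivity) (by positivity)]
    refine ENNReal.ofReal_le_ofReal ?_
    have h1 := sq_norm_le_add (M := 2 * K) (a := u s (x + c) - u s x) (b := u₀ (x + c) - u₀ x)
      ((norm_sub_le _ _).trans (by linarith [hK s hsT x, hK s hsT (x + c)]))
      ((norm_sub_le _ _).trans (by linarith))
    have h2 : ‖u s (x + c) - u s x - (u₀ (x + c) - u₀ x)‖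
        ≤ ‖u s (x + c) - u₀ (x + c)‖ + ‖u s x - u₀ x‖ := by
      rw [show u s (x + c) - u s x - (u₀ (x + c) - u₀ x)
        = (u s (x + c) - u₀ (x + c)) - (u s x - u₀ x) by ring]
      exact norm_sub_le _ _
    nlinarith [norm_nonneg (u s (x + c) - u s x - (u₀ (x + c) - u₀ x))]
  · have hm3 : AEMeasurable fun x => ENNReal.ofReal (gaussWeight y T x)
        * ‖u s (x + c) - u₀ (x + c)‖ₑ :=
      hg.aemeasurable.mul (hmsub.comp_quasiMeasurePreserving hqmp)
    exact (hm3.add hm2).const_mul _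

/-- The bounds for differences of u(t) and of u₀ are chained, divided by h² and passed to h → 0 by
Fatou. The exponential depends badly on ε and K, but tends to 1 as t → 0. -/
lemma IsPGLSolution.lintegral_gaussWeight_pd_sq_le (hd : 2 ≤ d) (hu : IsPGLSolution ε u₀ u)
    {g : Fin d → Eucl d → ℂ} (hg : IsWeakGradient u₀ g)
    (hK : ∀ t ∈ Ioc 0 T, ∀ x, ‖u t x‖ ≤ K) (hK0 : ∀ᵐ x, ‖u₀ x‖ ≤ K) (hT : 1 ≤ T)
    (y : Eucl d) {t : ℝ} (ht : 0 < t) (htT : t < T) (i : Fin d) :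
    ∫⁻ x, ENNReal.ofReal (gaussWeight y (T - t) x)
        * ‖pd (spDir i) (fun p : Eucl d × ℝ => u p.2 p.1) (x, t)‖ₑ ^ 2
      ≤ ENNReal.ofReal (Real.exp (2 * (1 / ε ^ 2 * (1 + 3 * K ^ 2)) * t))
        * (ENNReal.ofReal (Real.exp 2)
          * ∫⁻ x, ENNReal.ofReal (gaussWeight y (4 * T) x) * ‖g i x‖ₑ ^ 2) := by
  set e : Eucl d := EuclideanSpace.single i 1 with he
  set L := 2 * (1 / ε ^ 2 * (1 + 3 * K ^ 2)) with hL
  set h : ℕ → ℝ := fun n => 1 / ((n : ℝ) + 1) with hh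
  have hpos : ∀ n, 0 < h n := fun n => by positivity
  have hle1 : ∀ n, h n ≤ 1 := fun n => by
    rw [hh, div_le_one (by positivity)]
    linarith [(n.cast_nonneg : (0 : ℝ) ≤ n)]
  have hm := hg.1.aestronglyMeasurable
  have hc : Continuous (u t) := (hu.contDiff_slice ht).continuous
  have hbound : ∀ n, ∫⁻ x, ENNReal.ofReal (gaussWeight y (T - t) x)
        * ‖(h n)⁻¹ • (u t (x + h n • e) - u t x)‖ₑ ^ 2
      ≤ ENNReal.ofReal (Real.exp (L * t)) * (ENNReal.ofReal (Real.exp 2)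
          * ∫⁻ x, ENNReal.ofReal (gaussWeight y (4 * T) x) * ‖g i x‖ₑ ^ 2) := by
    intro n
    have h1 := hu.lintegral_gaussWeight_diff_sq_le hd hK hK0 hm y (h n • e) ht htT
    have h2 := lintegral_gaussWeight_enorm_sub_sq_le hg i (hpos n) (hle1 n) y hT
    calc _ = ENNReal.ofReal (h n)⁻¹ ^ 2 * ∫⁻ x, ENNReal.ofReal (gaussWeight y (T - t) x)
        * ‖u t (x + h n • e) - u t x‖ₑ ^ 2 := by
          rw [← lintegral_const_mul' _ _ (by finiteness)]
          refine lintegral_congr fun x => ?_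
          rw [enorm_smul, Real.enorm_of_nonneg (inv_nonneg.2 (hpos n).le)]
          ring
      _ ≤ ENNReal.ofReal (h n)⁻¹ ^ 2 * (ENNReal.ofReal (Real.exp (L * t))
          * (ENNReal.ofReal (Real.exp 2) * ENNReal.ofReal (h n) ^ 2
          * ∫⁻ x, ENNReal.ofReal (gaussWeight y (4 * T) x) * ‖g i x‖ₑ ^ 2)) := by
          gcongr
          exact h1.trans (by gcongr)
      _ = (ENNReal.ofReal (h n)⁻¹ * ENNReal.ofReal (h n)) ^ 2 * (ENNReal.ofReal (Real.exp (L * t))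
          * (ENNReal.ofReal (Real.exp 2)
          * ∫⁻ x, ENNReal.ofReal (gaussWeight y (4 * T) x) * ‖g i x‖ₑ ^ 2)) := by ring
      _ = _ := by
          rw [← ENNReal.ofReal_mul (inv_nonneg.2 (hpos n).le), inv_mul_cancel₀ (hpos n).ne']
          simp
  calc _ = ∫⁻ x, liminf (fun n => ENNReal.ofReal (gaussWeight y (T - t) x)
        * ‖(h n)⁻¹ • (u t (x + h n • e) - u t x)‖ₑ ^ 2) atTop := by
        refine lintegral_congr fun x => ?_
        refine (Tendsto.liminf_eq (ENNReal.Tendsto.const_mul ?_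
          (Or.inr ENNReal.ofReal_ne_top))).symm
        refine ((ENNReal.continuous_pow 2).tendsto _).comp ((continuous_enorm.tendsto _).comp ?_)
        rw [spDir, pd_spDir_eq (differentiableAt_of_slab isOpen_Ioi hu.smooth (p := (x, t)) ht)]
        have hdiff := ((hu.contDiff_slice ht).differentiable (by simp) x).hasFDerivAt
        have := hdiff.hasLineDerivAt e
        have h3 := (hasDerivAt_iff_tendsto_slope_zero.1 this)
        simp only [zero_add, zero_smul, add_zero] at h3
        refine h3.comp (tendsto_nhdsWithin_iff.2 ⟨tendsto_one_div_add_atTop_nhds_zero_nat, ?_⟩)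
        exact Eventually.of_forall fun n => (hpos n).ne'
    _ ≤ liminf (fun n => ∫⁻ x, ENNReal.ofReal (gaussWeight y (T - t) x)
        * ‖(h n)⁻¹ • (u t (x + h n • e) - u t x)‖ₑ ^ 2) atTop := by
        refine lintegral_liminf_le fun n => (measurable_ofReal_gaussWeight _ _).mul
          (Measurable.pow_const ?_ 2)
        exact Continuous.measurable (by fun_prop) |>.enorm
    _ ≤ _ := liminf_le_of_le (by isBoundedDefault) fun b hb => by
        obtain ⟨n, hn⟩ := hb.exists
        exact hn.trans (hbound n)

end InitialLayer

end

/-! ### From unit balls to general weights; the weak gradient and the potential -/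

noncomputable section

section Averaging

variable {d : ℕ}

/-- Tonelli on {|x-z| < 1}: integrating in z first produces the volume of the unit ball, while
integrating in x first produces the unit-ball integrals of f. No covering argument is needed. -/
lemma volume_ball_mul_lintegral_le {f ρ ρ' : Eucl d → ℝ≥0∞} (hf : AEMeasurable f)
    (hρ' : Measurable ρ') (hle : ∀ x z, dist x z < 1 → ρ x ≤ ρ' z) {A : ℝ≥0∞}
    (hA : ∀ z, ∫⁻ x in Metric.ball z 1, f x ≤ A) :
    volume (Metric.ball (0 : Eucl d) 1) * ∫⁻ x, ρ x * f x ≤ A * ∫⁻ z, ρ' z := by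
  set S : Set (Eucl d × Eucl d) := {p | dist p.1 p.2 < 1} with hS
  have hSm : MeasurableSet S := (isOpen_lt continuous_dist continuous_const).measurableSet
  have h1m : Measurable (S.indicator (fun _ => (1 : ℝ≥0∞))) := measurable_one.indicator hSm
  have hfm : AEMeasurable (fun p : Eucl d × Eucl d => f p.1) (volume.prod volume) :=
    hf.comp_quasiMeasurePreserving Measure.quasiMeasurePreserving_fst
  calc volume (Metric.ball (0 : Eucl d) 1) * ∫⁻ x, ρ x * f x
      = ∫⁻ x, volume (Metric.ball (0 : Eucl d) 1) * (ρ x * f x) :=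
        (lintegral_const_mul' _ _ measure_ball_lt_top.ne).symm
    _ = ∫⁻ x, ∫⁻ z, S.indicator (fun _ => 1) (x, z) * (ρ x * f x) := by
        refine lintegral_congr fun x => ?_
        have hm : Measurable fun z => S.indicator (fun _ => (1 : ℝ≥0∞)) (x, z) :=
          h1m.comp measurable_prodMk_left
        rw [lintegral_mul_const _ hm]
        congr 1
        have : (fun z => S.indicator (fun _ => (1 : ℝ≥0∞)) (x, z))
            = (Metric.ball x 1).indicator fun _ => 1 := by
          ext z
          simp [S, indicator, dist_comm]
        rw [this, lintegral_indicator measurableSet_ball, setLIntegral_const, one_mul,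
          Measure.addHaar_ball_center volume x]
    _ ≤ ∫⁻ x, ∫⁻ z, S.indicator (fun _ => 1) (x, z) * (ρ' z * f x) := by
        refine lintegral_mono fun x => lintegral_mono fun z => ?_
        by_cases h : (x, z) ∈ S
        · simp only [indicator_of_mem h, one_mul]
          exact mul_le_mul_left (hle x z h) _
        · simp [indicator_of_notMem h]
    _ = ∫⁻ z, ∫⁻ x, S.indicator (fun _ => 1) (x, z) * (ρ' z * f x) := by
        refine lintegral_lintegral_swap ?_
        exact h1m.aemeasurable.mul ((hρ'.comp measurable_snd).aemeasurable.mul hfm)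
    _ ≤ ∫⁻ z, A * ρ' z := by
        refine lintegral_mono fun z => ?_
        have : ∀ x, S.indicator (fun _ => (1 : ℝ≥0∞)) (x, z) * (ρ' z * f x)
            = ρ' z * (Metric.ball z 1).indicator f x := by
          intro x
          simp only [S, indicator, mem_ofPred_eq, Metric.mem_ball]
          split_ifs <;> simp
        simp_rw [this]
        rw [lintegral_const_mul'' _ (hf.indicator measurableSet_ball),
          lintegral_indicator measurableSet_ball, mul_comm A]
        exact mul_le_mul_right (hA z) _
    _ = A * ∫⁻ z, ρ' z := lintegral_const_mul _ hρ'

lemma volume_ball_mul_lintegral_gaussWeight_le {f : Eucl d → ℝ≥0∞} (hf : AEMeasurable f)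
    {A : ℝ≥0∞} (hA : ∀ z, ∫⁻ x in Metric.ball z 1, f x ≤ A) (y : Eucl d) {τ : ℝ} (hτ : 1 ≤ τ) :
    volume (Metric.ball (0 : Eucl d) 1) * ∫⁻ x, ENNReal.ofReal (gaussWeight y τ x) * f x
      ≤ A * ENNReal.ofReal (Real.exp 1 * (Real.pi * (8 * τ)) ^ (d / 2 : ℝ)) := by
  refine (volume_ball_mul_lintegral_le hf
    (((continuous_gaussWeight y (2 * τ)).const_mul (Real.exp 1)).measurable.ennreal_ofReal)
    (fun x z hxz => ENNReal.ofReal_le_ofReal ?_) hA).trans (le_of_eq ?_)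
  · have := gaussWeight_add_le y hτ (a := x - z) (by rw [← dist_eq_norm]; exact hxz.le) z
    rwa [add_sub_cancel] at this
  · rw [← ofReal_integral_eq_lintegral_ofReal
      ((integrable_gaussWeight y (by linarith)).const_mul _)
      (Eventually.of_forall fun x => mul_nonneg (Real.exp_pos _).le (gaussWeight_pos _ _ _).le),
      integral_const_mul, integral_gaussWeight y (by linarith)]
    ring_nf

/-- The weights are the indicators of B(y,R) and B(y,R+1); the factor (1+R)^d is the volume ratio of
B(y,R+1) to the unit ball. -/
lemma setLIntegral_ball_le {f : Eucl d → ℝ≥0∞} (hf : AEMeasurable f)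
    {A : ℝ≥0∞} (hA : ∀ z, ∫⁻ x in Metric.ball z 1, f x ≤ A) (y : Eucl d) {R : ℝ} (hR : 0 < R) :
    ∫⁻ x in Metric.ball y R, f x ≤ ENNReal.ofReal ((1 + R) ^ d) * A := by
  have hind : ∀ R, Measurable ((Metric.ball y R).indicator fun _ => (1 : ℝ≥0∞)) := fun R =>
    measurable_one.indicator measurableSet_ball
  have h := volume_ball_mul_lintegral_le (ρ := (Metric.ball y R).indicator fun _ => (1 : ℝ≥0∞))
    hf (hind (R + 1)) (fun x z hxz => ?_) hA
  · have e1 : ∫⁻ x, (Metric.ball y R).indicator (fun _ => (1 : ℝ≥0∞)) x * f x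
        = ∫⁻ x in Metric.ball y R, f x := by
      rw [← lintegral_indicator measurableSet_ball]
      refine lintegral_congr fun x => ?_
      by_cases hx : x ∈ Metric.ball y R <;> simp [hx]
    rw [e1, lintegral_indicator measurableSet_ball, setLIntegral_const, one_mul,
      Measure.addHaar_ball_of_pos volume y (by linarith : 0 < R + 1), finrank_euclideanSpace_fin, mul_comm, ← mul_assoc,
      mul_comm A] at h
    rw [add_comm 1 R]
    exact (ENNReal.mul_le_mul_iff_left (Metric.measure_ball_pos _ _ one_pos).ne'
      measure_ball_lt_top.ne).1 h
  · by_cases hx : x ∈ Metric.ball y R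
    · have hz : z ∈ Metric.ball y (R + 1) := by
        rw [Metric.mem_ball] at hx ⊢
        linarith [dist_triangle_left z y x]
      simp [hx, hz]
    · simp [hx]

end Averaging

section WeakGradient

variable {d : ℕ}

lemma isWeakGradient_classicalPartial {w : Eucl d → ℂ} (hw : ContDiff ℝ 1 w) :
    IsWeakGradient w (classicalPartial w) := by
  have hc : ∀ i, Continuous (classicalPartial w i) := fun i =>
    (hw.continuous_fderiv (by simp)).clm_apply continuous_const
  refine ⟨hw.continuous.locallyIntegrable, fun i => ⟨(hc i).locallyIntegrable, fun φ hφ hφc => ?_⟩⟩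
  have hφ1 : ContDiff ℝ 1 φ := hφ.of_le (by simp)
  have hcφ : Continuous (classicalPartial φ i) :=
    (hφ1.continuous_fderiv (by simp)).clm_apply continuous_const
  have hcs : HasCompactSupport (classicalPartial φ i) := hφc.fderiv_apply ℝ _
  rw [eq_comm, neg_eq_iff_eq_neg]
  exact integral_smul_fderiv_eq_neg_fderiv_smul_of_integrable
    ((hcφ.smul hw.continuous).integrable_of_hasCompactSupport hcs.smul_right)
    ((hφ.continuous.smul (hc i)).integrable_of_hasCompactSupport hφc.smul_right)
    ((hφ.continuous.smul hw.continuous).integrable_of_hasCompactSupport hφc.smul_right)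
    (fun x _ => hφ1.differentiable (by simp) x) (fun x _ => hw.differentiable (by simp) x)

lemma isWeakGradient_weakGrad {w : Eucl d → ℂ} (hw : ∃ g, IsWeakGradient w g) :
    IsWeakGradient w (weakGrad w) := by
  unfold weakGrad
  by_cases h : ContDiff ℝ 1 w
  · rw [if_pos h]
    exact isWeakGradient_classicalPartial h
  · rw [if_neg h, dif_pos hw]
    exact hw.choose_spec

/-- The potential part of the energy density. -/
def potentialDensity (ε : ℝ) (z : ℂ) : ℝ := (1 - ‖z‖ ^ 2) ^ 2 / (4 * ε ^ 2)

lemma potentialDensity_nonneg (ε : ℝ) (z : ℂ) : 0 ≤ potentialDensity ε z := by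
  unfold potentialDensity
  positivity

lemma continuous_potentialDensity (ε : ℝ) : Continuous (potentialDensity ε) := by
  unfold potentialDensity
  fun_prop

lemma potentialDensity_le {ε K : ℝ} {a : ℂ} (ha : ‖a‖ ≤ K) :
    potentialDensity ε a ≤ (1 + K ^ 2) ^ 2 / (4 * ε ^ 2) := by
  unfold potentialDensity
  have h1 : ‖a‖ ^ 2 ≤ K ^ 2 := pow_le_pow_left₀ (norm_nonneg _) ha 2
  have h2 : (1 - ‖a‖ ^ 2) ^ 2 ≤ (1 + K ^ 2) ^ 2 := by
    rw [sq_le_sq, abs_of_nonneg (by positivity : 0 ≤ 1 + K ^ 2), abs_le]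
    constructor <;> nlinarith [sq_nonneg ‖a‖]
  gcongr

lemma potentialDensity_le_add {ε K : ℝ} {a b : ℂ} (ha : ‖a‖ ≤ K) (hb : ‖b‖ ≤ K) :
    potentialDensity ε a
      ≤ potentialDensity ε b + (4 * K * (1 + K ^ 2)) / (4 * ε ^ 2) * ‖a - b‖ := by
  unfold potentialDensity
  have hK : 0 ≤ K := (norm_nonneg a).trans ha
  rw [div_mul_eq_mul_div, ← add_div]
  refine div_le_div_of_nonneg_right ?_ (by positivity)
  have h1 : |‖a‖ - ‖b‖| ≤ ‖a - b‖ := abs_norm_sub_norm_le a b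
  have h2 : (1 - ‖a‖ ^ 2) ^ 2 - (1 - ‖b‖ ^ 2) ^ 2
      = (‖a‖ - ‖b‖) * ((‖a‖ + ‖b‖) * (‖a‖ ^ 2 + ‖b‖ ^ 2 - 2)) := by ring
  have h3 : |(‖a‖ + ‖b‖) * (‖a‖ ^ 2 + ‖b‖ ^ 2 - 2)| ≤ 2 * K * (2 * (1 + K ^ 2)) := by
    rw [abs_mul, abs_of_nonneg (by positivity : 0 ≤ ‖a‖ + ‖b‖)]
    have ha2 : ‖a‖ ^ 2 ≤ K ^ 2 := pow_le_pow_left₀ (norm_nonneg _) ha 2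
    have hb2 : ‖b‖ ^ 2 ≤ K ^ 2 := pow_le_pow_left₀ (norm_nonneg _) hb 2
    refine mul_le_mul (by linarith) ?_ (abs_nonneg _) (by positivity)
    rw [abs_le]
    constructor <;> nlinarith [sq_nonneg ‖a‖, sq_nonneg ‖b‖]
  have h4 := mul_le_mul h1 h3 (abs_nonneg _) (norm_nonneg _)
  rw [← abs_mul, ← h2] at h4
  linarith [le_abs_self ((1 - ‖a‖ ^ 2) ^ 2 - (1 - ‖b‖ ^ 2) ^ 2)]

lemma ofReal_half_sum_add {ι : Type*} (s : Finset ι) (z : ι → ℂ) {c : ℝ} (hc : 0 ≤ c) :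
    ENNReal.ofReal ((∑ i ∈ s, ‖z i‖ ^ 2) / 2 + c)
      = ENNReal.ofReal (1 / 2) * ∑ i ∈ s, ‖z i‖ₑ ^ 2 + ENNReal.ofReal c := by
  rw [ENNReal.ofReal_add (by positivity) hc, div_eq_mul_one_div, mul_comm,
    ENNReal.ofReal_mul (by norm_num), ENNReal.ofReal_sum_of_nonneg fun i _ => by positivity]
  congr 2
  refine Finset.sum_congr rfl fun i _ => ?_
  rw [ENNReal.ofReal_pow (norm_nonneg _), ofReal_norm]

lemma ofReal_energyDensity (ε : ℝ) (w : Eucl d → ℂ) (x : Eucl d) :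
    ENNReal.ofReal (energyDensity ε w x) = ENNReal.ofReal (1 / 2) * ∑ i, ‖weakGrad w i x‖ₑ ^ 2
      + ENNReal.ofReal (potentialDensity ε (w x)) :=
  ofReal_half_sum_add _ _ (potentialDensity_nonneg ε _)

lemma ofReal_glEnergy (ε : ℝ) (U : Eucl d × ℝ → ℂ) (p : Eucl d × ℝ) :
    ENNReal.ofReal (glEnergy ε U p) = ENNReal.ofReal (1 / 2) * ∑ i, ‖pd (spDir i) U p‖ₑ ^ 2
      + ENNReal.ofReal (potentialDensity ε (U p)) :=
  ofReal_half_sum_add _ _ (potentialDensity_nonneg ε _)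

lemma aemeasurable_energyDensity {ε : ℝ} {w : Eucl d → ℂ} (hw : ∃ g, IsWeakGradient w g) :
    AEMeasurable (energyDensity ε w) := by
  have h := isWeakGradient_weakGrad hw
  unfold energyDensity
  refine AEMeasurable.add (AEMeasurable.div_const ?_ _) (AEMeasurable.div_const ?_ _)
  · exact Finset.aemeasurable_fun_sum _ fun i _ =>
      (h.2 i).1.aestronglyMeasurable.norm.aemeasurable.pow_const 2
  · exact (aemeasurable_const.sub (h.1.aestronglyMeasurable.norm.aemeasurable.pow_const 2)).pow_const 2

end WeakGradient

end

/-! ### The energy in unit balls at time t -/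

noncomputable section

section EnergyBound

variable {d : ℕ} {ε K T : ℝ} {u₀ : Eucl d → ℂ} {u : ℝ → Eucl d → ℂ}

/-- Its constant depends on ε and K, so it is never the final estimate: it supplies finiteness of
weighted energies at positive times and, for t → 0, the comparison with the datum. -/
lemma IsPGLSolution.lintegral_gaussWeight_energy_le (hd : 2 ≤ d) (hu : IsPGLSolution ε u₀ u)
    (hw : ∃ g, IsWeakGradient u₀ g)
    (hK : ∀ t ∈ Ioc 0 T, ∀ x, ‖u t x‖ ≤ K) (hK0 : ∀ᵐ x, ‖u₀ x‖ ≤ K) (hT : 1 ≤ T)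
    (y : Eucl d) {t : ℝ} (ht : 0 < t) (htT : t < T) :
    ∫⁻ x, ENNReal.ofReal (gaussWeight y (T - t) x) * ENNReal.ofReal (energyDensity ε (u t) x)
      ≤ ENNReal.ofReal (Real.exp (2 * (1 / ε ^ 2 * (1 + 3 * K ^ 2)) * t))
        * (ENNReal.ofReal (Real.exp 2) * ∫⁻ x, ENNReal.ofReal (gaussWeight y (4 * T) x)
            * (ENNReal.ofReal (1 / 2) * ∑ i, ‖weakGrad u₀ i x‖ₑ ^ 2))
        + ∫⁻ x, ENNReal.ofReal (gaussWeight y T x)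
            * ENNReal.ofReal (potentialDensity ε (u t x)) := by
  have hg := isWeakGradient_weakGrad hw
  have hmg := measurable_ofReal_gaussWeight (d := d)
  have hpdc : ∀ i, Measurable fun x =>
      ‖pd (spDir i) (fun p : Eucl d × ℝ => u p.2 p.1) (x, t)‖ₑ ^ 2 := fun i =>
    (_root_.contDiff_slice (hu.smooth.pd isOpen_Ioi (spDir i)) ht).continuous.measurable.enorm.pow_const 2
  have h1 : ∀ x, ENNReal.ofReal (gaussWeight y (T - t) x) * ENNReal.ofReal (energyDensity ε (u t) x)
      = (ENNReal.ofReal (1 / 2) * ∑ i, ENNReal.ofReal (gaussWeight y (T - t) x)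
          * ‖pd (spDir i) (fun p : Eucl d × ℝ => u p.2 p.1) (x, t)‖ₑ ^ 2)
        + ENNReal.ofReal (gaussWeight y (T - t) x)
          * ENNReal.ofReal (potentialDensity ε (u t x)) := by
    intro x
    rw [hu.energyDensity_eq ht, ofReal_glEnergy, mul_add, mul_left_comm, Finset.mul_sum]
  simp_rw [h1]
  have hpm : Measurable fun x => ENNReal.ofReal (gaussWeight y (T - t) x)
      * ENNReal.ofReal (potentialDensity ε (u t x)) :=
    (hmg y _).mul ((continuous_potentialDensity ε).comp
      (hu.contDiff_slice ht).continuous).measurable.ennreal_ofReal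
  rw [lintegral_add_right _ hpm, lintegral_const_mul' _ _ ENNReal.ofReal_ne_top,
    lintegral_finsetSum Finset.univ (f := fun i x => ENNReal.ofReal (gaussWeight y (T - t) x)
      * ‖pd (spDir i) (fun p : Eucl d × ℝ => u p.2 p.1) (x, t)‖ₑ ^ 2)
      fun i _ => (hmg y _).mul (hpdc i)]
  refine add_le_add ?_ (lintegral_mono fun x => ?_)
  · have h2 : ∫⁻ x, ENNReal.ofReal (gaussWeight y (4 * T) x)
            * (ENNReal.ofReal (1 / 2) * ∑ i, ‖weakGrad u₀ i x‖ₑ ^ 2)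
        = ENNReal.ofReal (1 / 2) * ∑ i, ∫⁻ x, ENNReal.ofReal (gaussWeight y (4 * T) x)
          * ‖weakGrad u₀ i x‖ₑ ^ 2 := by
      rw [← lintegral_finsetSum' Finset.univ (f := fun i x => ENNReal.ofReal
        (gaussWeight y (4 * T) x) * ‖weakGrad u₀ i x‖ₑ ^ 2) fun i _ => (hmg y _).aemeasurable.mul
        ((hg.2 i).1.aestronglyMeasurable.enorm.pow_const 2),
        ← lintegral_const_mul' _ _ ENNReal.ofReal_ne_top]
      refine lintegral_congr fun x => ?_
      rw [mul_left_comm, Finset.mul_sum]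
    rw [h2]
    calc _ ≤ ENNReal.ofReal (1 / 2) * ∑ i,
          (ENNReal.ofReal (Real.exp (2 * (1 / ε ^ 2 * (1 + 3 * K ^ 2)) * t))
          * (ENNReal.ofReal (Real.exp 2) * ∫⁻ x, ENNReal.ofReal (gaussWeight y (4 * T) x)
            * ‖weakGrad u₀ i x‖ₑ ^ 2)) := by
          gcongr with i _
          exact hu.lintegral_gaussWeight_pd_sq_le hd hg hK hK0 hT y ht htT i
      _ = _ := by
          rw [← Finset.mul_sum, ← Finset.mul_sum]
          ring
  · gcongr
    exact gaussWeight_mono y (by linarith) (by linarith) x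

lemma lintegral_gaussWeight_potential_le
    (hK : ∀ t ∈ Ioc 0 T, ∀ x, ‖u t x‖ ≤ K) (hK0 : ∀ᵐ x, ‖u₀ x‖ ≤ K)
    (hm : AEStronglyMeasurable u₀ volume) (y : Eucl d) (τ : ℝ) {t : ℝ} (ht : t ∈ Ioc 0 T) :
    ∫⁻ x, ENNReal.ofReal (gaussWeight y τ x) * ENNReal.ofReal (potentialDensity ε (u t x))
      ≤ (∫⁻ x, ENNReal.ofReal (gaussWeight y τ x) * ENNReal.ofReal (potentialDensity ε (u₀ x)))
        + ENNReal.ofReal ((4 * K * (1 + K ^ 2)) / (4 * ε ^ 2))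
          * ∫⁻ x, ENNReal.ofReal (gaussWeight y τ x) * ‖u t x - u₀ x‖ₑ := by
  have hK00 : 0 ≤ K := (norm_nonneg (u t 0)).trans (hK t ht 0)
  have hmw : AEMeasurable fun x => ENNReal.ofReal (gaussWeight y τ x)
      * ENNReal.ofReal (potentialDensity ε (u₀ x)) :=
    (measurable_ofReal_gaussWeight y τ).aemeasurable.mul
      (((continuous_potentialDensity ε).comp_aestronglyMeasurable hm).aemeasurable.ennreal_ofReal)
  rw [← lintegral_const_mul' _ _ ENNReal.ofReal_ne_top, ← lintegral_add_left' hmw]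
  refine lintegral_mono_ae ?_
  filter_upwards [hK0] with x hx
  rw [mul_left_comm, ← mul_add, ← ofReal_norm, ← ENNReal.ofReal_mul
    (p := (4 * K * (1 + K ^ 2)) / (4 * ε ^ 2)) (q := ‖u t x - u₀ x‖) (by positivity),
    ← ENNReal.ofReal_add (potentialDensity_nonneg _ _) (by positivity)]
  gcongr
  exact potentialDensity_le_add (hK t ht x) hx

lemma IsPGLSolution.continuous_energyDensity (hu : IsPGLSolution ε u₀ u) {t : ℝ} (ht : 0 < t) :
    Continuous (energyDensity ε (u t)) := by
  have h := (_root_.contDiff_slice (glEnergy_contDiffOn isOpen_Ioi (ε := ε) hu.smooth) ht).continuous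
  exact h.congr fun x => (hu.energyDensity_eq ht x).symm

lemma energyDensity_nonneg (ε : ℝ) (w : Eucl d → ℂ) (x : Eucl d) : 0 ≤ energyDensity ε w x := by
  unfold energyDensity
  positivity

/-- The unit-ball energy bound at time `t`, with the constants produced by the proof. -/
lemma IsPGLSolution.volume_ball_mul_ballEnergy_le (hd : 2 ≤ d) (hu : IsPGLSolution ε u₀ u)
    {M₀ : ℝ} (h0 : LocalEnergyBoundAt M₀ ε u₀) (y : Eucl d) {t : ℝ} (ht : 0 < t) :
    volume (Metric.ball (0 : Eucl d) 1) * ballEnergy ε (u t) y 1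
      ≤ ENNReal.ofReal (M₀ * |Real.log ε|) * ENNReal.ofReal (Real.exp 4
        * (Real.pi * 32) ^ (d / 2 : ℝ) * (1 + t)) := by
  -- With this T the Gaussian at time t has parameter T - t = 1, comparable to 1 on the unit ball.
  set T := 1 + t with hTdef
  have hT1 : 1 ≤ T := by linarith
  have htT : t < T := by linarith
  have hTt : T - t = 1 := by linarith
  set A := ENNReal.ofReal (M₀ * |Real.log ε|) with hA
  have hw := h0.weakly_differentiable
  have hm : AEStronglyMeasurable u₀ volume := h0.memLp_top.aestronglyMeasurable
  have hmE : AEMeasurable fun x => ENNReal.ofReal (energyDensity ε u₀ x) :=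
    (aemeasurable_energyDensity hw).ennreal_ofReal
  have hmg := measurable_ofReal_gaussWeight (d := d)
  -- The horizon is doubled because the cutoff errors involve the parameter 2(T-r), which is
  -- dominated by the 2T-r of the a priori estimate with horizon 2T.
  obtain ⟨K, hK, hK0⟩ : ∃ K, (∀ s ∈ Ioc 0 (2 * T), ∀ x, ‖u s x‖ ≤ K) ∧ ∀ᵐ x, ‖u₀ x‖ ≤ K := by
    obtain ⟨K1, hK1⟩ := hu.bounded (2 * T) (by linarith)
    obtain ⟨K2, hK2⟩ : ∃ K2, ∀ᵐ x, ‖u₀ x‖ ≤ K2 := by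
      refine ⟨(eLpNorm u₀ ∞ volume).toReal, ?_⟩
      have hfin := h0.memLp_top.eLpNorm_lt_top
      rw [eLpNorm_exponent_top] at hfin ⊢
      filter_upwards [ae_le_eLpNormEssSup (f := u₀) (μ := volume)] with x hx
      rw [← toReal_enorm]
      exact ENNReal.toReal_mono hfin.ne hx
    exact ⟨max K1 K2, fun s hs x => (hK1 s hs x).trans (le_max_left _ _),
      hK2.mono fun x hx => hx.trans (le_max_right _ _)⟩
  have hKT : ∀ s ∈ Ioc 0 T, ∀ x, ‖u s x‖ ≤ K := fun s hs => hK s ⟨hs.1, by linarith [hs.2]⟩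
  have hfin0 : ∀ τ, 1 ≤ τ → ∫⁻ x, ENNReal.ofReal (gaussWeight y τ x)
      * ENNReal.ofReal (energyDensity ε u₀ x) < ⊤ := by
    intro τ hτ
    have h1 := volume_ball_mul_lintegral_gaussWeight_le hmE (fun z => h0.energy_le z) y hτ
    have h2 : volume (Metric.ball (0 : Eucl d) 1) * ∫⁻ x, ENNReal.ofReal (gaussWeight y τ x)
      * ENNReal.ofReal (energyDensity ε u₀ x) < ⊤ := h1.trans_lt (by finiteness)
    exact ENNReal.lt_top_of_mul_ne_top_right h2.ne (Metric.measure_ball_pos _ _ one_pos).ne'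
  have hgrad_le : ∀ τ, ∫⁻ x, ENNReal.ofReal (gaussWeight y τ x)
        * (ENNReal.ofReal (1 / 2) * ∑ i, ‖weakGrad u₀ i x‖ₑ ^ 2)
      ≤ ∫⁻ x, ENNReal.ofReal (gaussWeight y τ x) * ENNReal.ofReal (energyDensity ε u₀ x) := by
    intro τ
    refine lintegral_mono fun x => ?_
    rw [ofReal_energyDensity]
    gcongr
    exact le_self_add
  set L := 2 * (1 / ε ^ 2 * (1 + 3 * K ^ 2)) with hL
  have hL0 : 0 ≤ L := by positivity
  set κ := ((d : ℝ) - 2) / 2 with hκ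
  -- Only the finiteness of J is used; its size disappears when the cutoff is removed in the
  -- monotonicity formula.
  set J : ℝ≥0∞ := ENNReal.ofReal (Real.exp (L * t)) * (ENNReal.ofReal (Real.exp 2)
      * ∫⁻ x, ENNReal.ofReal (gaussWeight y (4 * (2 * T)) x)
        * ENNReal.ofReal (energyDensity ε u₀ x))
    + ∫⁻ x, ENNReal.ofReal (gaussWeight y (2 * T) x)
        * ENNReal.ofReal ((1 + K ^ 2) ^ 2 / (4 * ε ^ 2)) with hJ
  have hJfin : J ≠ ⊤ := by
    refine ENNReal.add_ne_top.2 ⟨?_, ?_⟩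
    · have := (hfin0 (4 * (2 * T)) (by linarith)).ne
      finiteness
    · rw [lintegral_mul_const' _ _ ENNReal.ofReal_ne_top]
      have := (lintegral_gaussWeight_lt_top y (by linarith : 0 < 2 * T)).ne
      finiteness
  set E : ℝ → ℝ≥0∞ := fun s => ∫⁻ x, ENNReal.ofReal (gaussWeight y (T - s) x)
    * ENNReal.ofReal (energyDensity ε (u s) x) with hE
  have hEJ : ∀ r, 0 < r → r ≤ t → ∫⁻ x, ENNReal.ofReal (gaussWeight y (2 * (T - r)) x)
      * ENNReal.ofReal (energyDensity ε (u r) x) ≤ J := by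
    intro r hr hrt
    have h1 := hu.lintegral_gaussWeight_energy_le hd hw hK hK0 (by linarith) y hr
      (by linarith : r < 2 * T)
    refine (lintegral_mono fun x => ?_).trans (h1.trans ?_)
    · gcongr
      exact gaussWeight_mono y (by linarith) (by linarith) x
    · rw [hJ]
      gcongr
      · rw [ofReal_energyDensity]
        exact le_self_add
      · exact potentialDensity_le (hK r ⟨hr, by linarith⟩ _)
  set U : Eucl d × ℝ → ℂ := fun p => u p.2 p.1 with hUdef
  have hU : SolvesGL ε U := hu.solvesGL
  have hprod : ∀ r, 0 < r → ∀ τ, ∀ x, ENNReal.ofReal (glEnergy ε U (x, r) * gaussWeight y τ x)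
      = ENNReal.ofReal (gaussWeight y τ x) * ENNReal.ofReal (energyDensity ε (u r) x) := by
    intro r hr τ x
    rw [mul_comm, ENNReal.ofReal_mul (gaussWeight_pos _ _ _).le, hu.energyDensity_eq hr]
  have hnn : ∀ r τ, ∀ x, 0 ≤ glEnergy ε U (x, r) * gaussWeight y τ x := fun r τ x =>
    mul_nonneg (glEnergy_nonneg _ _ _) (gaussWeight_pos _ _ _).le
  have hcts : ∀ r, 0 < r → ∀ τ, Continuous fun x => glEnergy ε U (x, r) * gaussWeight y τ x := by
    intro r hr τ
    exact (_root_.contDiff_slice (glEnergy_contDiffOn isOpen_Ioi (ε := ε) hu.smooth) hr).continuous.mul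
      (continuous_gaussWeight y τ)
  have hint : ∀ r, 0 < r → r ≤ t → Integrable fun x =>
      glEnergy ε U (x, r) * gaussWeight y (2 * (T - r)) x := by
    intro r hr hrt
    refine ⟨(hcts r hr _).aestronglyMeasurable, ?_⟩
    rw [hasFiniteIntegral_iff_ofReal (Eventually.of_forall (hnn r _))]
    simp_rw [hprod r hr]
    exact (hEJ r hr hrt).trans_lt hJfin.lt_top
  have hint1 : ∀ r, 0 < r → r ≤ t → Integrable fun x =>
      glEnergy ε U (x, r) * gaussWeight y (T - r) x := by
    intro r hr hrt
    refine (hint r hr hrt).mono' (hcts r hr _).aestronglyMeasurable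
      (Eventually.of_forall fun x => ?_)
    rw [Real.norm_of_nonneg (hnn r _ x)]
    exact mul_le_mul_of_nonneg_left (gaussWeight_mono y (by linarith) (by linarith) x)
      (glEnergy_nonneg _ _ _)
  have hEint : ∀ r, 0 < r → r ≤ t →
      ENNReal.ofReal (∫ x, glEnergy ε U (x, r) * gaussWeight y (T - r) x) = E r := by
    intro r hr hrt
    rw [ofReal_integral_eq_lintegral_ofReal (hint1 r hr hrt) (Eventually.of_forall (hnn r _))]
    simp_rw [hprod r hr]
    rfl
  have hmono : ∀ s, 0 < s → s ≤ t → E t ≤ ENNReal.ofReal ((T - s) ^ (-κ)) * E s := by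
    intro s hs hst
    have h1 := rpow_mul_integral_glEnergy_le hd hU y (J := J.toReal) hs hst htT
      (fun r hr => hint r (hs.trans_le hr.1) hr.2) (fun r hr => by
        have hr0 := hs.trans_le hr.1
        rw [integral_eq_lintegral_of_nonneg_ae (Eventually.of_forall (hnn r _))
          (hcts r hr0 _).aestronglyMeasurable]
        refine ENNReal.toReal_mono hJfin ?_
        simp_rw [hprod r hr0]
        exact hEJ r hr0 hr.2)
    have h2 := ENNReal.ofReal_le_ofReal h1
    rw [ENNReal.ofReal_mul (Real.rpow_nonneg (by linarith) _),
      ENNReal.ofReal_mul (Real.rpow_nonneg (by linarith) _), hEint t ht le_rfl,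
      hEint s hs hst] at h2
    simpa [hTt] using h2
  set G := ∫⁻ x, ENNReal.ofReal (gaussWeight y (4 * T) x)
            * (ENNReal.ofReal (1 / 2) * ∑ i, ‖weakGrad u₀ i x‖ₑ ^ 2) with hG
  set P := ∫⁻ x, ENNReal.ofReal (gaussWeight y T x)
    * ENNReal.ofReal (potentialDensity ε (u₀ x)) with hP
  -- As s → 0, exp(Ls) tends to 1 and the potential tends to that of the datum, so no dependence on
  -- ε or K is left apart from the energy of the datum itself.
  have hlim : Tendsto (fun s => ENNReal.ofReal ((T - s) ^ (-κ))
      * (ENNReal.ofReal (Real.exp (L * s)) * (ENNReal.ofReal (Real.exp 2) * G)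
        + (P + ENNReal.ofReal ((4 * K * (1 + K ^ 2)) / (4 * ε ^ 2))
          * ∫⁻ x, ENNReal.ofReal (gaussWeight y T x) * ‖u s x - u₀ x‖ₑ))) (𝓝[>] 0)
      (𝓝 (ENNReal.ofReal (T ^ (-κ)) * (1 * (ENNReal.ofReal (Real.exp 2) * G) + (P + 0)))) := by
    have hGfin : G ≠ ⊤ := ((hgrad_le _).trans_lt (hfin0 _ (by linarith))).ne
    have hGfin' : ENNReal.ofReal (Real.exp 2) * G ≠ ⊤ := by finiteness
    have l1 : Tendsto (fun s => ENNReal.ofReal ((T - s) ^ (-κ))) (𝓝[>] 0)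
        (𝓝 (ENNReal.ofReal (T ^ (-κ)))) := by
      refine (ENNReal.continuous_ofReal.tendsto _).comp (tendsto_nhdsWithin_of_tendsto_nhds ?_)
      have hc : ContinuousAt (fun s : ℝ => (T - s) ^ (-κ)) 0 := by
        refine ContinuousAt.rpow_const (by fun_prop) (Or.inl ?_)
        rw [sub_zero]
        linarith
      simpa [ContinuousAt] using hc
    have l2 : Tendsto (fun s => ENNReal.ofReal (Real.exp (L * s))) (𝓝[>] 0) (𝓝 1) := by
      have hc : Continuous (fun s : ℝ => ENNReal.ofReal (Real.exp (L * s))) :=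
        ENNReal.continuous_ofReal.comp (by fun_prop)
      refine tendsto_nhdsWithin_of_tendsto_nhds ?_
      simpa using hc.tendsto 0
    have l3 := ENNReal.Tendsto.const_mul
      (a := ENNReal.ofReal ((4 * K * (1 + K ^ 2)) / (4 * ε ^ 2)))
      (hu.tendsto_lintegral_gaussWeight (T := T) (by linarith) hKT hK0 y (by linarith : 0 < T))
      (Or.inr ENNReal.ofReal_ne_top)
    rw [mul_zero] at l3
    have hPfin : P ≠ ⊤ := by
      refine (lt_of_le_of_lt (lintegral_mono fun x => ?_) (hfin0 T hT1)).ne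
      rw [ofReal_energyDensity]
      gcongr
      exact le_add_self
    exact ENNReal.Tendsto.mul l1 (Or.inr (by finiteness)) ((ENNReal.Tendsto.mul_const l2
      (Or.inr hGfin')).add (l3.const_add P)) (Or.inr ENNReal.ofReal_ne_top)
  have hEt : E t ≤ ENNReal.ofReal (T ^ (-κ)) * (ENNReal.ofReal (Real.exp 2) * G + P) := by
    rw [one_mul, add_zero] at hlim
    refine ge_of_tendsto hlim ?_
    filter_upwards [Ioc_mem_nhdsGT ht] with s hs
    have hsT : s ∈ Ioc 0 T := ⟨hs.1, hs.2.trans htT.le⟩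
    refine (hmono s hs.1 hs.2).trans ?_
    gcongr
    refine (hu.lintegral_gaussWeight_energy_le hd hw hKT hK0 hT1 y hs.1
      (hs.2.trans_lt htT)).trans ?_
    gcongr
    exact lintegral_gaussWeight_potential_le hKT hK0 hm y T hsT
  have hGP : ENNReal.ofReal (Real.exp 2) * G + P ≤ ENNReal.ofReal (Real.exp 2)
      * ∫⁻ x, ENNReal.ofReal (gaussWeight y (4 * T) x) * ENNReal.ofReal (energyDensity ε u₀ x) := by
    have h1 : P ≤ ENNReal.ofReal (Real.exp 2) * ∫⁻ x, ENNReal.ofReal (gaussWeight y (4 * T) x)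
        * ENNReal.ofReal (potentialDensity ε (u₀ x)) := by
      refine le_trans (lintegral_mono fun x => ?_) (le_mul_of_one_le_left zero_le ?_)
      · gcongr
        exact gaussWeight_mono y (by linarith) (by linarith) x
      · exact ENNReal.one_le_ofReal.2 (Real.one_le_exp (by norm_num))
    calc _ ≤ ENNReal.ofReal (Real.exp 2) * G + ENNReal.ofReal (Real.exp 2)
          * ∫⁻ x, ENNReal.ofReal (gaussWeight y (4 * T) x)
          * ENNReal.ofReal (potentialDensity ε (u₀ x)) := by gcongr
      _ = _ := by
          rw [← mul_add, hG, ← lintegral_add_right']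
          · simp_rw [← mul_add, ← ofReal_energyDensity]
          · exact (hmg y _).aemeasurable.mul (((continuous_potentialDensity ε).comp_aestronglyMeasurable
              hm).aemeasurable.ennreal_ofReal)
  -- On the unit ball the weight is at least exp(-1/4), hence at least exp(-1).
  have hball : ballEnergy ε (u t) y 1 ≤ ENNReal.ofReal (Real.exp 1) * E t := by
    rw [hE]
    simp only [hTt]
    rw [← lintegral_const_mul' _ _ ENNReal.ofReal_ne_top]
    refine le_trans ?_ (setLIntegral_le_lintegral (Metric.ball y 1) _)
    refine setLIntegral_mono' measurableSet_ball fun x hx => ?_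
    rw [← mul_assoc]
    refine le_mul_of_one_le_left zero_le ?_
    rw [← ENNReal.ofReal_mul (Real.exp_pos _).le]
    refine ENNReal.one_le_ofReal.2 ?_
    rw [gaussWeight, ← Real.exp_add]
    refine Real.one_le_exp ?_
    have : ‖x - y‖ < 1 := by rwa [← dist_eq_norm]
    nlinarith [norm_nonneg (x - y)]
  have hfinal := volume_ball_mul_lintegral_gaussWeight_le hmE (fun z => h0.energy_le z) y
    (by linarith : 1 ≤ 4 * T)
  have hT0 : 0 < T := by linarith
  calc volume (Metric.ball (0 : Eucl d) 1) * ballEnergy ε (u t) y 1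
      ≤ volume (Metric.ball (0 : Eucl d) 1) * (ENNReal.ofReal (Real.exp 1)
        * (ENNReal.ofReal (T ^ (-κ)) * (ENNReal.ofReal (Real.exp 2)
          * ∫⁻ x, ENNReal.ofReal (gaussWeight y (4 * T) x)
            * ENNReal.ofReal (energyDensity ε u₀ x)))) := by
        gcongr
        exact hball.trans (by gcongr; exact hEt.trans (by gcongr))
    _ = ENNReal.ofReal (Real.exp 1) * ENNReal.ofReal (T ^ (-κ)) * ENNReal.ofReal (Real.exp 2)
        * (volume (Metric.ball (0 : Eucl d) 1) * ∫⁻ x, ENNReal.ofReal (gaussWeight y (4 * T) x)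
            * ENNReal.ofReal (energyDensity ε u₀ x)) := by ring
    _ ≤ ENNReal.ofReal (Real.exp 1) * ENNReal.ofReal (T ^ (-κ)) * ENNReal.ofReal (Real.exp 2)
        * (A * ENNReal.ofReal (Real.exp 1 * (Real.pi * (8 * (4 * T))) ^ (d / 2 : ℝ))) := by gcongr
    _ = A * ENNReal.ofReal (Real.exp 1 * T ^ (-κ) * Real.exp 2
        * (Real.exp 1 * (Real.pi * (8 * (4 * T))) ^ (d / 2 : ℝ))) := by
        have := Real.pi_pos
        rw [ENNReal.ofReal_mul (p := Real.exp 1 * T ^ (-κ) * Real.exp 2) (by positivity),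
          ENNReal.ofReal_mul (p := Real.exp 1 * T ^ (-κ)) (by positivity),
          ENNReal.ofReal_mul (p := Real.exp 1) (q := T ^ (-κ)) (by positivity)]
        ring
    _ = _ := by
        congr 2
        have h1 : (Real.pi * (8 * (4 * T))) ^ (d / 2 : ℝ)
            = (Real.pi * 32) ^ (d / 2 : ℝ) * T ^ (d / 2 : ℝ) := by
          rw [← Real.mul_rpow (by positivity) hT0.le]
          congr 1
          ring
        -- The prefactor of the monotonicity formula against the mass of the initial Gaussian: the
        -- source of the linear growth 1 + t.
        have h2 : T ^ (-κ) * T ^ (d / 2 : ℝ) = T := by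
          rw [← Real.rpow_add hT0, hκ, show -(((d : ℝ) - 2) / 2) + d / 2 = 1 by ring,
            Real.rpow_one]
        have h3 : Real.exp 4 = Real.exp 1 * Real.exp 2 * Real.exp 1 := by
          rw [← Real.exp_add, ← Real.exp_add]
          norm_num
        rw [h1, h3]
        linear_combination (Real.exp 1 * Real.exp 2 * Real.exp 1
          * (Real.pi * 32) ^ (d / 2 : ℝ)) * h2

end EnergyBound

end

/-! ### Propagation of the local energy bound -/

noncomputable section

section Propagation

variable {d : ℕ} {ε M₀ : ℝ} {u₀ : Eucl d → ℂ} {u : ℝ → Eucl d → ℂ}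

/-- The constant in the propagation of unit-ball energy bounds. -/
def unitBallConst (d : ℕ) : ℝ :=
  max 1 (Real.exp 4 * (Real.pi * 32) ^ (d / 2 : ℝ) / (volume (Metric.ball (0 : Eucl d) 1)).toReal)

lemma one_le_unitBallConst (d : ℕ) : 1 ≤ unitBallConst d := le_max_left _ _

lemma IsPGLSolution.ballEnergy_one_le (hd : 2 ≤ d) (hM : 0 ≤ M₀) (hu : IsPGLSolution ε u₀ u)
    (h0 : LocalEnergyBoundAt M₀ ε u₀) (y : Eucl d) {t : ℝ} (ht : 0 ≤ t) :
    ballEnergy ε (u t) y 1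
      ≤ ENNReal.ofReal (unitBallConst d * (1 + t) * M₀ * |Real.log ε|) := by
  have hC := one_le_unitBallConst d
  have hA : 0 ≤ M₀ * |Real.log ε| := by positivity
  -- At t = 0 the hypothesis on the datum is used directly; the maximum with 1 in `unitBallConst`
  -- covers this case.
  rcases ht.eq_or_lt with rfl | ht
  · rw [hu.initial]
    refine (h0.energy_le y).trans (ENNReal.ofReal_le_ofReal ?_)
    nlinarith
  · have hv0 := Metric.measure_ball_pos volume (0 : Eucl d) one_pos
    have hvt : volume (Metric.ball (0 : Eucl d) 1) ≠ ⊤ := measure_ball_lt_top.ne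
    have hv : 0 < (volume (Metric.ball (0 : Eucl d) 1)).toReal := ENNReal.toReal_pos hv0.ne' hvt
    refine (ENNReal.mul_le_mul_iff_right hv0.ne' hvt).1
      ((hu.volume_ball_mul_ballEnergy_le hd h0 y ht).trans ?_)
    have hpi := Real.pi_pos
    rw [← ENNReal.ofReal_toReal hvt, ← ENNReal.ofReal_mul hA, ← ENNReal.ofReal_mul hv.le]
    refine ENNReal.ofReal_le_ofReal ?_
    have h1 : Real.exp 4 * (Real.pi * 32) ^ (d / 2 : ℝ)
        ≤ (volume (Metric.ball (0 : Eucl d) 1)).toReal * unitBallConst d := by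
      rw [mul_comm _ (unitBallConst d)]
      exact (div_le_iff₀ hv).1 (le_max_right _ _)
    calc _ = Real.exp 4 * (Real.pi * 32) ^ (d / 2 : ℝ) * ((1 + t) * (M₀ * |Real.log ε|)) := by ring
      _ ≤ (volume (Metric.ball (0 : Eucl d) 1)).toReal * unitBallConst d
          * ((1 + t) * (M₀ * |Real.log ε|)) := by gcongr
      _ = _ := by ring

lemma IsPGLSolution.aemeasurable_energyDensity (hu : IsPGLSolution ε u₀ u)
    (h0 : LocalEnergyBoundAt M₀ ε u₀) {t : ℝ} (ht : 0 ≤ t) :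
    AEMeasurable (energyDensity ε (u t)) := by
  rcases ht.eq_or_lt with rfl | ht
  · rw [hu.initial]
    exact _root_.aemeasurable_energyDensity h0.weakly_differentiable
  · exact (hu.continuous_energyDensity ht).measurable.aemeasurable

lemma IsPGLSolution.ballEnergy_le (hd : 2 ≤ d) (hM : 0 ≤ M₀) (hu : IsPGLSolution ε u₀ u)
    (h0 : LocalEnergyBoundAt M₀ ε u₀) (y : Eucl d) {t R : ℝ} (ht : 0 ≤ t) (hR : 0 < R) :
    ballEnergy ε (u t) y R
      ≤ ENNReal.ofReal (unitBallConst d * (1 + R) ^ d * (1 + t) * M₀ * |Real.log ε|) := by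
  refine (setLIntegral_ball_le (hu.aemeasurable_energyDensity h0 ht).ennreal_ofReal
    (fun z => hu.ballEnergy_one_le hd hM h0 z ht) y hR).trans (le_of_eq ?_)
  rw [← ENNReal.ofReal_mul (by positivity)]
  ring_nf

lemma IsPGLSolution.localEnergyBoundAt (hd : 2 ≤ d) (hM : 0 ≤ M₀) (hu : IsPGLSolution ε u₀ u)
    (h0 : LocalEnergyBoundAt M₀ ε u₀) {t : ℝ} (ht : 0 < t) :
    LocalEnergyBoundAt (unitBallConst d * (1 + t) * M₀) ε (u t) where
  memLp_top := by
    obtain ⟨K, hK⟩ := hu.bounded t ht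
    exact memLp_top_of_bound (hu.contDiff_slice ht).continuous.aestronglyMeasurable K
      (Eventually.of_forall (hK t ⟨ht, le_rfl⟩))
  weakly_differentiable :=
    ⟨_, isWeakGradient_classicalPartial ((hu.contDiff_slice ht).of_le (by simp))⟩
  energy_le y := hu.ballEnergy_one_le hd hM h0 y ht.le

lemma LocalEnergyBoundAt.mono {M N : ℝ} (h : LocalEnergyBoundAt M ε u₀) (hMN : M ≤ N) :
    LocalEnergyBoundAt N ε u₀ where
  memLp_top := h.memLp_top
  weakly_differentiable := h.weakly_differentiable
  energy_le y := (h.energy_le y).trans (ENNReal.ofReal_le_ofReal (by gcongr))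

lemma IsPGLSolution.shift (hu : IsPGLSolution ε u₀ u) {T : ℝ} (hT : 0 < T) :
    IsPGLSolution ε (u T) (fun t => u (T + t)) where
  smooth := hu.smooth.comp (f := fun p : Eucl d × ℝ => (p.1, T + p.2))
    (by fun_prop) (fun p hp => ⟨trivial, by have := hp.2; simp only [mem_Ioi] at *; linarith⟩)
  bounded S hS := by
    obtain ⟨K, hK⟩ := hu.bounded (T + S) (by linarith)
    exact ⟨K, fun t ht => hK _ ⟨by linarith [ht.1], by linarith [ht.2]⟩⟩
  equation t ht x := by
    rw [deriv_comp_const_add (f := fun s => u s x)]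
    exact hu.equation (T + t) (by linarith) x
  initial := by simp
  tendsto_initial R _ := by
    obtain ⟨K, hK⟩ := hu.bounded (T + 1) (by linarith)
    -- At the positive time T the solution is continuous in time and bounded nearby, so dominated
    -- convergence on the ball gives the initial condition.
    have hlim : Tendsto (fun t => ∫⁻ x in Metric.ball (0 : Eucl d) R, ‖u (T + t) x - u T x‖ₑ)
        (𝓝[>] 0) (𝓝 (∫⁻ _ in Metric.ball (0 : Eucl d) R, 0)) := by
      refine tendsto_lintegral_filter_of_dominated_convergence
        (fun _ => ENNReal.ofReal (K + K)) ?_ ?_ ?_ ?_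
      · filter_upwards [self_mem_nhdsWithin] with t ht
        have ht' : 0 < T + t := by have : (0 : ℝ) < t := ht; linarith
        exact ((hu.contDiff_slice ht').continuous.sub
          (hu.contDiff_slice hT).continuous).measurable.enorm
      · filter_upwards [Ioc_mem_nhdsGT one_pos] with t ht
        refine Eventually.of_forall fun x => ?_
        rw [← ofReal_norm]
        exact ENNReal.ofReal_le_ofReal ((norm_sub_le _ _).trans (add_le_add
          (hK _ ⟨by linarith [ht.1], by linarith [ht.2]⟩ x) (hK _ ⟨hT, by linarith⟩ x)))
      · rw [setLIntegral_const]
        exact ENNReal.mul_ne_top ENNReal.ofReal_ne_top measure_ball_lt_top.ne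
      · refine Eventually.of_forall fun x => ?_
        have hc : ContinuousAt (fun t : ℝ => ‖u (T + t) x - u T x‖ₑ) 0 := by
          have h1 : ContinuousAt (fun p : Eucl d × ℝ => u p.2 p.1) (x, T + 0) :=
            hu.smooth.continuousOn.continuousAt
              ((isOpen_univ.prod isOpen_Ioi).mem_nhds ⟨trivial, by simpa using hT⟩)
          have h2 : ContinuousAt (fun t : ℝ => u (T + t) x) 0 :=
            ContinuousAt.comp (f := fun t : ℝ => (x, T + t))
              (g := fun p : Eucl d × ℝ => u p.2 p.1) h1 (by fun_prop)
          exact (h2.sub continuousAt_const).enorm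
        refine tendsto_nhdsWithin_of_tendsto_nhds ?_
        simpa [ContinuousAt] using hc
    simpa using hlim

end Propagation

end

/-! ### Semi-monotonicity of localized energies -/

noncomputable section

section SemiMonotonicity

variable {d : ℕ} {ε M₀ : ℝ} {u₀ : Eucl d → ℂ} {u : ℝ → Eucl d → ℂ}

lemma neg_sq_sub_two_inner_le (b w : ℂ) (c : ℝ) :
    -(‖b‖ ^ 2 * c ^ 2) - 2 * (c * inner ℝ b w) ≤ ‖w‖ ^ 2 := by
  have h := norm_add_sq_real (c • b) w
  rw [norm_smul, mul_pow, Real.norm_eq_abs, sq_abs, real_inner_smul_left] at h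
  nlinarith [sq_nonneg ‖c • b + w‖]

/-- With the test function χ² the cross term is 2χ⟨∂ₜu, ∇χ·∇u⟩, which the dissipation |∂ₜu|²χ²
absorbs; what remains is |∇χ·∇u|² ≤ 2e|∇χ|². A test function that is not a square would not allow
this absorption. -/
lemma IsPGLSolution.exists_hasDerivAt_integral_energy_mul_sq (hu : IsPGLSolution ε u₀ u)
    {χ : Eucl d → ℝ} (hχ : ContDiff ℝ ∞ χ) (hc : HasCompactSupport χ) {t : ℝ} (ht : 0 < t) :
    ∃ D, HasDerivAt (fun s => ∫ x, energyDensity ε (u s) x * χ x ^ 2) D t ∧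
      D ≤ ∫ x, energyDensity ε (u t) x * (2 * ∑ i, classicalPartial χ i x ^ 2) := by
  set U : Eucl d × ℝ → ℂ := fun p => u p.2 p.1 with hUdef
  have hU : SolvesGL ε U := hu.solvesGL
  have hχ1 : ContDiff ℝ 1 χ := hχ.of_le (by simp)
  set ψ : Eucl d × ℝ → ℝ := fun p => χ p.1 ^ 2 with hψdef
  have hψ' : ContDiff ℝ ∞ ψ := (hχ.comp contDiff_fst).pow 2
  have hψ : ContDiffOn ℝ ∞ ψ (univ ×ˢ Ioi 0) := hψ'.contDiffOn
  have hE := glEnergy_contDiffOn isOpen_Ioi (ε := ε) hU.smooth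
  have hψ0 : ∀ x ∉ tsupport χ, ∀ t, ψ (x, t) = 0 := fun x hx t => by
    simp [hψdef, image_eq_zero_of_notMem_tsupport hx]
  have hcp : ∀ i, Continuous (classicalPartial χ i) := fun i =>
    (hχ1.continuous_fderiv (by simp)).clm_apply continuous_const
  have hpd : ∀ i, ∀ x t, pd (spDir i) ψ (x, t) = 2 * χ x * classicalPartial χ i x := by
    intro i x t
    rw [spDir, pd_spDir_eq (hψ'.differentiable (by simp) _)]
    have h1 := ((hχ1.differentiable (by simp) x).hasFDerivAt.pow 2).fderiv
    simp only [hψdef, classicalPartial]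
    rw [h1]
    simp [mul_assoc]
  have hpt : ∀ x t, pd tmDir ψ (x, t) = 0 := by
    intro x t
    have h := hasDerivAt_tmDir (hψ'.differentiable (by simp) (x, t))
    exact h.unique (hasDerivAt_const t (χ x ^ 2))
  obtain ⟨D, hD, hDle⟩ := exists_hasDerivAt_integral_le isOpen_Ioi
    (f := fun p => glEnergy ε U p * ψ p)
    (B := fun p => glEnergy ε U p * (2 * ∑ i, classicalPartial χ i p.1 ^ 2))
    (X := fun i p => ψ p * inner ℝ (pd (spDir i) U p) (pd tmDir U p)) hc (hE.mul hψ)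
    (fun x hx t _ => by rw [hψ0 x hx, mul_zero])
    (fun i => hψ.mul ((hU.smooth.pd isOpen_Ioi _).inner ℝ (hU.smooth.pd isOpen_Ioi _)))
    (fun i x hx t _ => by rw [hψ0 x hx, zero_mul]) ht
    (by
      refine Continuous.integrable_of_hasCompactSupport ?_ (HasCompactSupport.intro hc ?_)
      · exact (_root_.contDiff_slice hE ht).continuous.mul (by fun_prop)
      · intro x hx
        have h0 : ∀ i, classicalPartial χ i x = 0 := fun i => by
          rw [classicalPartial, fderiv_of_notMem_tsupport (𝕜 := ℝ) hx]
          simp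
        simp [h0])
    (fun x => by
      rw [pd_tmDir_glEnergy_mul isOpen_Ioi subset_rfl hU hψ (p := (x, t)) ht, hpt, mul_zero, zero_sub]
      refine add_le_add ?_ le_rfl
      set w := ∑ i, classicalPartial χ i x • pd (spDir i) U (x, t) with hw
      have h1 : ∑ i, pd (spDir i) ψ (x, t) • pd (spDir i) U (x, t) = (2 * χ x) • w := by
        rw [hw, Finset.smul_sum]
        simp_rw [hpd, mul_smul]
      have h2 := neg_sq_sub_two_inner_le (pd tmDir U (x, t)) w (χ x)
      have h3 := norm_sum_smul_sq_le (fun i => classicalPartial χ i x)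
        (fun i => pd (spDir i) U (x, t))
      have h4 := sum_norm_sq_le_glEnergy ε U (x, t)
      have h5 : 0 ≤ ∑ i, classicalPartial χ i x ^ 2 := by positivity
      rw [h1, real_inner_smul_right]
      simp only [hψdef]
      nlinarith [mul_le_mul_of_nonneg_left h4 h5])
  refine ⟨D, hD.congr_of_eventuallyEq ?_, hDle.trans (le_of_eq ?_)⟩
  · filter_upwards [Ioi_mem_nhds ht] with s hs
    simp_rw [hu.energyDensity_eq hs]
    rfl
  · simp_rw [hu.energyDensity_eq ht]
    rfl

end SemiMonotonicity

end

/-! ### Selection of a sequence; a countable family of test functions -/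

noncomputable section

section Selection

/-- The diagonal argument in the form of sequential compactness of a countable product of intervals.
-/
lemma exists_strictMono_forall_tendsto {ι : Type*} [Countable ι] {G : ℕ → ι → ℝ}
    (hG : ∀ i, ∃ B, ∀ m, |G m i| ≤ B) :
    ∃ φ : ℕ → ℕ, StrictMono φ ∧ ∀ i, ∃ l, Tendsto (fun m => G (φ m) i) atTop (𝓝 l) := by
  choose B hB using hG
  have hK : IsCompact (univ.pi fun i => Icc (-B i) (B i)) :=
    isCompact_univ_pi fun i => isCompact_Icc
  obtain ⟨L, -, φ, hφ, hL⟩ := hK.tendsto_subseq (x := G)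
    (fun m i _ => abs_le.1 (hB i m))
  exact ⟨φ, hφ, fun i => ⟨L i, tendsto_pi_nhds.1 hL i⟩⟩

/-- Helly's selection theorem: a sequence of functions on `(0,∞)` which are decreasing up to a fixed
function and pointwise bounded has limits off a countable set along a sequence which has limits at
positive points of a dense set. -/
lemma exists_countable_forall_tendsto_of_antitoneOn {f : ℕ → ℝ≥0 → ℝ}
    (hf : ∀ m, AntitoneOn (f m) (Ioi 0)) (hB : ∀ t, ∃ B, ∀ m, |f m t| ≤ B) {Q : Set ℝ≥0}
    (hQ : Dense Q) (hlim : ∀ q ∈ Q, ∃ l, Tendsto (fun m => f m q) atTop (𝓝 l)) :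
    ∃ D : Set ℝ≥0, D.Countable ∧ ∀ t, t ∉ D → ∃ l, Tendsto (fun m => f m t) atTop (𝓝 l) := by
  have hbdd : ∀ t, IsBoundedUnder (· ≤ ·) atTop fun m => f m t := fun t => by
    obtain ⟨B, hB⟩ := hB t
    exact isBoundedUnder_of ⟨B, fun m => (abs_le.1 (hB m)).2⟩
  have hbdd' : ∀ t, IsBoundedUnder (· ≥ ·) atTop fun m => f m t := fun t => by
    obtain ⟨B, hB⟩ := hB t
    exact isBoundedUnder_of ⟨-B, fun m => (abs_le.1 (hB m)).1⟩
  -- H is again decreasing on t > 0, hence continuous there off a countable set. Time 0 joins the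
  -- exceptional set because monotonicity is only assumed for t > 0.
  set H : ℝ≥0 → ℝ := fun t => limsup (fun m => f m t) atTop with hH
  have hHa : AntitoneOn H (Ioi 0) := fun s hs t ht hst =>
    limsup_le_limsup (Eventually.of_forall fun m => hf m hs ht hst)
      (hbdd' t).isCoboundedUnder_le (hbdd s)
  have hHQ : ∀ q ∈ Q, Tendsto (fun m => f m q) atTop (𝓝 (H q)) := fun q hq => by
    obtain ⟨l, hl⟩ := hlim q hq
    rw [show H q = l from hl.limsup_eq]
    exact hl
  refine ⟨{t ∈ Ioi 0 | ¬ContinuousWithinAt H (Ioi 0) t} ∪ {0},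
    hHa.countable_not_continuousWithinAt.union (countable_singleton 0), fun t ht => ⟨H t, ?_⟩⟩
  have ht0 : 0 < t := by
    refine pos_iff_ne_zero.2 fun h => ht (Or.inr h)
  have hc : ContinuousAt H t := by
    by_contra hcon
    exact ht (Or.inl ⟨ht0, fun h => hcon (h.continuousAt (Ioi_mem_nhds ht0))⟩)
  -- At a continuity point f(t) is squeezed between its values at dense points just after and just
  -- before t.
  refine tendsto_order.2 ⟨fun a ha => ?_, fun b hb => ?_⟩
  · have h1 : ∀ᶠ s in 𝓝[>] t, a < H s :=
      tendsto_nhdsWithin_of_tendsto_nhds hc (lt_mem_nhds ha)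
    obtain ⟨v, hv, hvs⟩ := (mem_nhdsGT_iff_exists_Ioo_subset' (lt_add_one t)).1 h1
    obtain ⟨q, hqQ, hq⟩ := hQ.exists_between hv
    filter_upwards [(hHQ q hqQ).eventually (lt_mem_nhds (hvs hq))] with m hm
    exact hm.trans_le (hf m ht0 (ht0.trans hq.1) hq.1.le)
  · have h1 : ∀ᶠ s in 𝓝[<] t, H s < b :=
      tendsto_nhdsWithin_of_tendsto_nhds hc (gt_mem_nhds hb)
    obtain ⟨v, hv, hvs⟩ := (mem_nhdsLT_iff_exists_Ioo_subset' ht0).1 h1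
    obtain ⟨q, hqQ, hq⟩ := hQ.exists_between (show max v 0 < t from max_lt hv ht0)
    have hq' : q ∈ Ioo v t := ⟨(le_max_left _ _).trans_lt hq.1, hq.2⟩
    filter_upwards [(hHQ q hqQ).eventually (gt_mem_nhds (hvs hq'))] with m hm
    exact (hf m ((le_max_right _ _).trans_lt hq.1) ht0 hq.2.le).trans_lt hm

/-- Two extractions: one over a countable dense set of times, after which Helly leaves only
countably many bad times for each k, and a second one over all these bad times, including 0. In this
way no time is lost. -/
lemma exists_strictMono_forall_tendsto_of_antitoneOn {F : ℕ → ℕ → ℝ≥0 → ℝ} {a : ℕ → ℝ≥0 → ℝ}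
    (hF : ∀ m k, AntitoneOn (fun t => F m k t - a k t) (Ioi 0))
    (hB : ∀ k t, ∃ B, ∀ m, |F m k t| ≤ B) :
    ∃ φ : ℕ → ℕ, StrictMono φ ∧ ∀ k t, ∃ l, Tendsto (fun m => F (φ m) k t) atTop (𝓝 l) := by
  obtain ⟨Q, hQc, hQ⟩ := TopologicalSpace.exists_countable_dense ℝ≥0
  have := hQc.to_subtype
  obtain ⟨φ, hφ, hlim⟩ := exists_strictMono_forall_tendsto (ι := ℕ × Q)
    (G := fun m i => F m i.1 i.2) fun i => hB i.1 i.2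
  have hD : ∀ k, ∃ D : Set ℝ≥0, D.Countable ∧ ∀ t, t ∉ D →
      ∃ l, Tendsto (fun m => F (φ m) k t) atTop (𝓝 l) := by
    intro k
    obtain ⟨D, hDc, hD⟩ := exists_countable_forall_tendsto_of_antitoneOn
      (f := fun m t => F (φ m) k t - a k t) (fun m => hF (φ m) k) (fun t => by
        obtain ⟨B, hB⟩ := hB k t
        exact ⟨B + |a k t|, fun m => (abs_sub _ _).trans (add_le_add (hB _) le_rfl)⟩) hQ
      (fun q hq => by
        obtain ⟨l, hl⟩ := hlim (k, ⟨q, hq⟩)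
        exact ⟨_, hl.sub_const _⟩)
    refine ⟨D, hDc, fun t ht => ?_⟩
    obtain ⟨l, hl⟩ := hD t ht
    exact ⟨l + a k t, by simpa using hl.add_const (a k t)⟩
  choose D hDc hD using hD
  have := fun k => (hDc k).to_subtype
  obtain ⟨φ', hφ', hlim'⟩ := exists_strictMono_forall_tendsto (ι := Σ k, D k)
    (G := fun m i => F (φ m) i.1 i.2) fun i => by
      obtain ⟨B, hB⟩ := hB i.1 i.2
      exact ⟨B, fun m => hB _⟩
  refine ⟨φ ∘ φ', hφ.comp hφ', fun k t => ?_⟩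
  by_cases ht : t ∈ D k
  · exact hlim' ⟨k, t, ht⟩
  · obtain ⟨l, hl⟩ := hD k t ht
    exact ⟨l, hl.comp hφ'.tendsto_atTop⟩

lemma exists_tendsto_of_forall_exists_close {a : ℕ → ℝ}
    (h : ∀ δ > 0, ∃ b : ℕ → ℝ, (∃ l, Tendsto b atTop (𝓝 l)) ∧ ∀ m, |a m - b m| ≤ δ) :
    ∃ l, Tendsto a atTop (𝓝 l) := by
  refine cauchySeq_tendsto_of_complete (Metric.cauchySeq_iff'.2 fun δ hδ => ?_)
  obtain ⟨b, ⟨l, hl⟩, hab⟩ := h (δ / 4) (by linarith)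
  obtain ⟨N, hN⟩ := Metric.cauchySeq_iff'.1 hl.cauchySeq (δ / 4) (by linarith)
  refine ⟨N, fun n hn => ?_⟩
  have h1 := hN n hn
  rw [Real.dist_eq] at h1 ⊢
  have h2 := abs_le.1 (hab n)
  have h3 := abs_le.1 (hab N)
  have h4 := abs_lt.1 h1
  rw [abs_lt]
  constructor <;> linarith [h2.1, h2.2, h3.1, h3.2, h4.1, h4.2]

end Selection

section TestFunctions

variable {d : ℕ}

/-- There are countably many smooth functions which are dense for locally uniform convergence. -/
lemma exists_seq_contDiff_dense (d : ℕ) : ∃ g : ℕ → Eucl d → ℝ, (∀ k, ContDiff ℝ ∞ (g k)) ∧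
    ∀ f : Eucl d → ℝ, Continuous f → ∀ K : Set (Eucl d), IsCompact K → ∀ δ > 0,
      ∃ k, ∀ x ∈ K, |g k x - f x| ≤ δ := by
  set S : Set C(Eucl d, ℝ) := {f | ContDiff ℝ ∞ f} with hS
  have hne : Nonempty S := ⟨⟨0, (contDiff_const : ContDiff ℝ ∞ fun _ : Eucl d => (0 : ℝ))⟩⟩
  -- The space of continuous functions is second countable for the compact-open topology, so its
  -- subspace of smooth functions is separable in its own right.
  obtain ⟨s, hs⟩ := TopologicalSpace.exists_dense_seq S
  refine ⟨fun k => (s k).1, fun k => (s k).2, fun f hf K hK δ hδ => ?_⟩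
  obtain ⟨g, hg, hgf, -⟩ := hf.exists_contDiff_approx (⊤ : ℕ∞) (continuous_const (y := δ / 2))
    (fun _ => by linarith)
  set gS : S := ⟨⟨g, hg.continuous⟩, hg⟩ with hgS
  have hnhds : {h : S | ∀ x ∈ K, dist (g x) (h.1 x) < δ / 2} ∈ 𝓝 gS := by
    have h1 := (ContinuousMap.tendsto_iff_forall_isCompact_tendstoUniformlyOn
      (f := gS.1) (F := fun h : S => h.1) (p := 𝓝 gS)).1 continuous_subtype_val.continuousAt K hK
    exact Metric.tendstoUniformlyOn_iff.1 h1 (δ / 2) (by linarith)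
  obtain ⟨h, hh, k, rfl⟩ := mem_closure_iff_nhds.1 (hs gS) _ hnhds
  refine ⟨k, fun x hx => ?_⟩
  have h1 := hh x hx
  have h2 := hgf x
  rw [Real.dist_eq] at h1 h2
  rw [abs_le]
  have h3 := abs_lt.1 h1
  have h4 := abs_lt.1 h2
  constructor <;> linarith [h3.1, h3.2, h4.1, h4.2]

lemma exists_contDiff_cutoff (d : ℕ) (N : ℕ) : ∃ ζ : Eucl d → ℝ, ContDiff ℝ ∞ ζ ∧
    (∀ x, ζ x ∈ Icc 0 1) ∧ (∀ x ∈ Metric.closedBall 0 (N : ℝ), ζ x = 1) ∧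
    tsupport ζ ⊆ Metric.closedBall 0 (N + 2 : ℝ) := by
  have hN : (0 : ℝ) ≤ N := N.cast_nonneg
  let b : ContDiffBump (0 : Eucl d) := ⟨N + 1, N + 2, by linarith, by linarith⟩
  refine ⟨b, b.contDiff, fun x => ⟨b.nonneg, b.le_one⟩, fun x hx => b.one_of_mem_closedBall
    (Metric.closedBall_subset_closedBall (by simp [b]) hx), ?_⟩
  rw [b.tsupport_eq]

end TestFunctions

end

/-! ### Convergence of the slices at every time -/

noncomputable section

section VagueConvergence

variable {d : ℕ}

lemma isFiniteMeasureOnCompacts_of_ball {ν : Measure (Eucl d)}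
    (h : ∀ R : ℝ, ν (Metric.ball 0 R) < ⊤) : IsFiniteMeasureOnCompacts ν where
  lt_top_of_isCompact K hK := by
    obtain ⟨R, hR⟩ := hK.isBounded.subset_ball 0
    exact (measure_mono hR).trans_lt (h R)

lemma abs_integral_le_of_ball {ν : Measure (Eucl d)} {f : Eucl d → ℝ} {c R B : ℝ}
    (hB : 0 ≤ B) (hν : ν (Metric.ball 0 R) ≤ ENNReal.ofReal B)
    (hf0 : ∀ x ∉ Metric.ball 0 R, f x = 0) (hfc : ∀ x, |f x| ≤ c) :
    |∫ x, f x ∂ν| ≤ c * B := by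
  have hc : 0 ≤ c := (abs_nonneg _).trans (hfc 0)
  rw [← setIntegral_eq_integral_of_forall_compl_eq_zero hf0]
  rw [← Real.norm_eq_abs]
  refine (norm_setIntegral_le_of_norm_le_const (C := c) (f := f) (hν.trans_lt ENNReal.ofReal_lt_top)
    fun x _ => hfc x).trans ?_
  gcongr
  exact ENNReal.toReal_le_of_le_ofReal hB hν

lemma exists_bound_of_hasCompactSupport {f : Eucl d → ℝ} (hf : Continuous f)
    (hc : HasCompactSupport f) : ∃ c, ∀ x, |f x| ≤ c := by
  obtain ⟨c, hc⟩ := hf.bounded_above_of_compact_support hc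
  exact ⟨c, hc⟩

/-- Polarization f = ((f+1)² - (f-1)²)/4, with g and g' approximating f+1 and f-1. The cutoff ζ is
harmless because ζ²f = f. The factor 2c+3 bounds the sums g + (f+1) and g' + (f-1). -/
lemma abs_sub_sq_sub_sq_le {f ζ g g' c η : ℝ} (hη1 : η ≤ 1) (hf : |f| ≤ c)
    (hζ : ζ ∈ Icc (0 : ℝ) 1) (hfζ : ζ = 1 ∨ f = 0) (hg : |g - (f + 1)| ≤ η)
    (hg' : |g' - (f - 1)| ≤ η) :
    |f - ((ζ * g) ^ 2 - (ζ * g') ^ 2) / 4| ≤ (2 * c + 3) / 2 * η := by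
  have hη : 0 ≤ η := (abs_nonneg _).trans hg
  have hc : 0 ≤ c := (abs_nonneg _).trans hf
  have e1 : f - ((ζ * g) ^ 2 - (ζ * g') ^ 2) / 4 = ζ ^ 2 * (((g' - (f - 1)) * (g' + (f - 1))
      - (g - (f + 1)) * (g + (f + 1))) / 4) := by
    rcases hfζ with rfl | rfl <;> ring
  have h1 : |g' + (f - 1)| ≤ 2 * c + 3 := by
    rw [abs_le] at *
    constructor <;> linarith [hg'.1, hg'.2, hf.1, hf.2]
  have h2 : |g + (f + 1)| ≤ 2 * c + 3 := by
    rw [abs_le] at *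
    constructor <;> linarith [hg.1, hg.2, hf.1, hf.2]
  have hζ2 : ζ ^ 2 ≤ 1 := pow_le_one₀ hζ.1 hζ.2
  rw [e1, abs_mul, abs_of_nonneg (sq_nonneg ζ), abs_div, abs_of_pos (by norm_num : (0 : ℝ) < 4)]
  have h3 : |(g' - (f - 1)) * (g' + (f - 1)) - (g - (f + 1)) * (g + (f + 1))|
      ≤ η * (2 * c + 3) + η * (2 * c + 3) := by
    refine (abs_sub _ _).trans ?_
    rw [abs_mul, abs_mul]
    gcongr
  refine (mul_le_of_le_one_left (by positivity) hζ2).trans ?_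
  linarith

/-- Monotonicity is available only for integrals of squares χ². Countably many χ, products of a
cutoff and a member of a dense family, approximate every test function through polarization,
uniformly in m. -/
lemma exists_strictMono_forall_integral_tendsto {ν : ℕ → ℝ≥0 → Measure (Eucl d)}
    (hfin : ∀ t R, ∃ B : ℝ, 0 ≤ B ∧ ∀ m, ν m t (Metric.ball 0 R) ≤ ENNReal.ofReal B)
    (hmono : ∀ χ : Eucl d → ℝ, ContDiff ℝ ∞ χ → HasCompactSupport χ → ∃ a : ℝ≥0 → ℝ,
      ∀ m, AntitoneOn (fun t => (∫ x, χ x ^ 2 ∂(ν m t)) - a t) (Ioi 0)) :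
    ∃ φ : ℕ → ℕ, StrictMono φ ∧ ∀ t, ∀ f : Eucl d → ℝ, Continuous f → HasCompactSupport f →
      ∃ l, Tendsto (fun m => ∫ x, f x ∂(ν (φ m) t)) atTop (𝓝 l) := by
  have hfm : ∀ m t, IsFiniteMeasureOnCompacts (ν m t) := fun m t =>
    isFiniteMeasureOnCompacts_of_ball fun R => by
      obtain ⟨B, -, hB⟩ := hfin t R
      exact (hB m).trans_lt ENNReal.ofReal_lt_top
  obtain ⟨g, hg, hgd⟩ := exists_seq_contDiff_dense d
  choose ζ hζ hζI hζ1 hζs using exists_contDiff_cutoff d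
  -- The index j encodes a pair (cutoff radius, dense function).
  set χ : ℕ → Eucl d → ℝ := fun j x => ζ j.unpair.1 x * g j.unpair.2 x with hχ
  have hχs : ∀ j, ContDiff ℝ ∞ (χ j) := fun j => (hζ _).mul (hg _)
  have hζc : ∀ N, HasCompactSupport (ζ N) := fun N =>
    (isCompact_closedBall _ _).of_isClosed_subset (isClosed_tsupport _) (hζs N)
  have hχc : ∀ j, HasCompactSupport (χ j) := fun j => (hζc _).mul_right
  have hχ2c : ∀ j, HasCompactSupport fun x => χ j x ^ 2 := fun j =>
    (hχc j).comp_left (g := fun y => y ^ 2) (by simp)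
  have hχ0 : ∀ j, ∀ x ∉ Metric.ball 0 (j.unpair.1 + 3 : ℝ), χ j x = 0 := by
    intro j x hx
    have : ζ j.unpair.1 x = 0 := image_eq_zero_of_notMem_tsupport fun h => hx
      (Metric.closedBall_subset_ball (by linarith) (hζs _ h))
    simp [hχ, this]
  choose a ha using fun j => hmono (χ j) (hχs j) (hχc j)
  obtain ⟨φ, hφ, hlim⟩ := exists_strictMono_forall_tendsto_of_antitoneOn
    (F := fun m j t => ∫ x, χ j x ^ 2 ∂(ν m t)) (a := a) (fun m j => ha j m) (fun j t => by
      obtain ⟨B, hB0, hB⟩ := hfin t (j.unpair.1 + 3)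
      obtain ⟨c, hc⟩ := exists_bound_of_hasCompactSupport ((hχs j).continuous.pow 2) (hχ2c j)
      exact ⟨c * B, fun m => abs_integral_le_of_ball hB0 (hB m)
        (fun x hx => by simp [hχ0 j x hx]) hc⟩)
  refine ⟨φ, hφ, fun t f hf hfc => exists_tendsto_of_forall_exists_close fun δ hδ => ?_⟩
  obtain ⟨c, hc⟩ := exists_bound_of_hasCompactSupport hf hfc
  have hc0 : 0 ≤ c := (abs_nonneg _).trans (hc 0)
  obtain ⟨r, hr⟩ := hfc.isBounded.subset_closedBall 0
  obtain ⟨N, hN⟩ := exists_nat_ge r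
  obtain ⟨B, hB0, hB⟩ := hfin t (N + 3)
  -- Chosen so that the error (2c+3)η/2, integrated over a ball of mass at most B, is at most δ; B+1
  -- avoids dividing by zero.
  set η := min 1 (δ / ((2 * c + 3) / 2 * (B + 1))) with hη
  have hη0 : 0 < η := by positivity
  obtain ⟨k, hk⟩ := hgd (fun x => f x + 1) (by fun_prop) _
    (isCompact_closedBall (0 : Eucl d) (N + 2 : ℝ)) η hη0
  obtain ⟨k', hk'⟩ := hgd (fun x => f x - 1) (by fun_prop) _
    (isCompact_closedBall (0 : Eucl d) (N + 2 : ℝ)) η hη0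
  refine ⟨fun m => ((∫ x, χ (Nat.pair N k) x ^ 2 ∂(ν (φ m) t))
    - ∫ x, χ (Nat.pair N k') x ^ 2 ∂(ν (φ m) t)) / 4, ?_, fun m => ?_⟩
  · obtain ⟨l, hl⟩ := hlim (Nat.pair N k) t
    obtain ⟨l', hl'⟩ := hlim (Nat.pair N k') t
    exact ⟨_, (hl.sub hl').div_const 4⟩
  · have := hfm (φ m) t
    have hi : ∀ j, Integrable (fun x => χ j x ^ 2) (ν (φ m) t) := fun j =>
      ((hχs j).continuous.pow 2).integrable_of_hasCompactSupport (hχ2c j)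
    have hif : Integrable f (ν (φ m) t) := hf.integrable_of_hasCompactSupport hfc
    have hi2 : Integrable (fun x => (χ (Nat.pair N k) x ^ 2 - χ (Nat.pair N k') x ^ 2) / 4)
        (ν (φ m) t) := ((hi _).sub (hi _)).div_const 4
    beta_reduce
    rw [← integral_sub (hi _) (hi _), ← integral_div, ← integral_sub hif hi2]
    have hf0 : ∀ x ∉ Metric.closedBall 0 (N : ℝ), f x = 0 := fun x hx =>
      image_eq_zero_of_notMem_tsupport fun h => hx
        (Metric.closedBall_subset_closedBall hN (hr h))
    have hχN : ∀ k, ∀ x ∉ tsupport (ζ N), χ (Nat.pair N k) x = 0 := fun k x hx => by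
      simp [hχ, image_eq_zero_of_notMem_tsupport hx]
    have hfN : ∀ x ∉ tsupport (ζ N), f x = 0 := fun x hx => hf0 x fun h => hx
      (subset_tsupport _ (by simp [hζ1 N x h]))
    refine (abs_integral_le_of_ball (c := (2 * c + 3) / 2 * η) hB0 (hB (φ m)) ?_ ?_).trans ?_
    · intro x hx
      have hx' : x ∉ tsupport (ζ N) := fun h => hx
        (Metric.closedBall_subset_ball (by linarith) (hζs N h))
      simp [hχN _ x hx', hfN x hx']
    · intro x
      by_cases hx : x ∈ tsupport (ζ N)
      · have hx2 := hζs N hx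
        have := abs_sub_sq_sub_sq_le (min_le_left _ _) (hc x) (hζI N x)
          (or_iff_not_imp_right.2 fun h => hζ1 N x (by_contra fun h' => h (hf0 x h')))
          (hk x hx2) (hk' x hx2)
        simpa [hχ] using this
      · rw [hχN _ x hx, hχN _ x hx, hfN x hx]
        simp only [ne_eq, OfNat.ofNat_ne_zero, not_false_eq_true, zero_pow, sub_self, zero_div,
          abs_zero]
        positivity
    · have h1 : η * ((2 * c + 3) / 2 * (B + 1)) ≤ δ :=
        (le_div_iff₀ (by positivity)).1 (min_le_right _ _)
      refine le_trans ?_ h1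
      have : 0 ≤ (2 * c + 3) / 2 * η := by positivity
      nlinarith

open CompactlySupported in
/-- Pointwise convergence of the integrals of test functions gives a limit measure. -/
lemma exists_weaklyConverges {ν : ℕ → Measure (Eucl d)} [∀ m, IsFiniteMeasureOnCompacts (ν m)]
    (h : ∀ f : Eucl d → ℝ, Continuous f → HasCompactSupport f →
      ∃ l, Tendsto (fun m => ∫ x, f x ∂(ν m)) atTop (𝓝 l)) :
    ∃ μ : Measure (Eucl d), IsFiniteMeasureOnCompacts μ ∧ WeaklyConverges ν μ := by
  choose l hl using fun f : C_c(Eucl d, ℝ) => h f f.continuous f.hasCompactSupport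
  have hi : ∀ (f : C_c(Eucl d, ℝ)) m, Integrable f (ν m) := fun f m =>
    f.continuous.integrable_of_hasCompactSupport f.hasCompactSupport
  let Λ₀ : C_c(Eucl d, ℝ) →ₗ[ℝ] ℝ :=
    { toFun := l
      map_add' := fun f g => by
        refine tendsto_nhds_unique (hl (f + g)) (((hl f).add (hl g)).congr fun m => ?_)
        rw [← integral_add (hi f m) (hi g m)]
        rfl
      map_smul' := fun c f => by
        refine tendsto_nhds_unique (hl (c • f)) (((hl f).const_mul c).congr fun m => ?_)
        rw [← integral_const_mul]
        rfl }
  let Λ : C_c(Eucl d, ℝ) →ₚ[ℝ] ℝ := PositiveLinearMap.mk₀ Λ₀ fun f hf =>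
    ge_of_tendsto' (hl f) fun m => integral_nonneg fun x => hf x
  refine ⟨RealRMK.rieszMeasure Λ, inferInstance, fun f hf hfc => ?_⟩
  have h1 := RealRMK.integral_rieszMeasure Λ ⟨⟨f, hf⟩, hfc⟩
  have h2 := hl ⟨⟨f, hf⟩, hfc⟩
  exact h1 ▸ h2

end VagueConvergence

end

/-! ### Lebesgue measure on times, weak convergence, measurability in time -/

noncomputable section

section TimeMeasure

lemma measurableEmbedding_nnreal_coe : MeasurableEmbedding ((↑) : ℝ≥0 → ℝ) :=
  MeasurableEmbedding.subtype_coe measurableSet_Ici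

lemma timeMeasure_singleton_zero : timeMeasure {0} = 0 := by
  rw [timeMeasure, measurableEmbedding_nnreal_coe.comap_apply]
  simp

lemma timeMeasure_Iic_lt_top (T : ℝ≥0) : timeMeasure (Iic T) < ⊤ := by
  rw [timeMeasure, measurableEmbedding_nnreal_coe.comap_apply]
  refine (measure_mono (t := Icc 0 (T : ℝ)) ?_).trans_lt measure_Icc_lt_top
  rintro _ ⟨s, hs, rfl⟩
  exact ⟨s.2, hs⟩

instance : SigmaFinite timeMeasure := by
  refine ⟨⟨⟨fun n : ℕ => Iic (n : ℝ≥0), fun _ => trivial, fun n => timeMeasure_Iic_lt_top _, ?_⟩⟩⟩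
  refine eq_univ_of_forall fun t => ?_
  obtain ⟨n, hn⟩ := exists_nat_ge t
  exact mem_iUnion.2 ⟨n, hn⟩

end TimeMeasure

section WeakConvergence

variable {X : Type*} [TopologicalSpace X] [MeasurableSpace X] [OpensMeasurableSpace X]
  {ν : ℕ → Measure X} {μ : Measure X}

lemma WeaklyConverges.tendsto_lintegral [∀ m, IsFiniteMeasureOnCompacts (ν m)]
    [IsFiniteMeasureOnCompacts μ] (h : WeaklyConverges ν μ) {f : X → ℝ} (hf : Continuous f)
    (hc : HasCompactSupport f) :
    Tendsto (fun m => ∫⁻ x, ENNReal.ofReal (f x) ∂(ν m)) atTop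
      (𝓝 (∫⁻ x, ENNReal.ofReal (f x) ∂μ)) := by
  have hg : Continuous fun x => max (f x) 0 := by fun_prop
  have hgc : HasCompactSupport fun x => max (f x) 0 :=
    hc.comp_left (g := fun y => max y 0) (by simp)
  have key : ∀ (m : Measure X) [IsFiniteMeasureOnCompacts m],
      ∫⁻ x, ENNReal.ofReal (f x) ∂m = ENNReal.ofReal (∫ x, max (f x) 0 ∂m) := by
    intro m _
    rw [ofReal_integral_eq_lintegral_ofReal (hg.integrable_of_hasCompactSupport hgc)
      (Eventually.of_forall fun x => le_max_right _ _)]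
    refine lintegral_congr fun x => ?_
    rcases le_total (f x) 0 with hx | hx
    · rw [max_eq_right hx, ENNReal.ofReal_of_nonpos hx, ENNReal.ofReal_zero]
    · rw [max_eq_left hx]
  simp_rw [key]
  exact (ENNReal.continuous_ofReal.tendsto _).comp (h _ hg hgc)

lemma integral_eq_of_lintegral_ne_top {m : Measure X}
    (hfin : ∀ f : X → ℝ, Continuous f → HasCompactSupport f →
      ∫⁻ x, ENNReal.ofReal (f x) ∂m ≠ ⊤) {f : X → ℝ} (hf : Continuous f)
    (hc : HasCompactSupport f) :
    ∫ x, f x ∂m = (∫⁻ x, ENNReal.ofReal (f x) ∂m).toReal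
      - (∫⁻ x, ENNReal.ofReal (-f x) ∂m).toReal := by
  refine integral_eq_lintegral_pos_part_sub_lintegral_neg_part
    ⟨hf.measurable.aestronglyMeasurable, ?_⟩
  rw [hasFiniteIntegral_iff_norm]
  exact (hfin _ hf.norm hc.norm).lt_top

/-- Apply the hypothesis to f and to -f: the truncation in `ENNReal.ofReal` picks out the positive
and negative parts. Lower integrals combine freely with Tonelli and disintegration. -/
lemma weaklyConverges_of_tendsto_lintegral
    (hν : ∀ m, ∀ f : X → ℝ, Continuous f → HasCompactSupport f →
      ∫⁻ x, ENNReal.ofReal (f x) ∂(ν m) ≠ ⊤)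
    (hμ : ∀ f : X → ℝ, Continuous f → HasCompactSupport f →
      ∫⁻ x, ENNReal.ofReal (f x) ∂μ ≠ ⊤)
    (h : ∀ f : X → ℝ, Continuous f → HasCompactSupport f →
      Tendsto (fun m => ∫⁻ x, ENNReal.ofReal (f x) ∂(ν m)) atTop
        (𝓝 (∫⁻ x, ENNReal.ofReal (f x) ∂μ))) : WeaklyConverges ν μ := by
  intro f hf hc
  rw [integral_eq_of_lintegral_ne_top hμ hf hc]
  simp_rw [fun m => integral_eq_of_lintegral_ne_top (hν m) hf hc]
  have hc' : HasCompactSupport fun x => -f x := hc.comp_left (g := fun y => -y) (by simp)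
  exact ((ENNReal.tendsto_toReal (hμ f hf hc)).comp (h f hf hc)).sub
    ((ENNReal.tendsto_toReal (hμ _ hf.neg hc')).comp (h _ hf.neg hc'))

end WeakConvergence

section Slices

variable {d : ℕ}

/-- Test with a continuous function that is 1 on B(0,R) and vanishes off B(0,R+1); this is why the
radius grows by 1. -/
lemma WeaklyConverges.measure_ball_le {ν : ℕ → Measure (Eucl d)} {μ : Measure (Eucl d)}
    [∀ m, IsFiniteMeasureOnCompacts (ν m)] [IsFiniteMeasureOnCompacts μ]
    (h : WeaklyConverges ν μ) {R : ℝ} {B : ℝ≥0∞}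
    (hB : ∀ m, ν m (Metric.ball 0 (R + 1)) ≤ B) : μ (Metric.ball 0 R) ≤ B := by
  set f : Eucl d → ℝ := fun x => min 1 (max 0 (R + 1 - ‖x‖)) with hf
  have h0 : ∀ x ∉ Metric.ball (0 : Eucl d) (R + 1), f x = 0 := by
    intro x hx
    have : R + 1 - ‖x‖ ≤ 0 := by simpa using hx
    simp [hf, max_eq_left this]
  have hc : HasCompactSupport f := HasCompactSupport.intro
    (isCompact_closedBall (0 : Eucl d) (R + 1))
    fun x hx => h0 x fun hx' => hx (Metric.ball_subset_closedBall hx')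
  have h1 : μ (Metric.ball 0 R) ≤ ∫⁻ x, ENNReal.ofReal (f x) ∂μ := by
    rw [← setLIntegral_one]
    refine (setLIntegral_mono' measurableSet_ball fun x hx => ?_).trans
      (setLIntegral_le_lintegral _ _)
    have : ‖x‖ < R := by simpa using hx
    rw [ENNReal.one_le_ofReal]
    exact le_min le_rfl (le_max_of_le_right (by linarith))
  refine h1.trans (le_of_tendsto' (h.tendsto_lintegral (by fun_prop) hc) fun m => ?_)
  refine le_trans ?_ (hB m)
  rw [← lintegral_indicator_one measurableSet_ball]
  refine lintegral_mono fun x => ?_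
  by_cases hx : x ∈ Metric.ball (0 : Eucl d) (R + 1)
  · simp only [hx, indicator_of_mem, Pi.one_apply]
    exact ENNReal.ofReal_le_one.2 (min_le_left _ _)
  · simp [h0 x hx]

/-- The indicator of U is the increasing limit of min(1, n·dist(x, Uᶜ)). Boundedness of U gives
these functions compact support, and nontriviality of the space ensures Uᶜ ≠ ∅, so that the distance
is positive on U. -/
lemma measurable_measure_isOpen_of_lintegral {α : Type*} [MeasurableSpace α] [Nontrivial (Eucl d)]
    {μt : α → Measure (Eucl d)}
    (h : ∀ f : Eucl d → ℝ, Continuous f → HasCompactSupport f →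
      Measurable fun t => ∫⁻ x, ENNReal.ofReal (f x) ∂(μt t))
    {U : Set (Eucl d)} (hU : IsOpen U) (hb : Bornology.IsBounded U) :
    Measurable fun t => μt t U := by
  have hne : Uᶜ.Nonempty := by
    rw [nonempty_compl]
    rintro rfl
    exact NormedSpace.unbounded_univ ℝ (Eucl d) hb
  set f : ℕ → Eucl d → ℝ := fun n x => min 1 (n * Metric.infDist x Uᶜ) with hf
  have hfc : ∀ n, Continuous (f n) := fun n =>
    continuous_const.min (continuous_const.mul (Metric.continuous_infDist_pt _))
  have hf0 : ∀ n, ∀ x ∉ U, f n x = 0 := fun n x hx => by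
    simp [hf, Metric.infDist_zero_of_mem (show x ∈ Uᶜ from hx)]
  have hsupp : ∀ n, HasCompactSupport (f n) := fun n =>
    HasCompactSupport.intro hb.isCompact_closure fun x hx =>
      hf0 n x fun hx' => hx (subset_closure hx')
  have hlim : ∀ x, Tendsto (fun n => ENNReal.ofReal (f n x)) atTop
      (𝓝 (U.indicator 1 x)) := by
    intro x
    by_cases hx : x ∈ U
    · have hpos : 0 < Metric.infDist x Uᶜ :=
        (hU.isClosed_compl.notMem_iff_infDist_pos hne).1 (by simpa using hx)
      obtain ⟨N, hN⟩ := exists_nat_ge (Metric.infDist x Uᶜ)⁻¹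
      refine tendsto_const_nhds.congr' ?_
      filter_upwards [eventually_ge_atTop N] with n hn
      have h1 : 1 ≤ n * Metric.infDist x Uᶜ := by
        have : (Metric.infDist x Uᶜ)⁻¹ ≤ n := hN.trans (by exact_mod_cast hn)
        rwa [inv_eq_one_div, div_le_iff₀ hpos] at this
      simp [hf, hx, min_eq_left h1]
    · simp [hf0 _ x hx, hx]
  have hmono : ∀ x, Monotone fun n => ENNReal.ofReal (f n x) := fun x n n' hn => by
    refine ENNReal.ofReal_le_ofReal (min_le_min le_rfl ?_)
    have : (n : ℝ) ≤ n' := by exact_mod_cast hn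
    exact mul_le_mul_of_nonneg_right this Metric.infDist_nonneg
  refine measurable_of_tendsto_metrizable (fun n => h (f n) (hfc n) (hsupp n))
    (tendsto_pi_nhds.2 fun t => ?_)
  rw [← lintegral_indicator_one hU.measurableSet]
  exact lintegral_tendsto_of_tendsto_of_monotone
    (fun n => (hfc n).measurable.ennreal_ofReal.aemeasurable) (Eventually.of_forall hmono)
    (Eventually.of_forall hlim)

/-- The π-system argument on open sets needs finite measures, hence the restriction to balls
followed by a supremum. -/
lemma measurable_measure_of_lintegral {α : Type*} [MeasurableSpace α] [Nontrivial (Eucl d)]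
    {μt : α → Measure (Eucl d)} (hfin : ∀ t, IsFiniteMeasureOnCompacts (μt t))
    (h : ∀ f : Eucl d → ℝ, Continuous f → HasCompactSupport f →
      Measurable fun t => ∫⁻ x, ENNReal.ofReal (f x) ∂(μt t)) : Measurable μt := by
  have hball : ∀ t (R : ℝ), μt t (Metric.ball 0 R) < ⊤ := fun t R => by
    have := hfin t
    exact measure_ball_lt_top
  have hN : ∀ N : ℕ, Measurable fun t => (μt t).restrict (Metric.ball 0 N) := by
    intro N
    have : ∀ t, IsFiniteMeasure ((μt t).restrict (Metric.ball 0 N)) := fun t =>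
      ⟨by simpa using hball t N⟩
    have hop : ∀ U : Set (Eucl d), IsOpen U →
        Measurable fun t => (μt t).restrict (Metric.ball 0 N) U := fun U hU => by
      simp_rw [Measure.restrict_apply hU.measurableSet]
      exact measurable_measure_isOpen_of_lintegral h (hU.inter Metric.isOpen_ball)
        (Metric.isBounded_ball.subset inter_subset_right)
    exact Measurable.measure_of_isPiSystem BorelSpace.measurable_eq isPiSystem_isOpen hop
      (hop univ isOpen_univ)
  refine Measure.measurable_measure.2 fun s hs => ?_
  have h1 : ∀ t, μt t s = ⨆ N : ℕ, (μt t).restrict (Metric.ball 0 N) s := fun t => by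
    simp_rw [Measure.restrict_apply hs]
    rw [← Monotone.measure_iUnion, ← inter_iUnion, Metric.iUnion_ball_nat, inter_univ]
    exact fun N N' hNN => inter_subset_inter_right _
      (Metric.ball_subset_ball (by exact_mod_cast hNN))
  simp_rw [h1]
  exact .iSup fun N => Measure.measurable_measure.1 (hN N) s hs

/-- Same scheme with rectangles as π-system. It makes t ↦ μ^t ⊗ δ_t an admissible integrand for
assembling a space-time measure. -/
lemma measurable_map_prodMk {α : Type*} [MeasurableSpace α] {μt : α → Measure (Eucl d)}
    (hfin : ∀ t, IsFiniteMeasureOnCompacts (μt t)) (hμ : Measurable μt) :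
    Measurable fun t => (μt t).map fun x => (x, t) := by
  have hmk : ∀ t : α, Measurable fun x : Eucl d => (x, t) := fun t => measurable_prodMk_right
  have hball : ∀ t (R : ℝ), μt t (Metric.ball 0 R) < ⊤ := fun t R => by
    have := hfin t
    exact measure_ball_lt_top
  have hN : ∀ N : ℕ, Measurable fun t =>
      ((μt t).restrict (Metric.ball 0 N)).map fun x => (x, t) := by
    intro N
    have : ∀ t, IsFiniteMeasure ((μt t).restrict (Metric.ball 0 N)) := fun t =>
      ⟨by simpa using hball t N⟩
    have hrect : ∀ (s : Set (Eucl d)) (r : Set α), MeasurableSet s → MeasurableSet r →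
        Measurable fun t => ((μt t).restrict (Metric.ball 0 N)).map (fun x => (x, t)) (s ×ˢ r) := by
      intro s r hs hr
      have h1 : ∀ t, ((μt t).restrict (Metric.ball 0 N)).map (fun x => (x, t)) (s ×ˢ r)
          = r.indicator (fun t => μt t (s ∩ Metric.ball 0 N)) t := by
        intro t
        rw [Measure.map_apply (hmk t) (hs.prod hr)]
        by_cases ht : t ∈ r
        · rw [mk_preimage_prod_left ht, Measure.restrict_apply hs, indicator_of_mem ht]
        · rw [mk_preimage_prod_left_eq_empty ht, measure_empty, indicator_of_notMem ht]
      simp_rw [h1]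
      exact (Measure.measurable_measure.1 hμ _ (hs.inter measurableSet_ball)).indicator hr
    refine Measurable.measure_of_isPiSystem generateFrom_prod.symm isPiSystem_prod ?_ ?_
    · rintro _ ⟨s, hs, r, hr, rfl⟩
      exact hrect s r hs hr
    · rw [← univ_prod_univ]
      exact hrect univ univ .univ .univ
  refine Measure.measurable_measure.2 fun s hs => ?_
  have h1 : ∀ t, (μt t).map (fun x => (x, t)) s
      = ⨆ N : ℕ, ((μt t).restrict (Metric.ball 0 N)).map (fun x => (x, t)) s := fun t => by
    have hs' := hmk t hs
    simp_rw [Measure.map_apply (hmk t) hs, Measure.restrict_apply hs']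
    rw [← Monotone.measure_iUnion, ← inter_iUnion, Metric.iUnion_ball_nat, inter_univ]
    exact fun N N' hNN => inter_subset_inter_right _
      (Metric.ball_subset_ball (by exact_mod_cast hNN))
  simp_rw [h1]
  exact .iSup fun N => Measure.measurable_measure.1 (hN N) s hs

end Slices

end

/-! ### From time slices to space-time measures -/

noncomputable section

section SpaceTime

variable {d : ℕ}

/-- The slice t = 0 involves an arbitrary choice of weak gradient, so joint measurability is only
assumed for t > 0; that slice is a null set. -/
lemma aemeasurable_of_indicator_pos_time {ρ : Eucl d × ℝ≥0 → ℝ≥0∞}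
    (hρ : Measurable ({p : Eucl d × ℝ≥0 | 0 < p.2}.indicator ρ)) :
    AEMeasurable ρ ((volume : Measure (Eucl d)).prod timeMeasure) := by
  refine ⟨_, hρ, ?_⟩
  have h : (volume : Measure (Eucl d)).prod timeMeasure (univ ×ˢ {0}) = 0 := by
    rw [Measure.prod_prod, timeMeasure_singleton_zero, mul_zero]
  rw [EventuallyEq, ae_iff]
  refine measure_mono_null (fun p hp => ?_) h
  refine ⟨trivial, by_contra fun h0 => hp ?_⟩
  rw [indicator_of_mem]
  exact pos_iff_ne_zero.2 h0

lemma measurable_slice_of_indicator_pos_time {ρ : Eucl d × ℝ≥0 → ℝ≥0∞}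
    (hρ : Measurable ({p : Eucl d × ℝ≥0 | 0 < p.2}.indicator ρ)) {t : ℝ≥0} (ht : 0 < t) :
    Measurable fun x => ρ (x, t) := by
  have h : Measurable fun x : Eucl d => {p : Eucl d × ℝ≥0 | 0 < p.2}.indicator ρ (x, t) :=
    hρ.comp measurable_prodMk_right
  exact (funext fun x => indicator_of_mem (s := {p : Eucl d × ℝ≥0 | 0 < p.2}) (a := (x, t)) ht ρ)
    ▸ h

lemma lintegral_slice_eq {ρ : Eucl d × ℝ≥0 → ℝ≥0∞}
    (hρ : Measurable ({p : Eucl d × ℝ≥0 | 0 < p.2}.indicator ρ)) {g : Eucl d × ℝ≥0 → ℝ≥0∞}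
    (hg : Measurable g) {t : ℝ≥0} (ht : 0 < t) :
    ∫⁻ x, g (x, t) ∂(volume.withDensity fun x => ρ (x, t)) = ∫⁻ x, ρ (x, t) * g (x, t) :=
  lintegral_withDensity_eq_lintegral_mul _ (measurable_slice_of_indicator_pos_time hρ ht)
    (hg.comp measurable_prodMk_right)

lemma measurable_lintegral_slice {ρ : Eucl d × ℝ≥0 → ℝ≥0∞}
    (hρ : Measurable ({p : Eucl d × ℝ≥0 | 0 < p.2}.indicator ρ)) {g : Eucl d × ℝ≥0 → ℝ≥0∞}
    (hg : Measurable g) :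
    Measurable fun t => ∫⁻ x, g (x, t) ∂(volume.withDensity fun x => ρ (x, t)) := by
  -- Changing a measurable function at the single time 0 leaves it measurable.
  refine ((hρ.mul hg).lintegral_prod_left' (μ := volume)).measurable_of_countable_ne
    ((countable_singleton 0).mono fun t ht => ?_)
  by_contra h0
  refine ht ?_
  have ht0 : 0 < t := pos_iff_ne_zero.2 h0
  rw [lintegral_slice_eq hρ hg ht0]
  refine lintegral_congr fun x => ?_
  rw [Pi.mul_apply, indicator_of_mem (s := {p : Eucl d × ℝ≥0 | 0 < p.2}) ht0]

lemma lintegral_withDensity_prod_timeMeasure {ρ : Eucl d × ℝ≥0 → ℝ≥0∞}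
    (hρ : Measurable ({p : Eucl d × ℝ≥0 | 0 < p.2}.indicator ρ)) {g : Eucl d × ℝ≥0 → ℝ≥0∞}
    (hg : Measurable g) :
    ∫⁻ p, g p ∂(((volume : Measure (Eucl d)).prod timeMeasure).withDensity ρ)
      = ∫⁻ t, ∫⁻ x, g (x, t) ∂(volume.withDensity fun x => ρ (x, t)) ∂timeMeasure := by
  have hm := aemeasurable_of_indicator_pos_time hρ
  rw [lintegral_withDensity_eq_lintegral_mul₀ hm hg.aemeasurable,
    lintegral_prod_symm _ (hm.mul hg.aemeasurable)]
  refine lintegral_congr_ae ?_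
  have h0 : ∀ᵐ t ∂timeMeasure, t ∉ ({0} : Set ℝ≥0) :=
    measure_eq_zero_iff_ae_notMem.1 timeMeasure_singleton_zero
  filter_upwards [h0] with t ht
  rw [lintegral_slice_eq hρ hg (pos_iff_ne_zero.2 ht)]
  rfl

lemma exists_lintegral_slice_le {f : Eucl d × ℝ≥0 → ℝ} (hf : Continuous f)
    (hc : HasCompactSupport f) : ∃ (c R : ℝ) (T : ℝ≥0), 0 < R ∧ ∀ (t : ℝ≥0) (ν : Measure (Eucl d)),
      ∫⁻ x, ENNReal.ofReal (f (x, t)) ∂ν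
        ≤ (Iic T).indicator (fun _ => ENNReal.ofReal c * ν (Metric.ball 0 R)) t := by
  obtain ⟨c, hcf⟩ := hf.bounded_above_of_compact_support hc
  obtain ⟨R, hR⟩ := (hc.image continuous_fst).isBounded.subset_ball 0
  obtain ⟨T, hT⟩ := (hc.image continuous_snd).bddAbove
  have hf0 : ∀ p, p ∉ tsupport f → f p = 0 := fun p => image_eq_zero_of_notMem_tsupport
  refine ⟨c, max R 1, T, by positivity, fun t ν => ?_⟩
  by_cases ht : t ∈ Iic T
  · rw [indicator_of_mem ht, ← setLIntegral_const, ← lintegral_indicator measurableSet_ball]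
    refine lintegral_mono fun x => ?_
    by_cases hx : x ∈ Metric.ball (0 : Eucl d) (max R 1)
    · rw [indicator_of_mem hx]
      exact ENNReal.ofReal_le_ofReal ((le_abs_self _).trans (hcf _))
    · rw [hf0 (x, t) fun h => hx (Metric.ball_subset_ball (le_max_left _ _)
        (hR (mem_image_of_mem Prod.fst h)))]
      simp
  · rw [indicator_of_notMem ht]
    simp_rw [fun x => hf0 (x, t) fun h => ht (hT (mem_image_of_mem Prod.snd h))]
    simp

/-- Convergence of all time slices gives convergence in space-time to the measure with the limit
slices. -/
lemma exists_weaklyConverges_isTimeDisintegration [Nontrivial (Eucl d)]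
    {ρ : ℕ → Eucl d × ℝ≥0 → ℝ≥0∞}
    (hρ : ∀ m, Measurable ({p : Eucl d × ℝ≥0 | 0 < p.2}.indicator (ρ m))) {b : ℝ → ℝ}
    (hb : ∀ m (R : ℝ) (t : ℝ≥0), 0 < R →
      volume.withDensity (fun x => ρ m (x, t)) (Metric.ball 0 R) ≤ ENNReal.ofReal (b R * (1 + t)))
    {μt : ℝ≥0 → Measure (Eucl d)} (hμfin : ∀ t, IsFiniteMeasureOnCompacts (μt t))
    (hμb : ∀ (R : ℝ) (t : ℝ≥0), 0 < R → μt t (Metric.ball 0 R) ≤ ENNReal.ofReal (b R * (1 + t)))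
    (hconv : ∀ t, WeaklyConverges (fun m => volume.withDensity fun x => ρ m (x, t)) (μt t)) :
    ∃ μ : Measure (Eucl d × ℝ≥0), IsFiniteMeasureOnCompacts μ ∧
      WeaklyConverges (fun m => ((volume : Measure (Eucl d)).prod timeMeasure).withDensity (ρ m)) μ ∧
      IsTimeDisintegration μ μt := by
  have hνfin : ∀ m t, IsFiniteMeasureOnCompacts (volume.withDensity fun x => ρ m (x, t)) :=
    fun m t => isFiniteMeasureOnCompacts_of_ball fun R =>
      (measure_mono (Metric.ball_subset_ball (le_max_left R 1))).trans_lt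
        ((hb m (max R 1) t (by positivity)).trans_lt ENNReal.ofReal_lt_top)
  have hconv' : ∀ t, ∀ f : Eucl d → ℝ, Continuous f → HasCompactSupport f →
      Tendsto (fun m => ∫⁻ x, ENNReal.ofReal (f x) ∂(volume.withDensity fun x => ρ m (x, t))) atTop
        (𝓝 (∫⁻ x, ENNReal.ofReal (f x) ∂(μt t))) := fun t f hf hfc => by
    have := hμfin t
    have := fun m => hνfin m t
    exact (hconv t).tendsto_lintegral hf hfc
  have hμm : Measurable μt := by
    refine measurable_measure_of_lintegral hμfin fun f hf hfc => ?_
    refine measurable_of_tendsto_metrizable (fun m => measurable_lintegral_slice (hρ m)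
      (g := fun p => ENNReal.ofReal (f p.1)) (hf.measurable.comp measurable_fst).ennreal_ofReal) ?_
    exact tendsto_pi_nhds.2 fun t => hconv' t f hf hfc
  have hκ := measurable_map_prodMk hμfin hμm
  -- The limit is built directly as ∫ μ^t ⊗ δ_t dt, so its disintegration is automatic and only the
  -- convergence has to be proved.
  set μ := timeMeasure.bind fun t => (μt t).map fun x => (x, t) with hμ
  have happ : ∀ A, MeasurableSet A → μ A = ∫⁻ t, μt t {x | (x, t) ∈ A} ∂timeMeasure := by
    intro A hA
    rw [hμ, Measure.bind_apply hA hκ.aemeasurable]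
    refine lintegral_congr fun t => ?_
    rw [Measure.map_apply measurable_prodMk_right hA]
    rfl
  have hlint : ∀ g : Eucl d × ℝ≥0 → ℝ≥0∞, Measurable g →
      ∫⁻ p, g p ∂μ = ∫⁻ t, ∫⁻ x, g (x, t) ∂(μt t) ∂timeMeasure := by
    intro g hg
    rw [hμ, Measure.lintegral_bind hκ.aemeasurable hg.aemeasurable]
    refine lintegral_congr fun t => ?_
    rw [lintegral_map hg measurable_prodMk_right]
  -- One integrable majorant in t for the approximating slices and the limit slices alike; it
  -- vanishes after the last time in the support of f. The absolute value of b dispenses with a sign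
  -- assumption.
  have hdom : ∀ f : Eucl d × ℝ≥0 → ℝ, Continuous f → HasCompactSupport f →
      ∃ G : ℝ≥0 → ℝ≥0∞, ∫⁻ t, G t ∂timeMeasure ≠ ⊤ ∧ ∀ (t : ℝ≥0) (ν : Measure (Eucl d)),
        (∀ R, 0 < R → ν (Metric.ball 0 R) ≤ ENNReal.ofReal (b R * (1 + t))) →
        ∫⁻ x, ENNReal.ofReal (f (x, t)) ∂ν ≤ G t := by
    intro f hf hfc
    obtain ⟨c, R, T, hR, h⟩ := exists_lintegral_slice_le hf hfc
    refine ⟨(Iic T).indicator fun _ => ENNReal.ofReal c * ENNReal.ofReal (|b R| * (1 + T)),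
      ?_, fun t ν hν => (h t ν).trans ?_⟩
    · rw [lintegral_indicator_const measurableSet_Iic]
      have := (timeMeasure_Iic_lt_top T).ne
      finiteness
    · by_cases ht : t ∈ Iic T
      · rw [indicator_of_mem ht, indicator_of_mem ht]
        have ht' : (t : ℝ) ≤ T := by exact_mod_cast ht
        gcongr
        refine (hν R hR).trans (ENNReal.ofReal_le_ofReal ?_)
        gcongr
        exact le_abs_self _
      · rw [indicator_of_notMem ht, indicator_of_notMem ht]
  have hgm : ∀ f : Eucl d × ℝ≥0 → ℝ, Continuous f → Measurable fun p => ENNReal.ofReal (f p) :=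
    fun f hf => hf.measurable.ennreal_ofReal
  refine ⟨μ, ⟨fun K hK => ?_⟩, weaklyConverges_of_tendsto_lintegral ?_ ?_ ?_, hμm, happ⟩
  · obtain ⟨R, hR⟩ := (hK.image continuous_fst).isBounded.subset_ball 0
    obtain ⟨T, hT⟩ := (hK.image continuous_snd).bddAbove
    set R' := max R 1 with hR'
    have hR0 : 0 < R' := by positivity
    have hsub : K ⊆ Metric.ball 0 R' ×ˢ Iic T := fun p hp =>
      ⟨Metric.ball_subset_ball (le_max_left _ _) (hR (mem_image_of_mem Prod.fst hp)),
        hT (mem_image_of_mem Prod.snd hp)⟩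
    refine (measure_mono hsub).trans_lt ?_
    rw [happ _ (measurableSet_ball.prod measurableSet_Iic)]
    calc ∫⁻ t, μt t {x | (x, t) ∈ Metric.ball 0 R' ×ˢ Iic T} ∂timeMeasure
        ≤ ∫⁻ t, (Iic T).indicator (fun _ => ENNReal.ofReal (|b R'| * (1 + T))) t ∂timeMeasure := by
          refine lintegral_mono fun t => ?_
          by_cases ht : t ∈ Iic T
          · have ht' : (t : ℝ) ≤ T := by exact_mod_cast ht
            rw [indicator_of_mem ht]
            refine (measure_mono fun x hx => hx.1).trans ((hμb R' t hR0).trans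
              (ENNReal.ofReal_le_ofReal ?_))
            gcongr
            exact le_abs_self _
          · have : {x : Eucl d | (x, t) ∈ Metric.ball 0 R' ×ˢ Iic T} = ∅ :=
              eq_empty_of_forall_notMem fun x hx => ht hx.2
            rw [this, measure_empty]
            exact zero_le
      _ < ⊤ := by
          rw [lintegral_indicator_const measurableSet_Iic]
          exact ENNReal.mul_lt_top ENNReal.ofReal_lt_top (timeMeasure_Iic_lt_top T)
  · intro m f hf hfc
    obtain ⟨G, hG, h⟩ := hdom f hf hfc
    rw [lintegral_withDensity_prod_timeMeasure (hρ m) (hgm f hf)]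
    exact ((lintegral_mono fun t => h t _ fun R hR => hb m R t hR).trans_lt hG.lt_top).ne
  · intro f hf hfc
    obtain ⟨G, hG, h⟩ := hdom f hf hfc
    rw [hlint _ (hgm f hf)]
    exact ((lintegral_mono fun t => h t _ fun R hR => hμb R t hR).trans_lt hG.lt_top).ne
  · intro f hf hfc
    obtain ⟨G, hG, h⟩ := hdom f hf hfc
    rw [hlint _ (hgm f hf)]
    simp_rw [fun m => lintegral_withDensity_prod_timeMeasure (hρ m) (hgm f hf)]
    refine tendsto_lintegral_of_dominated_convergence G
      (fun m => measurable_lintegral_slice (hρ m) (hgm f hf))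
      (fun m => Eventually.of_forall fun t => h t _ fun R hR => hb m R t hR) hG
      (Eventually.of_forall fun t => hconv' t (fun x => f (x, t)) (by fun_prop) ?_)
    exact HasCompactSupport.intro (hfc.image continuous_fst) fun x hx =>
      image_eq_zero_of_notMem_tsupport fun hx' => hx (mem_image_of_mem Prod.fst hx')

end SpaceTime

end

/-! ### Application to the rescaled energies -/

noncomputable section

section Compactness

variable {d : ℕ} {ε M₀ : ℝ} {u₀ : Eucl d → ℂ} {u : ℝ → Eucl d → ℂ}

lemma IsPGLSolution.measurable_indicator_density (hu : IsPGLSolution ε u₀ u) :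
    Measurable ({p : Eucl d × ℝ≥0 | 0 < p.2}.indicator fun p =>
      ENNReal.ofReal (energyDensity ε (u p.2) p.1 / |Real.log ε|)) := by
  classical
  have hs : IsOpen {p : Eucl d × ℝ≥0 | 0 < p.2} := isOpen_lt continuous_const continuous_snd
  rw [← piecewise_eq_indicator]
  refine ContinuousOn.measurable_piecewise ?_ continuousOn_const hs.measurableSet
  refine ENNReal.continuous_ofReal.comp_continuousOn (ContinuousOn.div_const ?_ _)
  have h1 : ContinuousOn (fun p : Eucl d × ℝ≥0 =>
      glEnergy ε (fun p : Eucl d × ℝ => u p.2 p.1) (p.1, (p.2 : ℝ))) {p | 0 < p.2} :=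
    (glEnergy_contDiffOn isOpen_Ioi hu.smooth).continuousOn.comp (by fun_prop)
      fun p hp => ⟨trivial, NNReal.coe_pos.2 hp⟩
  exact h1.congr fun p hp => hu.energyDensity_eq (NNReal.coe_pos.2 hp) p.1

lemma IsPGLSolution.sliceMeasure_ball_le (hd : 2 ≤ d) (hM : 0 ≤ M₀) (hε : ε ∈ Ioo (0 : ℝ) 1)
    (hu : IsPGLSolution ε u₀ u) (h0 : LocalEnergyBoundAt M₀ ε u₀) (t : ℝ≥0) {R : ℝ} (hR : 0 < R) :
    sliceMeasure ε u t (Metric.ball 0 R)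
      ≤ ENNReal.ofReal (unitBallConst d * (1 + R) ^ d * (1 + t) * M₀) := by
  have hL : 0 < |Real.log ε| := abs_pos.2 (Real.log_neg hε.1 hε.2).ne
  rw [sliceMeasure, withDensity_apply _ measurableSet_ball]
  simp_rw [div_eq_mul_inv, ENNReal.ofReal_mul (energyDensity_nonneg ε _ _)]
  rw [lintegral_mul_const' _ _ ENNReal.ofReal_ne_top]
  calc _ ≤ ENNReal.ofReal (unitBallConst d * (1 + R) ^ d * (1 + t) * M₀ * |Real.log ε|)
        * ENNReal.ofReal (|Real.log ε|⁻¹) := by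
        gcongr
        exact hu.ballEnergy_le hd hM h0 0 t.2 hR
    _ = _ := by
        rw [← ENNReal.ofReal_mul' (inv_nonneg.2 hL.le), mul_inv_cancel_right₀ hL.ne']

lemma IsPGLSolution.integral_sliceMeasure (hu : IsPGLSolution ε u₀ u) {t : ℝ≥0} (ht : 0 < t)
    (f : Eucl d → ℝ) :
    ∫ x, f x ∂(sliceMeasure ε u t) = (∫ x, energyDensity ε (u t) x * f x) / |Real.log ε| := by
  have hm : Measurable fun x => ENNReal.ofReal (energyDensity ε (u t) x / |Real.log ε|) :=
    ((hu.continuous_energyDensity (NNReal.coe_pos.2 ht)).div_const _).measurable.ennreal_ofReal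
  rw [sliceMeasure, integral_withDensity_eq_integral_toReal_smul hm
    (Eventually.of_forall fun _ => ENNReal.ofReal_lt_top), ← integral_div]
  refine integral_congr_ae (Eventually.of_forall fun x => ?_)
  simp only [smul_eq_mul]
  rw [ENNReal.toReal_ofReal (div_nonneg (energyDensity_nonneg _ _ _) (abs_nonneg _))]
  ring

/-- Up to a function of time which depends only on the cutoff, localized energies decrease. -/
lemma exists_antitoneOn_integral_sliceMeasure (hd : 2 ≤ d) (hM : 0 ≤ M₀) {χ : Eucl d → ℝ}
    (hχ : ContDiff ℝ ∞ χ) (hc : HasCompactSupport χ) : ∃ a : ℝ≥0 → ℝ,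
      ∀ (ε : ℝ) (u₀ : Eucl d → ℂ) (u : ℝ → Eucl d → ℂ), ε ∈ Ioo (0 : ℝ) 1 → IsPGLSolution ε u₀ u →
        LocalEnergyBoundAt M₀ ε u₀ →
        AntitoneOn (fun t => (∫ x, χ x ^ 2 ∂(sliceMeasure ε u t)) - a t) (Ioi 0) := by
  have hχ1 : ContDiff ℝ 1 χ := hχ.of_le (by simp)
  have hcp : ∀ i, Continuous (classicalPartial χ i) := fun i =>
    (hχ1.continuous_fderiv (by simp)).clm_apply continuous_const
  set h : Eucl d → ℝ := fun x => 2 * ∑ i, classicalPartial χ i x ^ 2 with hh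
  have hh0 : ∀ x ∉ tsupport χ, h x = 0 := by
    intro x hx
    have h0 : ∀ i, classicalPartial χ i x = 0 := fun i => by
      rw [classicalPartial, fderiv_of_notMem_tsupport (𝕜 := ℝ) hx]
      simp
    simp [hh, h0]
  obtain ⟨c, hcb⟩ := exists_bound_of_hasCompactSupport (f := h) (by fun_prop)
    (HasCompactSupport.intro hc hh0)
  obtain ⟨R₀, hR₀⟩ := hc.isBounded.subset_ball 0
  set R := max R₀ 1 with hRdef
  have hR : 0 < R := by positivity
  have hsupp : ∀ x ∉ Metric.ball (0 : Eucl d) R, h x = 0 := fun x hx =>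
    hh0 x fun hx' => hx (Metric.ball_subset_ball (le_max_left _ _) (hR₀ hx'))
  have hC := one_le_unitBallConst d
  set A := c * (unitBallConst d * (1 + R) ^ d * M₀) with hA
  -- The primitive of A(1+t), which bounds the time derivative of the localized energy. It does not
  -- depend on ε because the division by |ln ε| has removed the logarithm from the growth bound.
  refine ⟨fun t => A * (t + (t : ℝ) ^ 2 / 2), fun ε u₀ u hε hu h0 => ?_⟩
  have hL : 0 < |Real.log ε| := abs_pos.2 (Real.log_neg hε.1 hε.2).ne
  set J : ℝ → ℝ := fun s => (∫ x, energyDensity ε (u s) x * χ x ^ 2) / |Real.log ε|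
    - A * (s + s ^ 2 / 2) with hJ
  have hder : ∀ s, 0 < s → ∃ D, HasDerivAt J D s ∧ D ≤ 0 := by
    intro s hs
    obtain ⟨D, hD, hDle⟩ := hu.exists_hasDerivAt_integral_energy_mul_sq hχ hc hs
    have hq : HasDerivAt (fun s : ℝ => A * (s + s ^ 2 / 2)) (A * (1 + s)) s := by
      refine (((hasDerivAt_id' s).add
        (((hasDerivAt_id' s).pow 2).div_const 2)).const_mul A).congr_deriv ?_
      norm_num
    refine ⟨_, (hD.div_const _).sub hq, ?_⟩
    have h1 := hu.integral_sliceMeasure (t := ⟨s, hs.le⟩) hs h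
    have h2 := abs_integral_le_of_ball (by positivity)
      (hu.sliceMeasure_ball_le hd hM hε h0 ⟨s, hs.le⟩ hR) hsupp hcb
    rw [h1] at h2
    have h3 : D / |Real.log ε|
        ≤ (∫ x, energyDensity ε (u s) x * h x) / |Real.log ε| := by gcongr
    have h4 : D / |Real.log ε| ≤ c * (unitBallConst d * (1 + R) ^ d * (1 + s) * M₀) :=
      h3.trans ((le_abs_self _).trans h2)
    have h5 : c * (unitBallConst d * (1 + R) ^ d * (1 + s) * M₀) = A * (1 + s) := by
      rw [hA]
      ring
    rw [h5] at h4
    linarith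
  have hanti : AntitoneOn J (Ioi 0) := by
    refine antitoneOn_of_deriv_nonpos (convex_Ioi 0) (fun s hs => ?_) (fun s hs => ?_)
      fun s hs => ?_
    · obtain ⟨D, hD, -⟩ := hder s hs
      exact hD.continuousAt.continuousWithinAt
    · rw [interior_Ioi] at hs
      obtain ⟨D, hD, -⟩ := hder s hs
      exact hD.differentiableAt.differentiableWithinAt
    · rw [interior_Ioi] at hs
      obtain ⟨D, hD, hD0⟩ := hder s hs
      rwa [hD.deriv]
  intro s hs t ht hst
  have := hanti (show (s : ℝ) ∈ Ioi 0 from NNReal.coe_pos.2 hs)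
    (show (t : ℝ) ∈ Ioi 0 from NNReal.coe_pos.2 ht) (NNReal.coe_le_coe.2 hst)
  simp only [hJ] at this
  simp only [hu.integral_sliceMeasure hs, hu.integral_sliceMeasure ht]
  exact this

end Compactness

end

/-! ### Assembly of the two assertions -/

theorem mainTheorem10 (d : ℕ) (hd : 2 ≤ d) :
    ∃ C : ℝ, 0 < C ∧
      -- propagation in time of the local energy bound
      (∀ (M₀ : ℝ) (ε : ℝ) (u₀ : Eucl d → ℂ) (u : ℝ → Eucl d → ℂ), 0 < M₀ → 0 < ε →
        IsPGLSolution ε u₀ u → LocalEnergyBoundAt M₀ ε u₀ →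
        (∀ T : ℝ, 0 < T →
          IsPGLSolution ε (u T) (fun t => u (T + t)) ∧
          LocalEnergyBoundAt (C * (1 + T) * M₀) ε (u T)) ∧
        (∀ (t : ℝ) (y : Eucl d) (R : ℝ), 0 ≤ t → 0 < R →
          ballEnergy ε (u t) y R
            ≤ ENNReal.ofReal (C * (1 + R) ^ d * (1 + t) * M₀ * |Real.log ε|))) ∧
      -- compactness
      (∀ (M₀ : ℝ) (u₀ : ℝ → Eucl d → ℂ) (u : ℝ → ℝ → Eucl d → ℂ), 0 < M₀ →
        (∀ ε ∈ Ioo (0 : ℝ) 1, IsPGLSolution ε (u₀ ε) (u ε)) → LocalEnergyBound M₀ u₀ →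
        ∃ (ε : ℕ → ℝ) (μ : Measure (Eucl d × ℝ≥0)) (μt : ℝ≥0 → Measure (Eucl d)),
          (∀ m, ε m ∈ Ioo (0 : ℝ) 1) ∧ Tendsto ε atTop (𝓝 0) ∧
          IsFiniteMeasureOnCompacts μ ∧ (∀ t, IsFiniteMeasureOnCompacts (μt t)) ∧
          WeaklyConverges (fun m => spaceTimeMeasure (ε m) (u (ε m))) μ ∧
          (∀ t, WeaklyConverges (fun m => sliceMeasure (ε m) (u (ε m)) t) (μt t)) ∧
          (∀ (R : ℝ) (t : ℝ≥0), 0 < R →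
            μt t (Metric.ball 0 R) ≤ ENNReal.ofReal (C * (1 + t) * (1 + R) ^ d * M₀)) ∧
          IsTimeDisintegration μ μt) := by
  have hC1 := one_le_unitBallConst d
  -- The factor 2^d is needed only for the limit slices: their balls grow from R to R+1, and 1 +
  -- (R+1) ≤ 2(1+R).
  set C := unitBallConst d * 2 ^ d with hC
  have hC1C : unitBallConst d ≤ C := le_mul_of_one_le_right (by linarith) (one_le_pow₀ (by norm_num))
  have hC0 : 0 < C := by linarith
  refine ⟨C, hC0, ?_, ?_⟩
  · intro M₀ ε u₀ u hM _ hu h0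
    refine ⟨fun T hT => ⟨hu.shift hT, (hu.localEnergyBoundAt hd hM.le h0 hT).mono ?_⟩,
      fun t y R ht hR => (hu.ballEnergy_le hd hM.le h0 y ht hR).trans
        (ENNReal.ofReal_le_ofReal ?_)⟩
    · gcongr
    · gcongr
  · intro M₀ u₀ u hM hu h0
    have : Nontrivial (Eucl d) := by
      have : Nonempty (Fin d) := ⟨⟨0, by omega⟩⟩
      infer_instance
    -- The shift by 2 keeps every term strictly below 1, including m = 0.
    set e : ℕ → ℝ := fun m => 1 / ((m : ℝ) + 2) with he
    have heI : ∀ m, e m ∈ Ioo (0 : ℝ) 1 := fun m =>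
      ⟨by positivity, (div_lt_one (by positivity)).2 (by linarith [m.cast_nonneg (α := ℝ)])⟩
    have hlim : Tendsto e atTop (𝓝 0) :=
      Tendsto.const_div_atTop (tendsto_atTop_add_const_right _ _ tendsto_natCast_atTop_atTop) 1
    have hball : ∀ m (t : ℝ≥0) (R : ℝ), 0 < R → sliceMeasure (e m) (u (e m)) t (Metric.ball 0 R)
        ≤ ENNReal.ofReal (unitBallConst d * (1 + R) ^ d * (1 + t) * M₀) := fun m t R hR =>
      (hu _ (heI m)).sliceMeasure_ball_le hd hM.le (heI m) (h0 _ (heI m)) t hR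
    obtain ⟨φ, hφ, hconv⟩ := exists_strictMono_forall_integral_tendsto
      (ν := fun m t => sliceMeasure (e m) (u (e m)) t) (fun t R => by
        refine ⟨unitBallConst d * (1 + max R 1) ^ d * (1 + t) * M₀, by positivity, fun m => ?_⟩
        exact (measure_mono (Metric.ball_subset_ball (le_max_left _ _))).trans
          (hball m t _ (by positivity)))
      (fun χ hχ hc => by
        obtain ⟨a, ha⟩ := exists_antitoneOn_integral_sliceMeasure hd hM.le hχ hc
        exact ⟨a, fun m => ha _ _ _ (heI m) (hu _ (heI m)) (h0 _ (heI m))⟩)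
    have hfin : ∀ m t, IsFiniteMeasureOnCompacts (sliceMeasure (e m) (u (e m)) t) := fun m t =>
      isFiniteMeasureOnCompacts_of_ball fun R =>
        (measure_mono (Metric.ball_subset_ball (le_max_left R 1))).trans_lt
          ((hball m t _ (by positivity)).trans_lt ENNReal.ofReal_lt_top)
    choose μt hμfin hμt using fun t => exists_weaklyConverges
      (ν := fun m => sliceMeasure (e (φ m)) (u (e (φ m))) t) (hconv t)
    have hμb : ∀ (R : ℝ) (t : ℝ≥0), 0 < R →
        μt t (Metric.ball 0 R) ≤ ENNReal.ofReal (C * (1 + R) ^ d * M₀ * (1 + t)) := by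
      intro R t hR
      have := hμfin t
      refine (hμt t).measure_ball_le fun m =>
        (hball (φ m) t (R + 1) (by linarith)).trans (ENNReal.ofReal_le_ofReal ?_)
      calc unitBallConst d * (1 + (R + 1)) ^ d * (1 + t) * M₀
          ≤ unitBallConst d * (2 * (1 + R)) ^ d * (1 + t) * M₀ := by
            gcongr
            linarith
        _ = _ := by
            rw [hC, mul_pow]
            ring
    obtain ⟨μ, hμ, hμc, hμd⟩ := exists_weaklyConverges_isTimeDisintegration
      (ρ := fun m p => ENNReal.ofReal
        (energyDensity (e (φ m)) (u (e (φ m)) p.2) p.1 / |Real.log (e (φ m))|))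
      (fun m => (hu _ (heI (φ m))).measurable_indicator_density)
      (b := fun R => C * (1 + R) ^ d * M₀)
      (fun m R t hR => (hball (φ m) t R hR).trans (ENNReal.ofReal_le_ofReal (by
        calc unitBallConst d * (1 + R) ^ d * (1 + t) * M₀
            ≤ C * (1 + R) ^ d * (1 + t) * M₀ := by gcongr
          _ = _ := by ring))) hμfin hμb hμt
    refine ⟨e ∘ φ, μ, μt, fun m => heI _, hlim.comp hφ.tendsto_atTop, hμ, hμfin, hμc, hμt,
      fun R t hR => (hμb R t hR).trans (ENNReal.ofReal_le_ofReal (le_of_eq (by ring))), hμd⟩
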